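/- **Setting.** Let $\omega=e^{2\pi i/3}$, $\Lambda=\tfrac43\pi i\omega(\mathbb Z\oplus\omega\mathbb Z)\subset\mathbb C$, $\langle z,w\rangle=\operatorname{Re}(z\bar w)$, $z=x_1+ix_2$, $D_{\bar z}=\tfrac1{2i}(\partial_{x_1}+i\partial_{x_2})$, $U(z)=\sum_{k=0}^2\omega^k e^{\frac12(z\bar\omega^k-\bar z\omega^k)}$, and for $\alpha\in\mathbb C$, $t\in\mathbb R$ $$D(\alpha)=\begin{pmatrix}2D_{\bar z}&\alpha U(z)\\ \alpha U(-z)&2D_{\bar z}\end{pmatrix},\quad T_+=\begin{pmatrix}1&0\\0&0\end{pmatrix},\quad T_-=\begin{pmatrix}0&0\\0&1\end{pmatrix},\quad D_2(\alpha;t)=\begin{pmatrix}D(\alpha)&tT_+\\ tT_-&D(0)\end{pmatrix}.$$ On functions with values in $\mathbb C^{2}$ or $\mathbb C^{2}\oplus\mathbb C^2$ put, on each block $\mathbb C^2$, $\mathscr L_{\mathbf a}v(z)=\operatorname{diag}(\omega^{a_1+a_2},1)\,v(z+\mathbf a)$ for $\mathbf a=\tfrac43\pi i\omega(a_1+\omega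 a_2)\in\Lambda$; let $L^2_{\mathbf 0}$ be the space of $v\in L^2(\mathbb C/3\Lambda)$ with $\mathscr L_{\mathbf a}v=v$ for all $\mathbf a\in\Lambda$, and $H^1_{\mathbf 0}=L^2_{\mathbf 0}\cap H^1(\mathbb C/3\Lambda)$. For $\mathbf k\in\mathbb C$ and $D=D(\alpha)$ or $D=D_2(\alpha;t)$, the operator $$\begin{pmatrix}0&D^*+\bar{\mathbf k}\\ D+\mathbf k&0\end{pmatrix}\quad\text{on } L^2_{\mathbf 0}\oplus L^2_{\mathbf 0},\ \text{with domain } H^1_{\mathbf 0}\oplus H^1_{\mathbf 0},$$ is denoted by $H_{\mathbf k}(\alpha)$ or $H_{2,\mathbf k}(\alpha;t)$, respectively. Its spectrum is discrete and is listed with multiplicity as $\{\pm E_j\}_{j\ge1}$, $0\le E_1\le E_2\le\cdots$. Call $\alpha$ *magic* if for $H_{\mathbf k}(\alpha)$ one has $E_1=0$ for every $\mathbf k\in\mathbb C$; a magic $\alpha$ is *simple* if moreover $E_2>0$ for every $\mathbf k\in\mathbb C$. **Theorem.** Let $\alpha\in\mathbb C$ be magic and simple, and let $\mathbf k=K'=-i$.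 Put $D_{\mathbf k}(\alpha)=D(\alpha)+\mathbf k$ on $L^2_{\mathbf 0}(\mathbb C/3\Lambda;\mathbb C^2)$ and $e_1(z)=|\mathbb C/3\Lambda|^{-1/2}e^{i\langle z,i\rangle}(1,0)^T$, the normalized zero eigenfunction of $D_{\mathbf k}(0)$. There are complete orthonormal systems $(u_i)_{i\in\mathbb N}$ of eigenfunctions of $D_{\mathbf k}(\alpha)^*D_{\mathbf k}(\alpha)$ for its nonzero eigenvalues $z_i$ (complete: every element of $L^2_{\mathbf 0}$ orthogonal to all $u_i$ lies in $\ker D_{\mathbf k}(\alpha)$). For all such systems the series $$\sum_i\frac{1}{z_i}\,|\langle T_+e_1,D_{\mathbf k}(\alpha)u_i\rangle|^2$$ converges to the same number, which is at most $1$. With $$C=\Bigl(1-\sum_i\frac1{z_i}|\langle T_+e_1,D_{\mathbf k}(\alpha)u_i\rangle|^2\Bigr)^{1/2}$$ the first two nonnegative eigenvalues of $H_{2,\mathbf k}(\alpha;t)$ are, for all sufficiently small $t>0$, $$E_1=0,\qquad E_2=Ct+\mathcal O(t^{3/2}),$$ where the smallness of $t$ and the constant in $\mathcal O$ depend only on $\alpha$.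 -/

import Mathlib

open MeasureTheory Complex
open scoped ContDiff ComplexConjugate

noncomputable section

namespace Graphene

/-- The primitive cube root of unity `ω = exp (2πi/3)`. -/
def om : ℂ := exp (2 * Real.pi * I / 3)

/-- The point `(4/3) π i ω (s + ω r)`. For integers `s, r` these are the points of the moiré
lattice `Λ`; for multiples of `3`, the points of `3Λ`. -/
def pt (s r : ℝ) : ℂ := 4 / 3 * Real.pi * I * om * (s + om * r)

/-- The potential `U(z) = ∑_{k=0}^{2} ω^k exp ((z ω̄^k - z̄ ω^k)/2)`. -/
def U (z : ℂ) : ℂ :=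
  ∑ k ∈ Finset.range 3, om ^ k * exp ((z * conj om ^ k - conj z * om ^ k) / 2)

/-- The half-open fundamental parallelogram of `3Λ`. -/
def cell : Set ℂ :=
  {z | ∃ s ∈ Set.Ico (0 : ℝ) 3, ∃ r ∈ Set.Ico (0 : ℝ) 3, z = pt s r}

/-- Lebesgue measure of the torus `ℂ/3Λ`, carried by the fundamental parallelogram. -/
def μcell : Measure ℂ := volume.restrict cell

/-- `L²(ℂ/3Λ; ℂ^ι)`, a `3Λ`-periodic function being represented by its restriction to the
fundamental parallelogram. -/
abbrev L2 (ι : Type) [Fintype ι] : Type := Lp (EuclideanSpace ℂ ι) 2 μcell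

section operators

variable {ι : Type} [Fintype ι]

/-- The space `L²_0` of the `v ∈ L²(ℂ/3Λ; ℂ^ι)` with `𝓛_a v = v` for all `a ∈ Λ`. For
`a = (4/3) π i ω (a₁ + ω a₂)` the modified translation is
`(𝓛_a v)_j (z) = ω^(a₁+a₂) v_j (z + a)` for the components `j` of first kind (`χ j = 0`) and
`(𝓛_a v)_j (z) = v_j (z + a)` for those of second kind (`χ j = 1`). -/
def L20 (χ : ι → Fin 2) : Submodule ℂ (L2 ι) where
  carrier := {f | ∃ u : ℂ → EuclideanSpace ℂ ι,
    (∀ (a₁ a₂ : ℤ) (z : ℂ) (j : ι),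
      (if χ j = 0 then om ^ (a₁ + a₂) else 1) * u (z + pt a₁ a₂) j = u z j) ∧
    ⇑f =ᵐ[μcell] u}
  zero_mem' := ⟨fun _ => 0, by simp, Lp.coeFn_zero _ _ _⟩
  add_mem' := by
    rintro f g ⟨u, hu, hfu⟩ ⟨v, hv, hgv⟩
    refine ⟨fun z => u z + v z, fun a₁ a₂ z j => ?_, ?_⟩
    · simp only [PiLp.add_apply, mul_add, hu, hv]
    · filter_upwards [Lp.coeFn_add f g, hfu, hgv] with z h1 h2 h3
      rw [h1, Pi.add_apply, h2, h3]
  smul_mem' := by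
    rintro c f ⟨u, hu, hfu⟩
    refine ⟨fun z => c • u z, fun a₁ a₂ z j => ?_, ?_⟩
    · simp only [PiLp.smul_apply, smul_eq_mul]
      rw [mul_left_comm, hu]
    · filter_upwards [Lp.coeFn_smul c f, hfu] with z h1 h2
      rw [h1, Pi.smul_apply, h2]

/-- `g` is the weak derivative of `f` on the torus `ℂ/3Λ` in the direction `e`; the test
functions are the smooth functions on the torus. -/
def HasWeakDeriv (e : ℂ) (f g : ℂ → ℂ) : Prop :=
  ∀ φ : ℂ → ℂ, ContDiff ℝ ∞ φ → (∀ (a₁ a₂ : ℤ) (z : ℂ), φ (z + pt (3 * a₁) (3 * a₂)) = φ z) →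
    ∫ z, f z * fderiv ℝ φ z e ∂μcell = -∫ z, g z * φ z ∂μcell

/-- `v ∈ H¹(ℂ/3Λ; ℂ^ι)`, with weak derivatives `∂_{x₁} v = g₁` and `∂_{x₂} v = g₂` in `L²`. -/
def HasWeakGrad (v g₁ g₂ : L2 ι) : Prop :=
  ∀ j, HasWeakDeriv 1 (fun z => v z j) (fun z => g₁ z j) ∧
    HasWeakDeriv I (fun z => v z j) (fun z => g₂ z j)

/-- `v` lies in the domain `H¹_0 = L²_0 ∩ H¹` and `(D + k) v = w`, where `D = 2 D_{z̄} + V(z)` and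
`2 D_{z̄} = i⁻¹ (∂_{x₁} + i ∂_{x₂})`. -/
def IsD (χ : ι → Fin 2) (V : ℂ → Matrix ι ι ℂ) (k : ℂ) (v w : L2 ι) : Prop :=
  v ∈ L20 χ ∧ ∃ g₁ g₂ : L2 ι, HasWeakGrad v g₁ g₂ ∧ ∀ᵐ z ∂μcell, ∀ j,
    w z j = I⁻¹ * (g₁ z j + I * g₂ z j) + ∑ l, V z j l * v z l + k * v z j

/-- `v` lies in the domain `H¹_0` and `(D* + k̄) v = w`, where `D* = 2 D_z + V(z)ᴴ` and
`2 D_z = i⁻¹ (∂_{x₁} - i ∂_{x₂})`. -/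
def IsDadj (χ : ι → Fin 2) (V : ℂ → Matrix ι ι ℂ) (k : ℂ) (v w : L2 ι) : Prop :=
  v ∈ L20 χ ∧ ∃ g₁ g₂ : L2 ι, HasWeakGrad v g₁ g₂ ∧ ∀ᵐ z ∂μcell, ∀ j,
    w z j = I⁻¹ * (g₁ z j - I * g₂ z j) + ∑ l, (V z).conjTranspose j l * v z l + conj k * v z j

/-- `H_k (v₁, v₂) = E (v₁, v₂)` for the Bloch Hamiltonian
`H_k = [[0, D* + k̄], [D + k, 0]]` on `L²_0` with domain `H¹_0`. -/
def IsEigen (χ : ι → Fin 2) (V : ℂ → Matrix ι ι ℂ) (k : ℂ) (E : ℝ) (v : L2 ι × L2 ι) : Prop :=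
  IsDadj χ V k v.2 ((E : ℂ) • v.1) ∧ IsD χ V k v.1 ((E : ℂ) • v.2)

/-- The span of all eigenfunctions of `H_k` with an eigenvalue in `S`. Its dimension is the
number of eigenvalues in `S`, counted with multiplicity. -/
def eigenSpan (χ : ι → Fin 2) (V : ℂ → Matrix ι ι ℂ) (k : ℂ) (S : Set ℝ) :
    Submodule ℂ (L2 ι × L2 ι) :=
  Submodule.span ℂ {v | ∃ E ∈ S, IsEigen χ V k E v}

/-- `E` is the band energy `E_j` (`j = 1, 2, …`), when the spectrum of `H_k`, with multiplicity,
is listed as `{± E_j}` with `0 ≤ E_1 ≤ E_2 ≤ …` (so that the eigenvalue `0` of `H_k` has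
multiplicity twice the number of the `j` with `E_j = 0`): fewer than `2j` eigenvalues have modulus
less than `E`, and at least `2j` have modulus at most `E`. -/
def IsBandEnergy (χ : ι → Fin 2) (V : ℂ → Matrix ι ι ℂ) (k : ℂ) (j : ℕ) (E : ℝ) : Prop :=
  0 ≤ E ∧
  Module.rank ℂ (eigenSpan χ V k {x | |x| < E}) < ((2 * j : ℕ) : Cardinal) ∧
  ((2 * j : ℕ) : Cardinal) ≤ Module.rank ℂ (eigenSpan χ V k {x | |x| ≤ E})

end operators

/-- The kinds of the two components of a function on a single twisted bilayer. -/
def kind₁ : Fin 2 → Fin 2 := id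

/-- The kinds of the components for two sheets of two layers each. -/
def kind₂ : Fin 2 ⊕ Fin 2 → Fin 2 := Sum.elim id id

/-- The zeroth order part of the twisted bilayer operator
`D(α) = [[2 D_{z̄}, α U(z)], [α U(-z), 2 D_{z̄}]]`. -/
def pot₁ (α : ℂ) (z : ℂ) : Matrix (Fin 2) (Fin 2) ℂ := !![0, α * U z; α * U (-z), 0]

def Tplus : Matrix (Fin 2) (Fin 2) ℂ := !![1, 0; 0, 0]

def Tminus : Matrix (Fin 2) (Fin 2) ℂ := !![0, 0; 0, 1]

/-- The zeroth order part of `D_2(α; t) = [[D(α), t T₊], [t T₋, D(0)]]`. -/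
def pot₂ (α : ℂ) (t : ℝ) (z : ℂ) : Matrix (Fin 2 ⊕ Fin 2) (Fin 2 ⊕ Fin 2) ℂ :=
  Matrix.fromBlocks (pot₁ α z) ((t : ℂ) • Tplus) ((t : ℂ) • Tminus) (pot₁ 0 z)

/-- The set `𝒜` of magic parameters: `E_1(α, k) = 0` for every `k`. -/
def magicSet : Set ℂ := {α | ∀ k : ℂ, IsBandEnergy kind₁ (pot₁ α) k 1 0}

/-- A magic `α` is simple if `E_2(α, k) > 0` for every `k`. -/
def IsSimpleMagic (α : ℂ) : Prop :=
  α ∈ magicSet ∧ ∀ (k : ℂ) (E : ℝ), IsBandEnergy kind₁ (pot₁ α) k 2 E → 0 < E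

/-- The Dirac point `K' = -i`. -/
def Kprime : ℂ := -I

/-- The function `|ℂ/3Λ|^(-1/2) exp (i ⟨z, i⟩) (1, 0)`, where `⟨z, w⟩ = Re (z w̄)`. -/
def e₁fun (z : ℂ) : EuclideanSpace ℂ (Fin 2) :=
  !₂[(((volume.real cell) ^ (-(1 / 2) : ℝ) : ℝ) : ℂ) * exp (I * ((z * conj I).re : ℝ)), 0]

theorem volume_cell_lt_top : volume cell < ⊤ := by
  have hb : Bornology.IsBounded cell := by
    have hc : IsCompact ((fun p : ℝ × ℝ => pt p.1 p.2) '' (Set.Icc 0 3 ×ˢ Set.Icc 0 3)) := by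
      apply (isCompact_Icc.prod isCompact_Icc).image
      unfold pt
      fun_prop
    refine hc.isBounded.subset ?_
    rintro z ⟨s, hs, r, hr, rfl⟩
    exact ⟨(s, r), ⟨Set.Ico_subset_Icc_self hs, Set.Ico_subset_Icc_self hr⟩, rfl⟩
  exact hb.measure_lt_top

theorem e₁fun_memLp : MemLp e₁fun 2 μcell := by
  have : IsFiniteMeasure μcell := ⟨by simpa [μcell] using volume_cell_lt_top⟩
  have hcont : Continuous e₁fun := by
    unfold e₁fun
    refine (PiLp.continuous_toLp 2 _).comp (continuous_pi fun j => ?_)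
    fin_cases j
    · simp only [Fin.zero_eta, Matrix.cons_val_zero]
      fun_prop
    · simpa using (continuous_const : Continuous fun _ : ℂ => (0 : ℂ))
  refine MemLp.of_bound hcont.aestronglyMeasurable
    ‖(((volume.real cell) ^ (-(1 / 2) : ℝ) : ℝ) : ℂ)‖ (Filter.Eventually.of_forall fun z => ?_)
  rw [EuclideanSpace.norm_eq]
  apply Real.sqrt_le_iff.2 ⟨norm_nonneg _, ?_⟩
  have : ‖exp (I * ((z * conj I).re : ℝ))‖ = 1 := by
    rw [mul_comm]; exact norm_exp_ofReal_mul_I _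
  simp [e₁fun, Fin.sum_univ_two] at this ⊢

/-- The normalized zero eigenfunction `e₁` of `D(0) + K'` in `L²_0`. -/
def e₁ : L2 (Fin 2) := e₁fun_memLp.toLp e₁fun

/-- `T₊ e₁`. -/
def TplusE₁ : L2 (Fin 2) := (Matrix.toEuclideanCLM (𝕜 := ℂ) Tplus).compLp e₁

/-- `u_0, u_1, …` is a complete orthonormal system of eigenfunctions of `D_k(α)* D_k(α)` on `L²_0`
for its nonzero eigenvalues `z_0, z_1, …`, listed with multiplicity, and `w_i = D_k(α) u_i`. Here
`D_k(α) = D(α) + k`, and complete means that only the elements of the kernel of `D_k(α)` are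
orthogonal to all `u_i`. -/
structure IsEigensystem (α k : ℂ) (u w : ℕ → L2 (Fin 2)) (z : ℕ → ℝ) : Prop where
  orthonormal : Orthonormal ℂ u
  ne_zero : ∀ i, z i ≠ 0
  apply_D : ∀ i, IsD kind₁ (pot₁ α) k (u i) (w i)
  apply_Dadj : ∀ i, IsDadj kind₁ (pot₁ α) k (w i) ((z i : ℂ) • u i)
  complete : ∀ v ∈ L20 kind₁, (∀ i, inner ℂ (u i) v = 0) → IsD kind₁ (pot₁ α) k v 0

end Graphene

end

/-!
The idea is to write every operator as `R⁻¹ + B` with `R` compact and `B` bounded, to reduce the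
statement to linear algebra for such operators, and to compare the coupled operator with its two
uncoupled sheets.

*Reduction.* In Fourier space `2 D_{z̄}` is multiplication by the frequency `freq n`. After a fixed
shift it is invertible with compact inverse `R = freeInv`, and `D + k = R⁻¹ + B` where `B` is the
bounded operator `lowerOrder`; the weak derivatives in `IsD` and `IsDadj` thereby become the
relation `IsOp` (`isD_coe_iff`, `isDadj_coe_iff`). The antiunitary involution `v ↦ conj (v (-z))`
intertwines `D(α) + k` with its adjoint, so kernel and cokernel have the same dimension. If `α` is
magic and simple, both are lines at `K'`, spanned by unit vectors `u` and `u'`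
(`exists_lines_of_simple`). The Fredholm alternative then gives a compact pseudo-inverse `G` of
`D(α) + K'` (`IsPinv`, `exists_isPinv`). The operator `D(0) + K'` is a Fourier multiplier; its
kernel and its cokernel on `L²_0` are both spanned by `e₁ = T₊ e₁`.

*The series.* If `u_i` is a complete system of eigenfunctions and `w_i = D u_i`, then
`w_i / √z_i` together with `u'` is an orthonormal basis, and Parseval's identity for `e₁` says that
the series equals `1 - |⟨u', e₁⟩|²` (`hasSum_singular_system`). Hence `C = |⟨u', e₁⟩|`. The system
exists by the spectral theorem for `G G†` (`exists_singular_system`).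

*The first band.* Let `G₀` be the pseudo-inverse of `D(0) + K'`. Since `T₊ G₀ T₋ = 0`, the vector
`(u, -t G₀ T₋ u)` is in the kernel of the coupled operator, and `(0, e₁)` is in its cokernel, so
`E₁ = 0`.

*The second band.* If `C = 0`, there is a second vector in the kernel and in the cokernel, and
`E₂ = 0`. Otherwise kernel and cokernel are lines and `E₂` is the smallest nonzero singular value
(`IsPinv.isOpBand_two`). For the upper bound `E₂ ≤ C t`, correct `(0, e₁)` by `G` and `G₀` to a
trial function with image exactly `(t ⟨u', e₁⟩ u', 0)` (`TwoSheet.exists_trial`). For the lower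
bound, a unit vector orthogonal to the kernel whose image is `O(t)` equals a multiple of `(0, e₁)`
up to `O(t)`; pairing the first component of the equation with `u'` shows that its image has norm at
least `C t - O(t²)` (`TwoSheet.exists_lower_bound`). So the error is even of order `t²`.
-/

noncomputable section

namespace Graphene

open ContinuousLinearMap InnerProductSpace

local notation "⟪" x ", " y "⟫" => inner ℂ x y

/-! ### Operators of the form `R⁻¹ + B` and their pseudo-inverses -/

section Abstract

variable {H : Type*} [NormedAddCommGroup H] [InnerProductSpace ℂ H]

/-- `v` lies in the domain of the unbounded operator `R⁻¹ + B` and `(R⁻¹ + B) v = w`. -/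
def IsOp (R B : H →L[ℂ] H) (v w : H) : Prop := ∃ f, v = R f ∧ w = f + B v

namespace IsOp

variable {R B : H →L[ℂ] H} {v w v' w' : H}

theorem zero : IsOp R B 0 0 := ⟨0, by simp, by simp⟩

theorem add (h : IsOp R B v w) (h' : IsOp R B v' w') : IsOp R B (v + v') (w + w') := by
  obtain ⟨f, rfl, rfl⟩ := h
  obtain ⟨g, rfl, rfl⟩ := h'
  exact ⟨f + g, by simp, by simp only [map_add]; abel⟩

theorem smul (c : ℂ) (h : IsOp R B v w) : IsOp R B (c • v) (c • w) := by
  obtain ⟨f, rfl, rfl⟩ := h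
  exact ⟨c • f, by simp, by simp⟩

theorem sub (h : IsOp R B v w) (h' : IsOp R B v' w') : IsOp R B (v - v') (w - w') := by
  simpa [sub_eq_add_neg] using h.add (h'.smul (-1))

theorem unique (hR : Function.Injective R) (h : IsOp R B v w) (h' : IsOp R B v w') : w = w' := by
  obtain ⟨f, rfl, rfl⟩ := h
  obtain ⟨g, hg, rfl⟩ := h'
  rw [hR hg]

theorem inner_adjoint [CompleteSpace H] {x y : H} (h : IsOp R B v w)
    (h' : IsOp (adjoint R) (adjoint B) x y) : ⟪x, w⟫ = ⟪y, v⟫ := by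
  obtain ⟨f, rfl, rfl⟩ := h
  obtain ⟨g, rfl, rfl⟩ := h'
  simp only [inner_add_left, inner_add_right, adjoint_inner_left]

end IsOp

/-- `G` inverts `D = R⁻¹ + B` between the orthogonal complement of its kernel `ℂ u` and the
orthogonal complement of the kernel `ℂ u'` of its adjoint, and vanishes on `u'`. -/
structure IsPinv [CompleteSpace H] (R B : H →L[ℂ] H) (u u' : H) (G : H →L[ℂ] H) : Prop where
  inj : Function.Injective R
  norm_ker : ‖u‖ = 1
  norm_coker : ‖u'‖ = 1
  ker_iff : ∀ v, IsOp R B v 0 ↔ ∃ c : ℂ, v = c • u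
  coker_iff : ∀ v, IsOp (adjoint R) (adjoint B) v 0 ↔ ∃ c : ℂ, v = c • u'
  compact : IsCompactOperator G
  solves : ∀ y, ⟪u', y⟫ = 0 → IsOp R B (G y) y
  orth : ∀ y, ⟪u, G y⟫ = 0
  coker : G u' = 0
  left_inv : ∀ v y, IsOp R B v y → ⟪u, v⟫ = 0 → G y = v

/-- The Fredholm alternative for `1 + T` with `T` compact. -/
theorem exists_inverse_one_add [CompleteSpace H] {T : H →L[ℂ] H} (hT : IsCompactOperator T)
    (h : ∀ f, f + T f = 0 → f = 0) :
    ∃ S : H →L[ℂ] H, (∀ f, S (f + T f) = f) ∧ ∀ y, S y + T (S y) = y := by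
  have h1 : (-1 : ℂ) ∈ resolventSet ℂ T := by
    refine (hT.hasEigenvalue_or_mem_resolventSet (by norm_num)).resolve_left fun he => ?_
    obtain ⟨x, hx⟩ := he.exists_hasEigenvector
    refine hx.2 (h x ?_)
    have := hx.apply_eq_smul
    simp only [ContinuousLinearMap.coe_coe] at this
    rw [this]; simp
  rw [spectrum.mem_resolventSet_iff] at h1
  obtain ⟨e, he⟩ := h1.neg
  have hE : ∀ x, (e : H →L[ℂ] H) x = x + T x := by
    intro x
    rw [he]
    simp [Algebra.algebraMap_eq_smul_one, add_comm]
  refine ⟨(↑e⁻¹ : H →L[ℂ] H), fun f => ?_, fun y => ?_⟩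
  · rw [← hE]
    exact DFunLike.congr_fun (e.inv_mul) f
  · rw [← hE]
    exact DFunLike.congr_fun (e.mul_inv) y

theorem inner_self_one {u : H} (hu : ‖u‖ = 1) : ⟪u, u⟫ = 1 := by
  rw [inner_self_eq_norm_sq_to_K, hu]; simp

/-- Adding the rank one operator `v ↦ ⟪u, v⟫ u'` to `R⁻¹ + B` makes it injective, hence invertible
by the Fredholm alternative; the pseudo-inverse is this inverse composed with the projection on the
orthogonal complement of `u'`. -/
theorem exists_isPinv [CompleteSpace H] {R B : H →L[ℂ] H} {u u' : H}
    (hR : IsCompactOperator R) (inj : Function.Injective R)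
    (hu : ‖u‖ = 1) (hu' : ‖u'‖ = 1) (ker_iff : ∀ v, IsOp R B v 0 ↔ ∃ c : ℂ, v = c • u)
    (coker_iff : ∀ v, IsOp (adjoint R) (adjoint B) v 0 ↔ ∃ c : ℂ, v = c • u') :
    ∃ G, IsPinv R B u u' G := by
  have ker' : IsOp (adjoint R) (adjoint B) u' 0 := (coker_iff u').2 ⟨1, by simp⟩
  have key : ∀ f, ⟪u', f + B (R f)⟫ = 0 := fun f => by
    simpa using IsOp.inner_adjoint (v := R f) (w := f + B (R f)) ⟨f, rfl, rfl⟩ ker'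
  have huu := inner_self_one hu
  have huu' := inner_self_one hu'
  let T : H →L[ℂ] H := (B + rankOne ℂ u' u) ∘L R
  have hTapp : ∀ f, T f = B (R f) + ⟪u, R f⟫ • u' := fun f => by simp [T]
  have hTc : IsCompactOperator T := hR.clm_comp (B + rankOne ℂ u' u)
  have hT : ∀ f, f + T f = 0 → f = 0 := by
    intro f hf
    rw [hTapp, ← add_assoc] at hf
    have h1 : ⟪u, R f⟫ = 0 := by
      have := congrArg (fun x => ⟪u', x⟫) hf
      simpa only [inner_add_right _ (f + B (R f)), key, inner_smul_right, huu', mul_one, zero_add,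
        inner_zero_right] using this
    rw [h1, zero_smul, add_zero] at hf
    obtain ⟨c, hc⟩ := (ker_iff (R f)).1 ⟨f, rfl, hf.symm⟩
    rw [hc, inner_smul_right, huu, mul_one] at h1
    rw [h1, zero_smul] at hc
    exact inj (by simpa using hc)
  obtain ⟨S, hS1, hS2⟩ := exists_inverse_one_add hTc hT
  let P : H →L[ℂ] H := 1 - rankOne ℂ u' u'
  have hP : ∀ y, P y = y - ⟪u', y⟫ • u' := fun y => by simp [P]
  have hP0 : ∀ y, ⟪u', P y⟫ = 0 := fun y => by
    rw [hP, inner_sub_right, inner_smul_right, huu', mul_one, sub_self]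
  have hSP : ∀ y, ⟪u', y⟫ = 0 → ⟪u, R (S y)⟫ = 0 ∧ S y + B (R (S y)) = y := by
    intro y hy
    have h2 := hS2 y
    rw [hTapp, ← add_assoc] at h2
    have h1 : ⟪u, R (S y)⟫ = 0 := by
      have := congrArg (fun x => ⟪u', x⟫) h2
      simpa only [inner_add_right _ (S y + B (R (S y))), key, inner_smul_right, huu', mul_one,
        zero_add, hy] using this
    exact ⟨h1, by simpa [h1] using h2⟩
  refine ⟨R ∘L (S ∘L P), inj, hu, hu', ker_iff, coker_iff, ?_, ?_, ?_, ?_, ?_⟩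
  · exact hR.comp_clm (S ∘L P)
  · intro y hy
    have : P y = y := by rw [hP, hy]; simp
    refine ⟨S y, by simp [this], ?_⟩
    simp only [comp_apply, this]
    exact ((hSP y hy).2).symm
  · intro y
    exact (hSP (P y) (hP0 y)).1
  · rw [comp_apply, comp_apply, hP, huu', one_smul, sub_self, map_zero, map_zero]
  · rintro _ _ ⟨f, rfl, rfl⟩ h0
    have : P (f + B (R f)) = f + B (R f) := by rw [hP, key]; simp
    have h2 := hS1 f
    rw [hTapp, h0, zero_smul, add_zero] at h2
    simp only [comp_apply, this, h2]

namespace IsPinv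

variable [CompleteSpace H] {R B G : H →L[ℂ] H} {u u' : H}

theorem range_orth (h : IsPinv R B u u' G) {v y : H} (hv : IsOp R B v y) : ⟪u', y⟫ = 0 := by
  simpa using hv.inner_adjoint ((h.coker_iff u').2 ⟨1, by simp⟩)

theorem decomp (h : IsPinv R B u u' G) (y : H) : ∃ y', ⟪u', y'⟫ = 0 ∧ y = y' + ⟪u', y⟫ • u' :=
  ⟨y - ⟪u', y⟫ • u', by
    rw [inner_sub_right, inner_smul_right, inner_self_one h.norm_coker, mul_one, sub_self], by simp⟩

/-- The adjoint of the pseudo-inverse of an operator is the pseudo-inverse of its adjoint. -/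
theorem adjoint_isPinv (h : IsPinv R B u u' G) (hR : IsCompactOperator (adjoint R))
    (inj : Function.Injective (adjoint R)) :
    IsPinv (adjoint R) (adjoint B) u' u (adjoint G) := by
  obtain ⟨G', hG'⟩ := exists_isPinv (B := ContinuousLinearMap.adjoint B) hR inj h.norm_coker
    h.norm_ker h.coker_iff
    (by simpa using h.ker_iff)
  have : G' = ContinuousLinearMap.adjoint G := by
    rw [eq_adjoint_iff]
    intro x y
    obtain ⟨x', hx', hx⟩ := hG'.decomp x
    obtain ⟨y', hy', hy⟩ := h.decomp y
    have h1 := (h.solves y' hy').inner_adjoint (hG'.solves x' hx')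
    rw [hx, hy]
    simp only [map_add, map_smul, h.coker, hG'.coker, inner_add_left, inner_add_right,
      inner_smul_left, inner_smul_right, h.orth, smul_zero, add_zero]
    have h2 : ⟪G' x', u'⟫ = 0 := by
      rw [← inner_conj_symm, hG'.orth, map_zero]
    rw [h2, mul_zero, mul_zero, add_zero, add_zero, h1]
  rwa [this] at hG'

end IsPinv

/-- A nonzero compact operator attains its norm at a pair of singular vectors. -/
theorem exists_max_singular [CompleteSpace H] {G : H →L[ℂ] H} (hG : IsCompactOperator G)
    (h0 : G ≠ 0) :
    ∃ x y : H, x ≠ 0 ∧ G y = (‖G‖ : ℂ) • x ∧ adjoint G x = (‖G‖ : ℂ) • y := by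
  have hn : ‖G‖ ≠ 0 := by simpa using h0
  set T : H →L[ℂ] H := G ∘L adjoint G with hTd
  have hTn : ‖T‖ = ‖G‖ * ‖G‖ := by
    have := norm_adjoint_comp_self (adjoint G)
    rwa [adjoint_adjoint, LinearIsometryEquiv.norm_map] at this
  have hTc : IsCompactOperator T := hG.comp_clm (adjoint G)
  have hTs : IsSelfAdjoint T := by
    rw [isSelfAdjoint_iff', hTd, adjoint_comp, adjoint_adjoint]
  have hT0 : T ≠ 0 := by
    intro h; rw [h, norm_zero] at hTn
    exact (mul_ne_zero hn hn) hTn.symm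
  have : Nontrivial H := by
    by_contra hc
    rw [not_nontrivial_iff_subsingleton] at hc
    exact h0 (Subsingleton.elim _ _)
  obtain ⟨μ, hμ, hμn⟩ := spectrum.exists_nnnorm_eq_spectralRadius T
  replace hμn := hμn.trans (ContinuousLinearMap.spectralRadius_eq_nnnorm T hTs)
  have hμn' : ‖μ‖ = ‖G‖ * ‖G‖ := by
    rw [← hTn]; exact congrArg NNReal.toReal (ENNReal.coe_injective hμn)
  have hμ0 : μ ≠ 0 := by
    rw [← norm_ne_zero_iff, hμn']; exact mul_ne_zero hn hn
  obtain ⟨x, hx⟩ := ((hTc.hasEigenvalue_iff_mem_spectrum hμ0).2 hμ).exists_hasEigenvector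
  have hx1 : T x = μ • x := hx.apply_eq_smul
  have hx0 : x ≠ 0 := hx.2
  have hxn : (‖x‖ : ℂ) ^ 2 ≠ 0 := by simpa using hx0
  have h1 : μ * (‖x‖ : ℂ) ^ 2 = (‖adjoint G x‖ : ℂ) ^ 2 := by
    have h2 : ⟪x, T x⟫ = (‖adjoint G x‖ : ℂ) ^ 2 := by
      rw [hTd, comp_apply, ← adjoint_inner_left, inner_self_eq_norm_sq_to_K]; rfl
    rw [← h2, hx1, inner_smul_right, inner_self_eq_norm_sq_to_K]; rfl
  have hμr : μ = ((‖adjoint G x‖ ^ 2 / ‖x‖ ^ 2 : ℝ) : ℂ) := by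
    push_cast; rw [← h1, mul_div_cancel_right₀ _ hxn]
  have hμe : μ = (‖G‖ : ℂ) * ‖G‖ := by
    have : ‖μ‖ = ‖adjoint G x‖ ^ 2 / ‖x‖ ^ 2 := by
      rw [hμr, norm_real, Real.norm_of_nonneg (by positivity)]
    rw [hμr, ← this, hμn']; push_cast; rfl
  refine ⟨x, (‖G‖ : ℂ)⁻¹ • adjoint G x, hx0, ?_, ?_⟩
  · have : G (adjoint G x) = μ • x := hx1
    rw [map_smul, this, hμe, smul_smul]
    congr 1
    have : (‖G‖ : ℂ) ≠ 0 := by exact_mod_cast hn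
    field_simp
  · rw [smul_smul, mul_inv_cancel₀ (by exact_mod_cast hn), one_smul]

end Abstract

/-! ### Singular systems -/

section Abstract

variable {H : Type*} [NormedAddCommGroup H] [InnerProductSpace ℂ H]

theorem countable_of_orthonormal {σ : Type*} [TopologicalSpace.SeparableSpace H] {v : σ → H}
    (hv : Orthonormal ℂ v) : Countable σ := by
  have hd : Pairwise (Function.onFun Disjoint fun i => Metric.ball (v i) (1 / 2)) := by
    intro i j hij
    refine Metric.ball_disjoint_ball ?_
    have h1 : ‖v i - v j‖ ^ 2 = 2 := by
      rw [@norm_sub_sq ℂ, hv.2 hij, hv.1 i, hv.1 j]; simp; norm_num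
    rw [dist_eq_norm]
    nlinarith [norm_nonneg (v i - v j)]
  have := hd.countable_of_isOpen_disjoint (fun i => Metric.isOpen_ball)
    (fun i => ⟨v i, Metric.mem_ball_self (by norm_num)⟩)
  exact this

variable [CompleteSpace H] {R B G : H →L[ℂ] H} {u u' : H}

/-- The singular vectors of `D = R⁻¹ + B` are the eigenvectors of the compact selfadjoint operator
`G G†`, whose nonzero eigenvalues are the reciprocals of those of `D† D`. -/
theorem exists_singular_system [TopologicalSpace.SeparableSpace H]
    (hinf : ¬ FiniteDimensional ℂ H) (h : IsPinv R B u u' G)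
    (h' : IsPinv (adjoint R) (adjoint B) u' u (adjoint G)) :
    ∃ (v w : ℕ → H) (z : ℕ → ℝ), Orthonormal ℂ v ∧ (∀ i, z i ≠ 0) ∧
      (∀ i, IsOp R B (v i) (w i)) ∧
      (∀ i, IsOp (adjoint R) (adjoint B) (w i) ((z i : ℂ) • v i)) ∧
      ∀ x, (∀ i, ⟪v i, x⟫ = 0) → IsOp R B x 0 := by
  set T : H →L[ℂ] H := G ∘L adjoint G with hTd
  have hTc : IsCompactOperator T := h.compact.comp_clm (adjoint G)
  have hTsa : IsSelfAdjoint T := by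
    rw [isSelfAdjoint_iff', hTd, adjoint_comp, adjoint_adjoint]
  have hTs : T.IsSymmetric := hTsa.isSymmetric
  have hfin : ∀ μ : {μ : ℂ // μ ≠ 0},
      FiniteDimensional ℂ (Module.End.eigenspace T.toLinearMap μ.1) :=
    fun μ => finite_dimensional_eigenspace hTc μ.1 μ.2
  let V : {μ : ℂ // μ ≠ 0} → Submodule ℂ H := fun μ => Module.End.eigenspace T.toLinearMap μ.1
  have hV : OrthogonalFamily ℂ (fun μ => V μ) fun μ => (V μ).subtypeₗᵢ :=
    hTs.orthogonalFamily_eigenspaces.comp Subtype.val_injective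
  let b : ∀ μ, OrthonormalBasis (Fin (Module.finrank ℂ (V μ))) ℂ (V μ) :=
    fun μ => stdOrthonormalBasis ℂ (V μ)
  let U : (Σ μ, Fin (Module.finrank ℂ (V μ))) → H := fun s => (V s.1).subtypeₗᵢ (b s.1 s.2)
  have hU : Orthonormal ℂ U := hV.orthonormal_sigma_orthonormal fun μ => (b μ).orthonormal
  have hUT : ∀ s, T (U s) = s.1.1 • U s := fun s => Module.End.mem_eigenspace_iff.1 (b s.1 s.2).2
  -- The eigenvalues of `G G†` are real.
  have hreal : ∀ s : (Σ μ, Fin (Module.finrank ℂ (V μ))), (s.1.1 : ℂ) = ((s.1.1.re : ℝ) : ℂ) := by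
    intro s
    have h1 : ⟪U s, T (U s)⟫ = (‖adjoint G (U s)‖ : ℂ) ^ 2 := by
      rw [hTd, comp_apply, ← adjoint_inner_left, inner_self_eq_norm_sq_to_K]; rfl
    rw [hUT, inner_smul_right, inner_self_one (hU.1 s), mul_one] at h1
    rw [h1]; norm_cast
  let W : (Σ μ, Fin (Module.finrank ℂ (V μ))) → H := fun s => s.1.1⁻¹ • adjoint G (U s)
  have hGW : ∀ s, G (W s) = U s := by
    intro s
    have : G (adjoint G (U s)) = s.1.1 • U s := hUT s
    rw [map_smul, this, smul_smul, inv_mul_cancel₀ s.1.2, one_smul]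
  have hD : ∀ s, IsOp R B (U s) (W s) := by
    intro s
    rw [← hGW]
    refine h.solves _ ?_
    rw [inner_smul_right, h'.orth, mul_zero]
  have hD' : ∀ s, IsOp (adjoint R) (adjoint B) (W s) ((((s.1.1.re)⁻¹ : ℝ) : ℂ) • U s) := by
    intro s
    have : W s = adjoint G (s.1.1⁻¹ • U s) := by simp [W]
    have hz : ((((s.1.1.re)⁻¹ : ℝ) : ℂ) • U s) = s.1.1⁻¹ • U s := by
      rw [ofReal_inv, ← hreal s]
    rw [this, hz]
    refine h'.solves _ ?_
    rw [inner_smul_right, ← hGW s, h.orth, mul_zero]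
  have hker : ∀ x, (∀ s, ⟪U s, x⟫ = 0) → ∃ c : ℂ, x = c • u := by
    intro x hx
    have hTx : T x = 0 := by
      set K := Module.End.eigenspace T.toLinearMap (0 : ℂ) with hK
      have hKc : IsClosed (K : Set H) := by
        have : (K : Set H) = {y | T y = 0} := by
          ext y
          simp [hK]
        rw [this]
        exact isClosed_eq T.continuous continuous_const
      have : CompleteSpace K := hKc.completeSpace_coe
      have hmem : x - K.starProjection x ∈ (⨆ μ, Module.End.eigenspace T.toLinearMap μ)ᗮ := by
        rw [Submodule.mem_orthogonal]
        intro y hy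
        refine Submodule.iSup_induction _ (motive := fun y => ⟪y, x - K.starProjection x⟫ = 0) hy
          ?_ (by simp) (fun a b ha hb => by rw [inner_add_left, ha, hb, add_zero])
        intro μ y hy
        by_cases hμ : μ = 0
        · subst hμ
          exact Submodule.sub_starProjection_mem_orthogonal x y hy
        · have h1 : ⟪y, K.starProjection x⟫ = 0 :=
            hTs.orthogonalFamily_eigenspaces hμ ⟨y, hy⟩
              ⟨K.starProjection x, Submodule.starProjection_apply_mem K x⟩
          have h2 : ⟪y, x⟫ = 0 := by
            have hy' := (b ⟨μ, hμ⟩).sum_repr ⟨y, hy⟩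
            have hy'' : y = ∑ i, (b ⟨μ, hμ⟩).repr ⟨y, hy⟩ i • U ⟨⟨μ, hμ⟩, i⟩ := by
              have := congrArg (fun a : V ⟨μ, hμ⟩ => (a : H)) hy'
              simpa [U] using this.symm
            rw [hy'', sum_inner]
            exact Finset.sum_eq_zero fun i _ => by rw [inner_smul_left, hx, mul_zero]
          rw [inner_sub_right, h1, h2, sub_zero]
      rw [orthogonalComplement_iSup_eigenspaces_eq_bot hTc hTs, Submodule.mem_bot,
        sub_eq_zero] at hmem
      have : x ∈ K := by rw [hmem]; exact Submodule.starProjection_apply_mem K x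
      simpa [hK] using this
    have hGx : adjoint G x = 0 := by
      have h1 : ⟪x, T x⟫ = (‖adjoint G x‖ : ℂ) ^ 2 := by
        rw [hTd, comp_apply, ← adjoint_inner_left, inner_self_eq_norm_sq_to_K]; rfl
      rw [hTx, inner_zero_right] at h1
      simpa using h1.symm
    obtain ⟨y, hy, hxy⟩ := h'.decomp x
    have h2 : adjoint G y = 0 := by
      have := hGx
      rw [hxy, map_add, map_smul, h'.coker, smul_zero, add_zero] at this
      exact this
    have h3 := h'.solves y hy
    rw [h2] at h3
    have h4 := h3.unique h'.inj IsOp.zero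
    exact ⟨⟪u, x⟫, by rw [h4, zero_add] at hxy; exact hxy⟩
  have hcount : Countable (Σ μ, Fin (Module.finrank ℂ (V μ))) := countable_of_orthonormal hU
  have hinfσ : Infinite (Σ μ, Fin (Module.finrank ℂ (V μ))) := by
    by_contra hc
    rw [not_infinite_iff_finite] at hc
    apply hinf
    let S := Submodule.span ℂ (Set.range U ∪ {u})
    have hSf : FiniteDimensional ℂ S :=
      FiniteDimensional.span_of_finite ℂ ((Set.finite_range U).union (Set.finite_singleton u))
    have hSb : Sᗮ = ⊥ := by
      rw [Submodule.eq_bot_iff]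
      intro x hx
      rw [Submodule.mem_orthogonal] at hx
      obtain ⟨c, hc⟩ := hker x fun s => hx _ (Submodule.subset_span (Or.inl ⟨s, rfl⟩))
      have := hx u (Submodule.subset_span (Or.inr rfl))
      rw [hc, inner_smul_right, inner_self_one h.norm_ker, mul_one] at this
      rw [hc, this, zero_smul]
    rw [Submodule.orthogonal_eq_bot_iff] at hSb
    rw [hSb] at hSf
    exact Module.finite_def.2 (Submodule.fg_top _ |>.1 (Module.finite_def.1 hSf))
  obtain ⟨e⟩ : Nonempty (ℕ ≃ Σ μ, Fin (Module.finrank ℂ (V μ))) := nonempty_equiv_of_countable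
  refine ⟨U ∘ e, W ∘ e, fun i => ((e i).1.1.re)⁻¹, hU.comp _ e.injective, fun i => ?_,
    fun i => hD _, fun i => ?_, fun x hx => ?_⟩
  · have := (e i).1.2
    rw [hreal (e i)] at this
    exact inv_ne_zero (by exact_mod_cast this)
  · exact hD' (e i)
  · refine (h.ker_iff x).2 (hker x fun s => ?_)
    simpa using hx (e.symm s)

/-- Parseval's identity for the orthonormal basis of `H` that consists of the normalized images of
the `v i` under `D = R⁻¹ + B` and of the unit vector `u'` in the cokernel. -/
theorem hasSum_singular_system (h : IsPinv R B u u' G)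
    {v w : ℕ → H} {z : ℕ → ℝ} (hv : Orthonormal ℂ v) (hz : ∀ i, z i ≠ 0)
    (hD : ∀ i, IsOp R B (v i) (w i))
    (hD' : ∀ i, IsOp (adjoint R) (adjoint B) (w i) ((z i : ℂ) • v i))
    (hc : ∀ x, (∀ i, ⟪v i, x⟫ = 0) → IsOp R B x 0) {e : H} (he : ‖e‖ = 1) :
    HasSum (fun i => ‖⟪e, w i⟫‖ ^ 2 / z i) (1 - ‖⟪u', e⟫‖ ^ 2) := by
  have hww : ∀ i j, ⟪w i, w j⟫ = if i = j then (z i : ℂ) else 0 := by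
    intro i j
    rw [(hD j).inner_adjoint (hD' i), inner_smul_left, orthonormal_iff_ite.1 hv]
    split_ifs <;> simp
  have hzpos : ∀ i, 0 < z i := by
    intro i
    have h1 := hww i i
    rw [if_pos rfl, inner_self_eq_norm_sq_to_K] at h1
    have h2 : ‖w i‖ ^ 2 = z i := Complex.ofReal_injective (by push_cast; exact h1)
    exact lt_of_le_of_ne (h2 ▸ by positivity) (hz i).symm
  have hsq : ∀ i, ((Real.sqrt (z i) : ℝ) : ℂ) ^ 2 = z i := fun i => by
    exact_mod_cast Real.sq_sqrt (hzpos i).le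
  have hs0 : ∀ i, ((Real.sqrt (z i) : ℝ) : ℂ) ≠ 0 := fun i => by
    exact_mod_cast (Real.sqrt_pos.2 (hzpos i)).ne'
  let f : Option ℕ → H := fun o => o.elim u' fun i => ((Real.sqrt (z i) : ℝ) : ℂ)⁻¹ • w i
  have hf : Orthonormal ℂ f := by
    rw [orthonormal_iff_ite]
    rintro (_ | i) (_ | j)
    · simpa [f] using inner_self_one h.norm_coker
    · simp only [f, Option.elim, inner_smul_right, h.range_orth (hD j)]
      simp
    · simp only [f, Option.elim, inner_smul_left]
      rw [← inner_conj_symm, h.range_orth (hD i)]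
      simp
    · simp only [f, Option.elim, inner_smul_left, inner_smul_right, hww, Option.some.injEq]
      split_ifs with hij
      · subst hij
        rw [← hsq i, map_inv₀, conj_ofReal]
        have := hs0 i
        field_simp
      · simp
  have hfc : (Submodule.span ℂ (Set.range f))ᗮ = ⊥ := by
    rw [Submodule.eq_bot_iff]
    intro y hy
    rw [Submodule.mem_orthogonal] at hy
    have h1 : ⟪u', y⟫ = 0 := hy _ (Submodule.subset_span ⟨none, rfl⟩)
    have h2 : ∀ i, ⟪w i, y⟫ = 0 := fun i => by
      have := hy _ (Submodule.subset_span ⟨some i, rfl⟩)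
      simp only [f, Option.elim, inner_smul_left] at this
      exact (mul_eq_zero.1 this).resolve_left (by simpa using (Real.sqrt_pos.2 (hzpos i)).ne')
    have h3 := h.solves y h1
    have h4 : IsOp R B (G y) 0 := by
      refine hc _ fun i => ?_
      have := h3.inner_adjoint (hD' i)
      rw [h2, inner_smul_left] at this
      exact (mul_eq_zero.1 this.symm).resolve_left (by simpa using hz i)
    exact h3.unique h.inj h4
  let b := HilbertBasis.mkOfOrthogonalEqBot hf hfc
  have hb : ⇑b = f := HilbertBasis.coe_mkOfOrthogonalEqBot hf hfc
  have hsum := b.hasSum_inner_mul_inner e e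
  rw [hb, inner_self_one he] at hsum
  have hsum2 : HasSum (fun o => ‖⟪e, f o⟫‖ ^ 2) 1 := by
    have h1 : HasSum (fun o => ((‖⟪e, f o⟫‖ ^ 2 : ℝ) : ℂ)) ((1 : ℝ) : ℂ) := by
      convert! hsum using 1
      · ext o
        rw [← inner_conj_symm (f o) e, mul_conj, normSq_eq_norm_sq]
    exact_mod_cast h1
  have hsum3 := (Option.some_injective ℕ).hasSum_iff (f := fun o => if o = none then 0 else
    ‖⟪e, f o⟫‖ ^ 2) (a := 1 - ‖⟪e, f none⟫‖ ^ 2) (fun o ho => by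
      cases o with
      | none => simp
      | some i => exact absurd ⟨i, rfl⟩ ho)
  have hsum4 := hsum3.2 (hasSum_ite_sub_hasSum hsum2 none)
  rw [norm_inner_symm u' e]
  convert! hsum4 using 1
  ext i
  simp only [f, Function.comp, Option.elim, inner_smul_right, norm_mul, norm_inv, norm_real,
    reduceCtorEq, if_false, mul_pow, inv_pow, Real.norm_of_nonneg (Real.sqrt_nonneg _),
    Real.sq_sqrt (hzpos i).le]
  rw [div_eq_inv_mul]

end Abstract

/-! ### Band energies of abstract block operators -/

section Abstract

variable {H : Type*} [NormedAddCommGroup H] [InnerProductSpace ℂ H]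

theorem natCast_le_rank {V : Type*} [AddCommGroup V] [Module ℂ V] (W : Submodule ℂ V) {n : ℕ}
    {f : Fin n → V} (hf : LinearIndependent ℂ f) (hW : ∀ i, f i ∈ W) :
    (n : Cardinal) ≤ Module.rank ℂ W := by
  have : LinearIndependent ℂ fun i => (⟨f i, hW i⟩ : W) :=
    LinearIndependent.of_comp W.subtype hf
  simpa using this.cardinal_lift_le_rank

theorem two_le_rank (W : Submodule ℂ (H × H)) {a c : H} (ha : a ≠ 0) (hc : c ≠ 0)
    (haW : (a, 0) ∈ W) (hcW : (0, c) ∈ W) : ((2 * 1 : ℕ) : Cardinal) ≤ Module.rank ℂ W := by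
  refine natCast_le_rank W (f := ![(a, 0), (0, c)]) ?_ ?_
  · rw [LinearIndependent.pair_iff]
    intro s t h
    simp only [Prod.smul_mk, Prod.mk_add_mk, smul_zero, add_zero, zero_add, Prod.mk_eq_zero,
      smul_eq_zero, ha, hc, or_false] at h
    exact h
  · intro i
    fin_cases i
    · exact haW
    · exact hcW

theorem four_le_rank (W : Submodule ℂ (H × H)) {a b c d : H}
    (hab : LinearIndependent ℂ ![a, b]) (hcd : LinearIndependent ℂ ![c, d])
    (haW : (a, 0) ∈ W) (hbW : (b, 0) ∈ W) (hcW : (0, c) ∈ W) (hdW : (0, d) ∈ W) :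
    ((2 * 2 : ℕ) : Cardinal) ≤ Module.rank ℂ W := by
  rw [LinearIndependent.pair_iff] at hab hcd
  refine natCast_le_rank W (f := ![(a, 0), (b, 0), (0, c), (0, d)]) ?_ ?_
  · rw [Fintype.linearIndependent_iff]
    intro g hg
    simp only [Nat.reduceMul, Fin.sum_univ_four, Matrix.cons_val, Prod.smul_mk, Prod.mk_add_mk,
      smul_zero, add_zero, zero_add, Prod.mk_eq_zero] at hg
    obtain ⟨h0, h1⟩ := hab _ _ hg.1
    obtain ⟨h2, h3⟩ := hcd _ _ hg.2
    intro i
    fin_cases i <;> assumption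
  · intro i
    fin_cases i <;> assumption

theorem linearIndependent_pair_of_orth {a b : H} (ha : a ≠ 0) (hb : b ≠ 0) (h : ⟪a, b⟫ = 0) :
    LinearIndependent ℂ ![a, b] := by
  rw [LinearIndependent.pair_iff]
  intro s t hst
  have h1 : s = 0 := by
    have := congrArg (fun x => ⟪a, x⟫) hst
    simpa [inner_add_right, inner_smul_right, h, ha] using this
  subst h1
  simpa [hb] using hst

theorem rank_span_pair_lt {V : Type*} [AddCommGroup V] [Module ℂ V] {W : Submodule ℂ V} {a b : V}
    (hW : W ≤ Submodule.span ℂ {a, b}) : Module.rank ℂ W < ((2 * 2 : ℕ) : Cardinal) := by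
  classical
  have h1 : Module.rank ℂ (Submodule.span ℂ (({a, b} : Finset V) : Set V)) ≤ 2 :=
    (rank_span_finset_le _).trans (by exact_mod_cast Finset.card_le_two)
  have h2 := (Submodule.rank_mono (by simpa using hW)).trans h1
  exact h2.trans_lt (by norm_cast)

variable [CompleteSpace H]

/-- `E` is an eigenvalue, with eigenvector `v`, of the block operator `[[0, D†], [D, 0]]` for
`D = R⁻¹ + B`. -/
def OpEigen (R B : H →L[ℂ] H) (E : ℝ) (v : H × H) : Prop :=
  IsOp (adjoint R) (adjoint B) v.2 ((E : ℂ) • v.1) ∧ IsOp R B v.1 ((E : ℂ) • v.2)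

/-- The span of the eigenvectors of `[[0, D†], [D, 0]]` with an eigenvalue in `S`. -/
def opSpan (R B : H →L[ℂ] H) (S : Set ℝ) : Submodule ℂ (H × H) :=
  Submodule.span ℂ {v | ∃ E ∈ S, OpEigen R B E v}

/-- `E` is the `j`-th smallest nonnegative eigenvalue of `[[0, D†], [D, 0]]`; compare
`IsBandEnergy`. -/
def IsOpBand (R B : H →L[ℂ] H) (j : ℕ) (E : ℝ) : Prop :=
  0 ≤ E ∧ Module.rank ℂ (opSpan R B {x | |x| < E}) < ((2 * j : ℕ) : Cardinal) ∧
    ((2 * j : ℕ) : Cardinal) ≤ Module.rank ℂ (opSpan R B {x | |x| ≤ E})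

variable {R B G : H →L[ℂ] H} {u u' : H}

theorem mem_opSpan_left {v : H} {E : ℝ} (hE : 0 ≤ E) (hv : IsOp R B v 0) :
    (v, 0) ∈ opSpan R B {x | |x| ≤ E} :=
  Submodule.subset_span ⟨0, by simpa using hE, by simpa using IsOp.zero, by simpa using hv⟩

theorem mem_opSpan_right {v : H} {E : ℝ} (hE : 0 ≤ E) (hv : IsOp (adjoint R) (adjoint B) v 0) :
    (0, v) ∈ opSpan R B {x | |x| ≤ E} :=
  Submodule.subset_span ⟨0, by simpa using hE, by simpa using hv, by simpa using IsOp.zero⟩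

theorem rank_opSpan_lt_zero (j : ℕ) (hj : 0 < j) :
    Module.rank ℂ (opSpan R B {x | |x| < 0}) < ((2 * j : ℕ) : Cardinal) := by
  have : opSpan R B {x | |x| < 0} = ⊥ := by
    rw [opSpan, Submodule.span_eq_bot]
    rintro v ⟨E, hE, -⟩
    exact absurd hE (not_lt.2 (abs_nonneg E))
  rw [this, rank_bot]
  exact_mod_cast (by omega : 0 < 2 * j)

theorem isOpBand_one_zero {a c : H} (ha0 : a ≠ 0) (hc0 : c ≠ 0) (ha : IsOp R B a 0)
    (hc : IsOp (adjoint R) (adjoint B) c 0) : IsOpBand R B 1 0 :=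
  ⟨le_rfl, rank_opSpan_lt_zero 1 one_pos,
    two_le_rank _ ha0 hc0 (mem_opSpan_left le_rfl ha) (mem_opSpan_right le_rfl hc)⟩

theorem isOpBand_two_zero {a b c d : H} (hab : LinearIndependent ℂ ![a, b])
    (hcd : LinearIndependent ℂ ![c, d]) (ha : IsOp R B a 0) (hb : IsOp R B b 0)
    (hc : IsOp (adjoint R) (adjoint B) c 0) (hd : IsOp (adjoint R) (adjoint B) d 0) :
    IsOpBand R B 2 0 :=
  ⟨le_rfl, rank_opSpan_lt_zero 2 two_pos, four_le_rank _ hab hcd (mem_opSpan_left le_rfl ha)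
    (mem_opSpan_left le_rfl hb) (mem_opSpan_right le_rfl hc) (mem_opSpan_right le_rfl hd)⟩

namespace IsPinv

theorem ker (h : IsPinv R B u u' G) : IsOp R B u 0 := (h.ker_iff u).2 ⟨1, by simp⟩

theorem coker_mem (h : IsPinv R B u u' G) : IsOp (ContinuousLinearMap.adjoint R)
    (ContinuousLinearMap.adjoint B) u' 0 := (h.coker_iff u').2 ⟨1, by simp⟩

theorem ne_zero_ker (h : IsPinv R B u u' G) : u ≠ 0 := by
  rintro rfl; simpa using h.norm_ker

theorem ne_zero_coker (h : IsPinv R B u u' G) : u' ≠ 0 := by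
  rintro rfl; simpa using h.norm_coker

/-- If the kernel and the cokernel of `D` are lines, then the second band energy is the reciprocal
of the norm of the pseudo-inverse, which is the smallest nonzero singular value of `D`. -/
theorem isOpBand_two (h : IsPinv R B u u' G)
    (h' : IsPinv (ContinuousLinearMap.adjoint R) (ContinuousLinearMap.adjoint B) u' u
      (ContinuousLinearMap.adjoint G)) (h0 : G ≠ 0) :
    IsOpBand R B 2 ‖G‖⁻¹ ∧
      ∃ x y : H, ‖x‖ = 1 ∧ ‖y‖ = ‖G‖⁻¹ ∧ ⟪u, x⟫ = 0 ∧ IsOp R B x y := by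
  have hn : 0 < ‖G‖ := norm_pos_iff.2 h0
  have hnC : (‖G‖ : ℂ) ≠ 0 := by exact_mod_cast hn.ne'
  obtain ⟨x, y, hx0, hGy, hGx⟩ := exists_max_singular h.compact h0
  have hx : x = G ((‖G‖⁻¹ : ℂ) • y) := by
    rw [map_smul, hGy, smul_smul, inv_mul_cancel₀ hnC, one_smul]
  have hy : y = ContinuousLinearMap.adjoint G ((‖G‖⁻¹ : ℂ) • x) := by
    rw [map_smul, hGx, smul_smul, inv_mul_cancel₀ hnC, one_smul]
  have hux : ⟪u, x⟫ = 0 := by rw [hx, h.orth]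
  have huy : ⟪u', y⟫ = 0 := by rw [hy, h'.orth]
  have hDx : IsOp R B x ((‖G‖⁻¹ : ℂ) • y) := by
    rw [hx]; exact h.solves _ (by rw [inner_smul_right, huy, mul_zero])
  have hDy : IsOp (ContinuousLinearMap.adjoint R) (ContinuousLinearMap.adjoint B) y
      ((‖G‖⁻¹ : ℂ) • x) := by
    nth_rw 1 [hy]; exact h'.solves _ (by rw [inner_smul_right, hux, mul_zero])
  have hyn : ‖y‖ = ‖x‖ := by
    have h1 := hDx.inner_adjoint hDy
    rw [inner_smul_right, inner_smul_left, inner_self_eq_norm_sq_to_K,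
      inner_self_eq_norm_sq_to_K, map_inv₀, conj_ofReal] at h1
    have h2 := mul_left_cancel₀ (inv_ne_zero hnC) h1
    have h3 : ‖y‖ ^ 2 = ‖x‖ ^ 2 := Complex.ofReal_injective (by push_cast; exact h2)
    exact (sq_eq_sq₀ (norm_nonneg _) (norm_nonneg _)).1 h3
  have hy0 : y ≠ 0 := by
    rw [← norm_ne_zero_iff, hyn]; exact norm_ne_zero_iff.2 hx0
  refine ⟨⟨by positivity, ?_, ?_⟩, ?_⟩
  · refine rank_span_pair_lt (a := (u, 0)) (b := (0, u')) (Submodule.span_le.2 ?_)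
    rintro ⟨v₁, v₂⟩ ⟨E, hE, hv₂, hv₁⟩
    simp only [Set.mem_ofPred_eq] at hE
    have hEn : |E| * ‖G‖ < 1 := by
      have := mul_lt_mul_of_pos_right hE hn
      rwa [inv_mul_cancel₀ hn.ne'] at this
    -- The components orthogonal to kernel and cokernel are related by `G`, which contracts.
    obtain ⟨p, hp, hpv⟩ : ∃ p, ⟪u, p⟫ = 0 ∧ v₁ = p + ⟪u, v₁⟫ • u := h'.decomp v₁
    obtain ⟨q, hq, hqv⟩ : ∃ q, ⟪u', q⟫ = 0 ∧ v₂ = q + ⟪u', v₂⟫ • u' := h.decomp v₂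
    have hpD : IsOp R B p ((E : ℂ) • v₂) := by
      have := hv₁.sub (h.ker.smul ⟪u, v₁⟫)
      rw [smul_zero, sub_zero] at this
      rwa [show p = v₁ - ⟪u, v₁⟫ • u from eq_sub_of_add_eq hpv.symm]
    have hqD : IsOp (ContinuousLinearMap.adjoint R) (ContinuousLinearMap.adjoint B) q
        ((E : ℂ) • v₁) := by
      have := hv₂.sub (h.coker_mem.smul ⟪u', v₂⟫)
      rw [smul_zero, sub_zero] at this
      rwa [show q = v₂ - ⟪u', v₂⟫ • u' from eq_sub_of_add_eq hqv.symm]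
    have hpG : p = (E : ℂ) • G q := by
      rw [← h.left_inv _ _ hpD hp, map_smul]
      nth_rw 1 [hqv]
      rw [map_add, map_smul, h.coker, smul_zero, add_zero]
    have hqG : q = (E : ℂ) • ContinuousLinearMap.adjoint G p := by
      rw [← h'.left_inv _ _ hqD hq, map_smul]
      nth_rw 1 [hpv]
      rw [map_add, map_smul, h'.coker, smul_zero, add_zero]
    have hpn : ‖p‖ ≤ |E| * ‖G‖ * ‖q‖ := by
      nth_rw 1 [hpG]
      rw [norm_smul, norm_real, Real.norm_eq_abs, mul_assoc]
      exact mul_le_mul_of_nonneg_left (G.le_opNorm q) (abs_nonneg E)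
    have hqn : ‖q‖ ≤ |E| * ‖G‖ * ‖p‖ := by
      nth_rw 1 [hqG]
      rw [norm_smul, norm_real, Real.norm_eq_abs, mul_assoc]
      refine mul_le_mul_of_nonneg_left ?_ (abs_nonneg E)
      simpa using (ContinuousLinearMap.adjoint G).le_opNorm p
    have hp0 : p = 0 := norm_eq_zero.1 (by
      nlinarith [norm_nonneg p, norm_nonneg q, mul_nonneg (abs_nonneg E) hn.le])
    have hq0 : q = 0 := by rw [hqG, hp0, map_zero, smul_zero]
    rw [hp0, zero_add] at hpv
    rw [hq0, zero_add] at hqv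
    refine Submodule.mem_span_pair.2 ⟨⟪u, v₁⟫, ⟪u', v₂⟫, ?_⟩
    simpa using ⟨hpv.symm, hqv.symm⟩
  · have hp : (0 : ℝ) ≤ ‖G‖⁻¹ := by positivity
    have m1 : (x, y) ∈ opSpan R B {E | |E| ≤ ‖G‖⁻¹} :=
      Submodule.subset_span ⟨‖G‖⁻¹, by simp [abs_of_nonneg hp], by simpa using hDy,
        by simpa using hDx⟩
    have m2 : (x, -y) ∈ opSpan R B {E | |E| ≤ ‖G‖⁻¹} := by
      refine Submodule.subset_span ⟨-‖G‖⁻¹, by simp [abs_of_nonneg hp], ?_, ?_⟩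
      · simpa using hDy.smul (-1)
      · simpa using hDx
    have m3 : (x, (0 : H)) ∈ opSpan R B {E | |E| ≤ ‖G‖⁻¹} := by
      have := Submodule.smul_mem _ (2⁻¹ : ℂ) (add_mem m1 m2)
      simpa [← two_smul ℂ x, smul_smul] using this
    have m4 : ((0 : H), y) ∈ opSpan R B {E | |E| ≤ ‖G‖⁻¹} := by
      simpa using sub_mem m1 m3
    exact four_le_rank _ (linearIndependent_pair_of_orth h.ne_zero_ker hx0 hux)
      (linearIndependent_pair_of_orth h.ne_zero_coker hy0 huy)
      (mem_opSpan_left hp h.ker) m3 (mem_opSpan_right hp h.coker_mem) m4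
  · have hxn : ‖x‖ ≠ 0 := norm_ne_zero_iff.2 hx0
    refine ⟨(‖x‖⁻¹ : ℂ) • x, (‖x‖⁻¹ : ℂ) • (‖G‖⁻¹ : ℂ) • y, ?_, ?_, ?_, hDx.smul _⟩
    · simp [norm_smul, hxn]
    · simp [norm_smul, hyn]
      field_simp
    · rw [inner_smul_right, hux, mul_zero]

end IsPinv

end Abstract

/-! ### Two weakly coupled sheets -/

section Abstract

variable {H : Type*} [NormedAddCommGroup H] [InnerProductSpace ℂ H]

theorem exists_orth_decomp {u : H} (hu : ‖u‖ = 1) (v : H) :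
    ∃ v', ⟪u, v'⟫ = 0 ∧ v = v' + ⟪u, v⟫ • u :=
  ⟨v - ⟪u, v⟫ • u, by
    rw [inner_sub_right, inner_smul_right, inner_self_one hu, mul_one, sub_self], by simp⟩

theorem norm_sq_of_decomp {u v v' : H} (hu : ‖u‖ = 1) (h : ⟪u, v'⟫ = 0)
    (hv : v = v' + ⟪u, v⟫ • u) : ‖v‖ ^ 2 = ‖⟪u, v⟫‖ ^ 2 + ‖v'‖ ^ 2 := by
  have h4 : ⟪⟪u, v⟫ • u, v'⟫ = 0 := by rw [inner_smul_left, h, mul_zero]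
  have := norm_add_sq_eq_norm_sq_add_norm_sq_of_inner_eq_zero _ _ h4
  rw [add_comm (⟪u, v⟫ • u), ← hv, norm_smul, hu, mul_one] at this
  nlinarith

/-- The arithmetic of the lower bound for the second singular value: `a` and `b` are the moduli of
the components along `u` and `e`, `v` and `w` the norms of the parts orthogonal to them, `y` the
norm of the image in the first sheet, and `g`, `g₀` the norms of the pseudo-inverses. -/
theorem lower_bound_aux {C a v w b y g g₀ t : ℝ} (hC : 0 ≤ C)
    (hC1 : C ≤ 1) (ha : 0 ≤ a) (hv : 0 ≤ v) (hw : 0 ≤ w) (hb : 0 ≤ b) (ht : 0 < t) (ht1 : t < 1)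
    (han : a ≤ g₀ * t) (hvn : v ≤ g * (2 * t)) (hwn : w ≤ g₀ * (2 * t))
    (hsum : a ^ 2 + v ^ 2 + b ^ 2 + w ^ 2 = 1) (hmain : t * b * C ≤ y + t * w) :
    C * t ≤ y + (2 * g₀ + (5 * g₀ ^ 2 + 4 * g ^ 2)) * t ^ 2 := by
  have hb1 : 1 - (5 * g₀ ^ 2 + 4 * g ^ 2) * t ^ 2 ≤ b := by
    have e1 : a ^ 2 ≤ (g₀ * t) ^ 2 := pow_le_pow_left₀ ha han 2
    have e2 : v ^ 2 ≤ (g * (2 * t)) ^ 2 := pow_le_pow_left₀ hv hvn 2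
    have e3 : w ^ 2 ≤ (g₀ * (2 * t)) ^ 2 := pow_le_pow_left₀ hw hwn 2
    have e4 : b ≤ 1 := by nlinarith [sq_nonneg a, sq_nonneg v, sq_nonneg w]
    have e5 : b ^ 2 ≤ b := by nlinarith
    nlinarith
  have e1 : t * w ≤ t * (g₀ * (2 * t)) := mul_le_mul_of_nonneg_left hwn ht.le
  have e2 : C * t * (1 - (5 * g₀ ^ 2 + 4 * g ^ 2) * t ^ 2) ≤ C * t * b :=
    mul_le_mul_of_nonneg_left hb1 (by positivity)
  have e3 : C * t * ((5 * g₀ ^ 2 + 4 * g ^ 2) * t ^ 2) ≤ 1 * ((5 * g₀ ^ 2 + 4 * g ^ 2) * t ^ 2) :=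
    mul_le_mul_of_nonneg_right (mul_le_one₀ hC1 ht.le ht1.le) (by positivity)
  linarith

variable {K : Type*} [NormedAddCommGroup K] [InnerProductSpace ℂ K]

/-- An identification of `K` with the orthogonal sum of two copies of `H`. -/
structure IsSheetSplit (p q : K →L[ℂ] H) : Prop where
  inner_eq : ∀ x y, ⟪x, y⟫ = ⟪p x, p y⟫ + ⟪q x, q y⟫
  surj : ∀ v w, ∃ x, p x = v ∧ q x = w

theorem IsSheetSplit.norm_sq {p q : K →L[ℂ] H} (h : IsSheetSplit p q) (x : K) :
    ‖x‖ ^ 2 = ‖p x‖ ^ 2 + ‖q x‖ ^ 2 := by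
  have := h.inner_eq x x
  simp only [inner_self_eq_norm_sq_to_K] at this
  exact Complex.ofReal_injective (by push_cast; exact this)

theorem IsSheetSplit.ext {p q : K →L[ℂ] H} (h : IsSheetSplit p q) {x y : K} (hp : p x = p y)
    (hq : q x = q y) : x = y := by
  have := h.norm_sq (x - y)
  rw [map_sub, map_sub, hp, hq] at this
  simpa [sub_eq_zero] using this

variable [CompleteSpace H] [CompleteSpace K]

/-- The data of two coupled sheets: `D = R⁻¹ + B` and `D₀ = R⁻¹ + B₀` have one-dimensional kernels
and cokernels, spanned by the unit vectors `u`, `u'` for `D` and by the same unit vector `e` for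
`D₀`; the coupling is by complementary orthogonal projections `Tp`, `Tm` that commute with `D₀`,
and `e` lies in the range of `Tp`. -/
structure TwoSheet (R B B₀ Tp Tm G G₀ : H →L[ℂ] H) (u u' e : H) : Prop where
  pinv : IsPinv R B u u' G
  pinv₀ : IsPinv R B₀ e e G₀
  pinv₀_adj : IsPinv (adjoint R) (adjoint B₀) e e (adjoint G₀)
  add : ∀ v, Tp v + Tm v = v
  Tp_Tm : ∀ v, Tp (Tm v) = 0
  Tm_Tp : ∀ v, Tm (Tp v) = 0
  Tp_e : Tp e = e
  Tp_symm : ∀ v w, ⟪Tp v, w⟫ = ⟪v, Tp w⟫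
  Tm_symm : ∀ v w, ⟪Tm v, w⟫ = ⟪v, Tm w⟫
  norm_Tp : ∀ v, ‖Tp v‖ ≤ ‖v‖
  norm_Tm : ∀ v, ‖Tm v‖ ≤ ‖v‖
  comm_Tp : ∀ {v y}, IsOp R B₀ v y → IsOp R B₀ (Tp v) (Tp y)
  comm_Tm_adj : ∀ {v y}, IsOp (adjoint R) (adjoint B₀) v y →
    IsOp (adjoint R) (adjoint B₀) (Tm v) (Tm y)

/-- `A (v, w) = (y, x)` for the coupled operator `A = [[D, t Tp], [t Tm, D₀]]`. -/
def PairOp (R B B₀ Tp Tm : H →L[ℂ] H) (t : ℝ) (v w y x : H) : Prop :=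
  IsOp R B v (y - (t : ℂ) • Tp w) ∧ IsOp R B₀ w (x - (t : ℂ) • Tm v)

namespace TwoSheet

variable {R B B₀ Tp Tm G G₀ : H →L[ℂ] H} {u u' e : H}

theorem Tm_e (h : TwoSheet R B B₀ Tp Tm G G₀ u u' e) : Tm e = 0 := by
  simpa [h.Tp_e] using h.add e

theorem inner_Tm (h : TwoSheet R B B₀ Tp Tm G G₀ u u' e) (v : H) : ⟪e, Tm v⟫ = 0 := by
  rw [← h.Tm_symm, h.Tm_e, inner_zero_left]

theorem solves_Tm (h : TwoSheet R B B₀ Tp Tm G G₀ u u' e) (v : H) :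
    IsOp R B₀ (G₀ (Tm v)) (Tm v) := h.pinv₀.solves _ (h.inner_Tm v)

theorem Tp_G₀_Tm (h : TwoSheet R B B₀ Tp Tm G G₀ u u' e) (v : H) : Tp (G₀ (Tm v)) = 0 := by
  have h1 := h.comm_Tp (h.solves_Tm v)
  rw [h.Tp_Tm] at h1
  obtain ⟨c, hc⟩ := (h.pinv₀.ker_iff _).1 h1
  have h2 : ⟪e, Tp (G₀ (Tm v))⟫ = 0 := by
    rw [← h.Tp_symm, h.Tp_e, h.pinv₀.orth]
  rw [hc, inner_smul_right, inner_self_one h.pinv₀.norm_ker, mul_one] at h2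
  rw [hc, h2, zero_smul]

theorem Tm_Tm (h : TwoSheet R B B₀ Tp Tm G G₀ u u' e) (v : H) : Tm (Tm v) = Tm v := by
  simpa [h.Tp_Tm] using h.add (Tm v)

/-- The coupling keeps a zero mode: `u`, corrected in the second sheet. -/
theorem pairOp_ker (h : TwoSheet R B B₀ Tp Tm G G₀ u u' e) (t : ℝ) :
    PairOp R B B₀ Tp Tm t u (-(t : ℂ) • G₀ (Tm u)) 0 0 := by
  constructor
  · rw [map_smul, h.Tp_G₀_Tm]
    simpa using h.pinv.ker
  · simpa using (h.solves_Tm u).smul (-(t : ℂ))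

/-- A trial function for the second band. -/
theorem exists_trial (h : TwoSheet R B B₀ Tp Tm G G₀ u u' e) (t : ℝ) :
    ∃ v w, PairOp R B B₀ Tp Tm t v w (((t : ℂ) * ⟪u', e⟫) • u') 0 ∧ ⟪e, w⟫ = 1 := by
  set v := -(t : ℂ) • G (e - ⟪u', e⟫ • u') with hv
  refine ⟨v, e - (t : ℂ) • G₀ (Tm v), ⟨?_, ?_⟩, ?_⟩
  · rw [map_sub, map_smul, h.Tp_G₀_Tm, smul_zero, sub_zero, h.Tp_e]
    have h1 : ⟪u', e - ⟪u', e⟫ • u'⟫ = 0 := by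
      rw [inner_sub_right, inner_smul_right, inner_self_one h.pinv.norm_coker, mul_one, sub_self]
    have h2 := (h.pinv.solves _ h1).smul (-(t : ℂ))
    rw [hv]
    convert! h2 using 1
    module
  · have := h.pinv₀.ker.sub ((h.solves_Tm v).smul (t : ℂ))
    exact this
  · rw [inner_sub_right, inner_smul_right, h.pinv₀.orth, mul_zero, sub_zero,
      inner_self_one h.pinv₀.norm_ker]

/-- If `u'` is not orthogonal to `e`, the zero mode `e` of the second sheet is lost. -/
theorem pairOp_ker_iff (h : TwoSheet R B B₀ Tp Tm G G₀ u u' e) {t : ℝ} (ht : t ≠ 0)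
    (hC : ⟪u', e⟫ ≠ 0) {v w : H} (hvw : PairOp R B B₀ Tp Tm t v w 0 0) :
    ∃ d : ℂ, v = d • u ∧ w = d • (-(t : ℂ) • G₀ (Tm u)) := by
  obtain ⟨h1, h2⟩ := hvw
  rw [zero_sub] at h1 h2
  have h3 : IsOp R B₀ (w + (t : ℂ) • G₀ (Tm v)) 0 := by
    simpa using h2.add ((h.solves_Tm v).smul (t : ℂ))
  obtain ⟨c, hc⟩ := (h.pinv₀.ker_iff _).1 h3
  have hw : w = c • e - (t : ℂ) • G₀ (Tm v) := eq_sub_of_add_eq hc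
  have hTw : Tp w = c • e := by
    rw [hw, map_sub, map_smul, map_smul, h.Tp_G₀_Tm, h.Tp_e, smul_zero, sub_zero]
  rw [hTw] at h1
  have h4 := h.pinv.range_orth h1
  rw [inner_neg_right, inner_smul_right, inner_smul_right, neg_eq_zero] at h4
  have hc0 : c = 0 :=
    (mul_eq_zero.1 ((mul_eq_zero.1 h4).resolve_left (by exact_mod_cast ht))).resolve_right hC
  rw [hc0, zero_smul, smul_zero, neg_zero] at h1
  obtain ⟨d, hd⟩ := (h.pinv.ker_iff v).1 h1
  refine ⟨d, hd, ?_⟩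
  rw [hw, hc0, hd, map_smul, map_smul]
  module

theorem pairOp_coker (h : TwoSheet R B B₀ Tp Tm G G₀ u u' e) (t : ℝ) :
    PairOp (adjoint R) (adjoint B) (adjoint B₀) Tm Tp t 0 e 0 0 := by
  constructor
  · simpa [h.Tm_e] using IsOp.zero
  · simpa using h.pinv₀_adj.ker

theorem pairOp_coker_iff (h : TwoSheet R B B₀ Tp Tm G G₀ u u' e) {t : ℝ} (ht : t ≠ 0)
    (hC : ⟪u', e⟫ ≠ 0) {v w : H}
    (hvw : PairOp (adjoint R) (adjoint B) (adjoint B₀) Tm Tp t v w 0 0) :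
    ∃ d : ℂ, v = 0 ∧ w = d • e := by
  obtain ⟨h1, h2⟩ := hvw
  rw [zero_sub] at h1 h2
  have h3 := h.comm_Tm_adj h2
  rw [map_neg, map_smul, h.Tm_Tp, smul_zero, neg_zero] at h3
  obtain ⟨c, hc⟩ := (h.pinv₀_adj.ker_iff _).1 h3
  have hTw : Tm w = 0 := by rw [← h.Tm_Tm, hc, map_smul, h.Tm_e, smul_zero]
  rw [hTw, smul_zero, neg_zero] at h1
  obtain ⟨d, hd⟩ := (h.pinv.coker_iff v).1 h1
  have h4 := h.pinv₀_adj.range_orth h2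
  rw [hd, inner_neg_right, inner_smul_right, ← h.Tp_symm, h.Tp_e, inner_smul_right,
    neg_eq_zero] at h4
  have hd0 : d = 0 := by
    refine (mul_eq_zero.1 ((mul_eq_zero.1 h4).resolve_left (by exact_mod_cast ht))).resolve_right ?_
    rwa [← inner_conj_symm, ← ne_eq, map_ne_zero]
  rw [hd0, zero_smul] at hd
  rw [hd, map_zero, smul_zero, neg_zero] at h2
  obtain ⟨b, hb⟩ := (h.pinv₀_adj.ker_iff w).1 h2
  exact ⟨b, hd, hb⟩

/-- If `u'` is orthogonal to `e`, then the cokernel of the coupled operator keeps dimension two. -/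
theorem pairOp_coker_of_orth (h : TwoSheet R B B₀ Tp Tm G G₀ u u' e) (t : ℝ) (hC : ⟪u', e⟫ = 0) :
    ∃ w, PairOp (adjoint R) (adjoint B) (adjoint B₀) Tm Tp t u' w 0 0 := by
  have h1 : ⟪e, Tp u'⟫ = 0 := by
    rw [← h.Tp_symm, h.Tp_e, ← inner_conj_symm, hC, map_zero]
  have h2 := h.pinv₀_adj.solves _ h1
  have h3 := h.comm_Tm_adj h2
  rw [h.Tm_Tp] at h3
  obtain ⟨c, hc⟩ := (h.pinv₀_adj.ker_iff _).1 h3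
  have h4 : Tm (adjoint G₀ (Tp u')) = 0 := by rw [← h.Tm_Tm, hc, map_smul, h.Tm_e, smul_zero]
  refine ⟨-(t : ℂ) • adjoint G₀ (Tp u'), ?_, ?_⟩
  · simpa [h4] using h.pinv.coker_mem
  · simpa using h2.smul (-(t : ℂ))

/-- The lower bound for the second singular value, by projection on the four vectors that span
the kernels and cokernels at `t = 0`. -/
theorem exists_lower_bound (h : TwoSheet R B B₀ Tp Tm G G₀ u u' e) :
    ∃ M : ℝ, 0 ≤ M ∧ ∀ (t : ℝ) (v w y x : H), 0 < t → t < 1 → PairOp R B B₀ Tp Tm t v w y x →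
      ⟪u, v⟫ + ⟪-(t : ℂ) • G₀ (Tm u), w⟫ = 0 → ‖v‖ ^ 2 + ‖w‖ ^ 2 = 1 → ‖y‖ ≤ t → ‖x‖ ≤ t →
      ‖⟪u', e⟫‖ * t ≤ ‖y‖ + M * t ^ 2 := by
  refine ⟨2 * ‖G₀‖ + (5 * ‖G₀‖ ^ 2 + 4 * ‖G‖ ^ 2), by positivity, ?_⟩
  rintro t v w y x ht ht1 ⟨h1, h2⟩ horth hnorm hy hx
  have hv1 : ‖v‖ ≤ 1 := by nlinarith [norm_nonneg v, sq_nonneg ‖w‖]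
  have hw1 : ‖w‖ ≤ 1 := by nlinarith [norm_nonneg w, sq_nonneg ‖v‖]
  have hsub : ∀ {a b : H}, ‖a‖ ≤ t → ‖b‖ ≤ 1 → ‖a - (t : ℂ) • b‖ ≤ 2 * t := by
    intro a b ha hb
    refine (norm_sub_le _ _).trans ?_
    rw [norm_smul, norm_real, Real.norm_of_nonneg ht.le]
    have := mul_le_mul_of_nonneg_left hb ht.le
    linarith
  -- The components of `v`, `w` orthogonal to `u`, `e` are `O(t)`.
  obtain ⟨v', huv', hv'⟩ : ∃ v', ⟪u, v'⟫ = 0 ∧ v = v' + ⟪u, v⟫ • u :=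
    exists_orth_decomp h.pinv.norm_ker v
  obtain ⟨w', hew', hw'⟩ : ∃ w', ⟪e, w'⟫ = 0 ∧ w = w' + ⟪e, w⟫ • e :=
    exists_orth_decomp h.pinv₀.norm_ker w
  have hvn := norm_sq_of_decomp h.pinv.norm_ker huv' hv'
  have hwn := norm_sq_of_decomp h.pinv₀.norm_ker hew' hw'
  have hv'op : IsOp R B v' (y - (t : ℂ) • Tp w) := by
    have := h1.sub (h.pinv.ker.smul ⟪u, v⟫)
    rwa [smul_zero, sub_zero, sub_eq_of_eq_add hv'] at this
  have hw'op : IsOp R B₀ w' (x - (t : ℂ) • Tm v) := by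
    have := h2.sub (h.pinv₀.ker.smul ⟪e, w⟫)
    rwa [smul_zero, sub_zero, sub_eq_of_eq_add hw'] at this
  have hv'n : ‖v'‖ ≤ ‖G‖ * (2 * t) := by
    rw [← h.pinv.left_inv _ _ hv'op huv']
    exact (G.le_opNorm _).trans
      (mul_le_mul_of_nonneg_left (hsub hy ((h.norm_Tp w).trans hw1)) (norm_nonneg _))
  have hw'n : ‖w'‖ ≤ ‖G₀‖ * (2 * t) := by
    rw [← h.pinv₀.left_inv _ _ hw'op hew']
    exact (G₀.le_opNorm _).trans
      (mul_le_mul_of_nonneg_left (hsub hx ((h.norm_Tm v).trans hv1)) (norm_nonneg _))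
  have han : ‖⟪u, v⟫‖ ≤ ‖G₀‖ * t := by
    rw [eq_neg_of_add_eq_zero_left horth, norm_neg]
    refine (norm_inner_le_norm _ _).trans ?_
    rw [norm_smul, norm_neg, norm_real, Real.norm_of_nonneg ht.le]
    have h3 : ‖G₀ (Tm u)‖ ≤ ‖G₀‖ * 1 :=
      (G₀.le_opNorm _).trans (mul_le_mul_of_nonneg_left
        ((h.norm_Tm u).trans_eq h.pinv.norm_ker) (norm_nonneg _))
    have h4 : t * ‖G₀ (Tm u)‖ * ‖w‖ ≤ t * (‖G₀‖ * 1) * 1 :=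
      mul_le_mul (mul_le_mul_of_nonneg_left h3 ht.le) hw1 (norm_nonneg _) (by positivity)
    linarith
  -- Pairing the first equation with `u'` isolates the leading term.
  have hpair : (t : ℂ) * ⟪e, w⟫ * ⟪u', e⟫ = ⟪u', y⟫ - (t : ℂ) * ⟪u', Tp w'⟫ := by
    have h3 := h.pinv.range_orth h1
    have h4 : Tp w = Tp w' + ⟪e, w⟫ • e := by
      conv_lhs => rw [hw']
      rw [map_add, map_smul, h.Tp_e]
    rw [h4, inner_sub_right, inner_smul_right, inner_add_right, inner_smul_right, sub_eq_zero] at h3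
    rw [h3]; ring
  have hC1 : ‖⟪u', e⟫‖ ≤ 1 := by
    refine (norm_inner_le_norm _ _).trans ?_
    rw [h.pinv.norm_coker, h.pinv₀.norm_ker, one_mul]
  have hmain : t * ‖⟪e, w⟫‖ * ‖⟪u', e⟫‖ ≤ ‖y‖ + t * ‖w'‖ := by
    have h4 := congrArg norm hpair
    rw [norm_mul, norm_mul, norm_real, Real.norm_of_nonneg ht.le] at h4
    rw [h4]
    refine (norm_sub_le _ _).trans ?_
    rw [norm_mul, norm_real, Real.norm_of_nonneg ht.le]
    have h5 : ‖⟪u', y⟫‖ ≤ ‖y‖ := by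
      simpa [h.pinv.norm_coker] using norm_inner_le_norm (𝕜 := ℂ) u' y
    have h6 : ‖⟪u', Tp w'⟫‖ ≤ ‖w'‖ := by
      refine (norm_inner_le_norm _ _).trans ?_
      rw [h.pinv.norm_coker, one_mul]
      exact h.norm_Tp w'
    exact add_le_add h5 (mul_le_mul_of_nonneg_left h6 ht.le)
  exact lower_bound_aux (norm_nonneg _) hC1 (norm_nonneg _)
    (norm_nonneg _) (norm_nonneg _) (norm_nonneg _) ht ht1 han hv'n hw'n
    (by rw [← hnorm, hvn, hwn]; ring) hmain

end TwoSheet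

/-- The first two band energies of the coupled sheets for a weak coupling `t`. -/
theorem TwoSheet.exists_band_energies {R B B₀ Tp Tm G G₀ : H →L[ℂ] H} {u u' e : H}
    (h : TwoSheet R B B₀ Tp Tm G G₀ u u' e) {p q : K →L[ℂ] H} (hpq : IsSheetSplit p q) :
    ∃ M : ℝ, ∀ (t : ℝ) (R₂ B₂ : K →L[ℂ] K), 0 < t → t < 1 → IsCompactOperator R₂ →
      IsCompactOperator (adjoint R₂) → Function.Injective R₂ → Function.Injective (adjoint R₂) →
      (∀ x y, IsOp R₂ B₂ x y ↔ PairOp R B B₀ Tp Tm t (p x) (q x) (p y) (q y)) →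
      (∀ x y, IsOp (adjoint R₂) (adjoint B₂) x y ↔
        PairOp (adjoint R) (adjoint B) (adjoint B₀) Tm Tp t (p x) (q x) (p y) (q y)) →
      IsOpBand R₂ B₂ 1 0 ∧
        ∃ E₂, IsOpBand R₂ B₂ 2 E₂ ∧ |E₂ - ‖⟪u', e⟫‖ * t| ≤ M * t ^ 2 := by
  obtain ⟨M, hM0, hM⟩ := h.exists_lower_bound
  refine ⟨M, fun t R₂ B₂ ht ht1 hRc hRc' hRi hRi' hop hop' => ?_⟩
  obtain ⟨φ, hφp, hφq⟩ := hpq.surj u (-(t : ℂ) • G₀ (Tm u))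
  obtain ⟨ψ, hψp, hψq⟩ := hpq.surj 0 e
  have hφ : IsOp R₂ B₂ φ 0 := by
    rw [hop, hφp, hφq, map_zero, map_zero]; exact h.pairOp_ker t
  have hψ : IsOp (adjoint R₂) (adjoint B₂) ψ 0 := by
    rw [hop', hψp, hψq, map_zero, map_zero]; exact h.pairOp_coker t
  have hφ0 : φ ≠ 0 := by
    rintro rfl; exact h.pinv.ne_zero_ker (by rw [← hφp, map_zero])
  have hψn : ‖ψ‖ = 1 := by
    have := hpq.norm_sq ψ
    rw [hψp, hψq, h.pinv₀.norm_ker, norm_zero] at this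
    exact (sq_eq_sq₀ (norm_nonneg _) zero_le_one).1 (by linarith)
  have hψ0 : ψ ≠ 0 := by rintro rfl; simp at hψn
  have hψφ : ⟪ψ, φ⟫ = 0 := by
    rw [hpq.inner_eq, hψp, hψq, hφq, inner_zero_left, inner_smul_right, h.pinv₀.orth, mul_zero,
      add_zero]
  refine ⟨isOpBand_one_zero hφ0 hψ0 hφ hψ, ?_⟩
  obtain ⟨v, w, hvw, hw1⟩ := h.exists_trial t
  obtain ⟨x, hxp, hxq⟩ := hpq.surj v w
  obtain ⟨y, hyp, hyq⟩ := hpq.surj (((t : ℂ) * ⟪u', e⟫) • u') 0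
  have hxy : IsOp R₂ B₂ x y := by rwa [hop, hxp, hxq, hyp, hyq]
  have hψx : ⟪ψ, x⟫ = 1 := by
    rw [hpq.inner_eq, hψp, hψq, hxq, inner_zero_left, hw1, zero_add]
  by_cases hC : ⟪u', e⟫ = 0
  · obtain ⟨w', hw'⟩ := h.pairOp_coker_of_orth t hC
    obtain ⟨x', hx'p, hx'q⟩ := hpq.surj u' w'
    have hx' : IsOp (adjoint R₂) (adjoint B₂) x' 0 := by
      rwa [hop', hx'p, hx'q, map_zero, map_zero]
    have hy0 : y = 0 := hpq.ext (by rw [hyp, hC]; simp) (by rw [hyq, map_zero])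
    rw [hy0] at hxy
    refine ⟨0, isOpBand_two_zero (a := φ) (b := x) (c := ψ) (d := x') ?_ ?_ hφ hxy hψ hx', ?_⟩
    · rw [LinearIndependent.pair_iff]
      intro s r hsr
      have hr : r = 0 := by
        have := congrArg (fun z => ⟪ψ, z⟫) hsr
        simpa [inner_add_right, inner_smul_right, hψφ, hψx] using this
      subst hr
      simpa [hφ0] using hsr
    · rw [LinearIndependent.pair_iff]
      intro s r hsr
      have hr : r = 0 := by
        have := congrArg p hsr
        simpa [hψp, hx'p, h.pinv.ne_zero_coker] using this
      subst hr
      simpa [hψ0] using hsr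
    · rw [hC, norm_zero, zero_mul, sub_zero, abs_zero]; positivity
  · have hφn : (‖φ‖ : ℂ) ≠ 0 := by exact_mod_cast norm_ne_zero_iff.2 hφ0
    set φ₁ : K := (‖φ‖⁻¹ : ℂ) • φ with hφ₁
    have hφ₁n : ‖φ₁‖ = 1 := by
      rw [hφ₁, norm_smul, norm_inv, norm_real, norm_norm,
        inv_mul_cancel₀ (norm_ne_zero_iff.2 hφ0)]
    have hker : ∀ z, IsOp R₂ B₂ z 0 ↔ ∃ c : ℂ, z = c • φ₁ := by
      intro z
      constructor
      · intro hz
        rw [hop, map_zero, map_zero] at hz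
        obtain ⟨d, hd1, hd2⟩ := h.pairOp_ker_iff ht.ne' hC hz
        refine ⟨d * ‖φ‖, ?_⟩
        rw [hφ₁, smul_smul, mul_assoc, mul_inv_cancel₀ hφn, mul_one]
        exact hpq.ext (by rw [hd1, map_smul, hφp]) (by rw [hd2, map_smul, hφq])
      · rintro ⟨c, rfl⟩
        simpa using (hφ.smul (‖φ‖⁻¹ : ℂ)).smul c
    have hcoker : ∀ z, IsOp (adjoint R₂) (adjoint B₂) z 0 ↔ ∃ c : ℂ, z = c • ψ := by
      intro z
      constructor
      · intro hz
        rw [hop', map_zero, map_zero] at hz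
        obtain ⟨d, hd1, hd2⟩ := h.pairOp_coker_iff ht.ne' hC hz
        exact ⟨d, hpq.ext (by rw [hd1, map_smul, hψp, smul_zero]) (by rw [hd2, map_smul, hψq])⟩
      · rintro ⟨c, rfl⟩
        simpa using hψ.smul c
    obtain ⟨G₂, hG₂⟩ := exists_isPinv hRc hRi hφ₁n hψn hker hcoker
    have hG₂' := hG₂.adjoint_isPinv hRc' hRi'
    -- The trial function, made orthogonal to the kernel, still has norm at least `1`.
    set x₁ := x - ⟪φ₁, x⟫ • φ₁ with hx₁
    have hx₁o : ⟪φ₁, x₁⟫ = 0 := by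
      rw [hx₁, inner_sub_right, inner_smul_right, inner_self_one hφ₁n, mul_one, sub_self]
    have hx₁y : IsOp R₂ B₂ x₁ y := by
      simpa using hxy.sub (hG₂.ker.smul ⟪φ₁, x⟫)
    have hψφ₁ : ⟪ψ, φ₁⟫ = 0 := by rw [hφ₁, inner_smul_right, hψφ, mul_zero]
    have hx₁n : 1 ≤ ‖x₁‖ := by
      have h1 : ⟪ψ, x₁⟫ = 1 := by
        rw [hx₁, inner_sub_right, inner_smul_right, hψφ₁, hψx, mul_zero, sub_zero]
      simpa [h1, hψn] using norm_inner_le_norm (𝕜 := ℂ) ψ x₁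
    have hGy : G₂ y = x₁ := hG₂.left_inv _ _ hx₁y hx₁o
    have hyn : ‖y‖ = ‖⟪u', e⟫‖ * t := by
      have := hpq.norm_sq y
      rw [hyp, hyq, norm_smul, h.pinv.norm_coker, norm_mul, norm_real,
        Real.norm_of_nonneg ht.le, norm_zero] at this
      have h2 : ‖y‖ ^ 2 = (‖⟪u', e⟫‖ * t) ^ 2 := by rw [this]; ring
      exact (sq_eq_sq₀ (norm_nonneg _) (by positivity)).1 h2
    have hG0 : G₂ ≠ 0 := by
      intro h0
      rw [h0, zero_apply] at hGy
      rw [← hGy, norm_zero] at hx₁n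
      linarith
    have hGn : 0 < ‖G₂‖ := norm_pos_iff.2 hG0
    obtain ⟨hband, a, b, han, hbn, hao, hab⟩ := hG₂.isOpBand_two hG₂' hG0
    refine ⟨_, hband, ?_⟩
    have hupper : ‖G₂‖⁻¹ ≤ ‖⟪u', e⟫‖ * t := by
      rw [← hyn, inv_le_iff_one_le_mul₀ hGn, mul_comm]
      exact hx₁n.trans (hGy ▸ G₂.le_opNorm y)
    have hC1 : ‖⟪u', e⟫‖ ≤ 1 := by
      refine (norm_inner_le_norm _ _).trans ?_
      rw [h.pinv.norm_coker, h.pinv₀.norm_ker, one_mul]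
    have hbt : ‖b‖ ≤ t := by rw [hbn]; nlinarith
    have hbsq := hpq.norm_sq b
    have hpb : ‖p b‖ ≤ ‖b‖ := by
      nlinarith [norm_nonneg (p b), norm_nonneg b, sq_nonneg ‖q b‖]
    have hqb : ‖q b‖ ≤ ‖b‖ := by
      nlinarith [norm_nonneg (q b), norm_nonneg b, sq_nonneg ‖p b‖]
    have hao' : ⟪u, p a⟫ + ⟪-(t : ℂ) • G₀ (Tm u), q a⟫ = 0 := by
      have h1 := hpq.inner_eq φ a
      rw [hφp, hφq] at h1
      rw [← h1]
      have : φ = (‖φ‖ : ℂ) • φ₁ := by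
        rw [hφ₁, smul_smul, mul_inv_cancel₀ hφn, one_smul]
      rw [this, inner_smul_left, hao, mul_zero]
    have hlow := hM t _ _ _ _ ht ht1 ((hop a b).1 hab) hao'
      (by rw [← hpq.norm_sq, han, one_pow]) (hpb.trans hbt) (hqb.trans hbt)
    rw [abs_le]
    have hMt : 0 ≤ M * t ^ 2 := by positivity
    constructor
    · rw [← hbn]; linarith
    · linarith

end Abstract

/-! ### The lattice and the torus -/

theorem om_eq : om = -1 / 2 + (Real.sqrt 3 / 2 : ℝ) * I := by
  have h : (2 * Real.pi * I / 3 : ℂ) = ((2 * Real.pi / 3 : ℝ) : ℂ) * I := by push_cast; ring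
  rw [om, h, exp_mul_I, ← ofReal_cos, ← ofReal_sin]
  have hc : Real.cos (2 * Real.pi / 3) = -1 / 2 := by
    rw [show 2 * Real.pi / 3 = Real.pi - Real.pi / 3 by ring, Real.cos_pi_sub,
      Real.cos_pi_div_three]; ring
  have hs : Real.sin (2 * Real.pi / 3) = Real.sqrt 3 / 2 := by
    rw [show 2 * Real.pi / 3 = Real.pi - Real.pi / 3 by ring, Real.sin_pi_sub,
      Real.sin_pi_div_three]
  rw [hc, hs]; push_cast; rfl

theorem sqrt_three_sq : (Real.sqrt 3) ^ 2 = 3 := Real.sq_sqrt (by norm_num)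

theorem om_re : om.re = -1 / 2 := by rw [om_eq]; simp
theorem om_im : om.im = Real.sqrt 3 / 2 := by rw [om_eq]; simp

theorem om_sq : om ^ 2 = -1 - om := by
  rw [om_eq]
  apply Complex.ext
  · simp [pow_two]; nlinarith [sqrt_three_sq]
  · simp [pow_two]; ring

theorem pt_re (s r : ℝ) : (pt s r).re = 2 * Real.pi / Real.sqrt 3 * (r - s) := by
  have h3 : Real.sqrt 3 ≠ 0 := by positivity
  have hq := sqrt_three_sq
  have : pt s r = 4 / 3 * Real.pi * I * (om * s + om ^ 2 * r) := by rw [pt]; ring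
  rw [this, om_sq]
  simp [om_re, om_im]
  field_simp
  linear_combination (4 * (r - s)) * hq

theorem pt_im (s r : ℝ) : (pt s r).im = -(2 * Real.pi / 3) * (s + r) := by
  have : pt s r = 4 / 3 * Real.pi * I * (om * s + om ^ 2 * r) := by rw [pt]; ring
  rw [this, om_sq]
  simp [om_re, om_im]
  ring

theorem pt_add (s r s' r' : ℝ) : pt (s + s') (r + r') = pt s r + pt s' r' := by
  simp only [pt]; push_cast; ring

theorem pt_smul (c s r : ℝ) : pt (c * s) (c * r) = c * pt s r := by
  simp only [pt]; push_cast; ring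

/-- The coordinates on `ℂ` in which `3Λ` becomes `ℤ²`. -/
def ptEquiv : (Fin 2 → ℝ) ≃L[ℝ] ℂ :=
  LinearEquiv.toContinuousLinearEquiv
  { toFun := fun x => pt (3 * x 0) (3 * x 1)
    map_add' := fun x y => by
      simp only [Pi.add_apply, mul_add, pt_add]
    map_smul' := fun c x => by
      simp only [Pi.smul_apply, smul_eq_mul, RingHom.id_apply, real_smul]
      rw [← pt_smul]; ring_nf
    invFun := fun z => ![(-(3 / (2 * Real.pi)) * z.im - Real.sqrt 3 / (2 * Real.pi) * z.re) / 6,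
      (-(3 / (2 * Real.pi)) * z.im + Real.sqrt 3 / (2 * Real.pi) * z.re) / 6]
    left_inv := fun x => by
      have h3 : Real.sqrt 3 ≠ 0 := by positivity
      have hp := Real.pi_ne_zero
      funext i
      fin_cases i
      · simp only [pt_re, pt_im, Fin.zero_eta, Matrix.cons_val_zero]; field_simp; ring
      · simp only [pt_re, pt_im, Fin.mk_one, Matrix.cons_val_one, Matrix.cons_val_zero]
        field_simp; ring
    right_inv := fun z => by
      have h3 : Real.sqrt 3 ≠ 0 := by positivity
      have hp := Real.pi_ne_zero
      apply Complex.ext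
      · simp only [pt_re, Matrix.cons_val_zero, Matrix.cons_val_one]; field_simp; ring
      · simp only [pt_im, Matrix.cons_val_zero, Matrix.cons_val_one]; field_simp; ring }

theorem ptEquiv_apply (x : Fin 2 → ℝ) : ptEquiv x = pt (3 * x 0) (3 * x 1) := rfl

theorem cell_eq_image : cell = ptEquiv '' Set.univ.pi fun _ => Set.Ico 0 1 := by
  ext z
  constructor
  · rintro ⟨s, hs, r, hr, rfl⟩
    refine ⟨![s / 3, r / 3], ?_, ?_⟩
    · intro i _
      fin_cases i
      · simp only [Fin.zero_eta, Matrix.cons_val_zero, Set.mem_Ico] at hs ⊢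
        constructor <;> linarith [hs.1, hs.2]
      · simp only [Fin.mk_one, Matrix.cons_val_one, Matrix.cons_val_zero, Set.mem_Ico] at hr ⊢
        constructor <;> linarith [hr.1, hr.2]
    · rw [ptEquiv_apply]
      simp only [Matrix.cons_val_zero, Matrix.cons_val_one]
      congr 1 <;> ring
  · rintro ⟨x, hx, rfl⟩
    have h0 := hx 0 trivial
    have h1 := hx 1 trivial
    simp only [Set.mem_Ico] at h0 h1
    exact ⟨3 * x 0, ⟨by linarith [h0.1], by linarith [h0.2]⟩, 3 * x 1,
      ⟨by linarith [h1.1], by linarith [h1.2]⟩, rfl⟩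

/-- The basis of `3Λ`. -/
def latBasis : Module.Basis (Fin 2) ℝ ℂ := Module.Basis.ofEquivFun ptEquiv.toLinearEquiv.symm

theorem cell_eq_fundamentalDomain : cell = ZSpan.fundamentalDomain latBasis := by
  rw [cell_eq_image]
  ext z
  rw [ZSpan.mem_fundamentalDomain]
  constructor
  · rintro ⟨x, hx, rfl⟩ i
    simpa [latBasis] using hx i trivial
  · intro hz
    refine ⟨ptEquiv.symm z, fun i _ => ?_, by simp⟩
    simpa [latBasis] using hz i

theorem measurableSet_cell : MeasurableSet cell := by
  rw [cell_eq_fundamentalDomain]; exact ZSpan.fundamentalDomain_measurableSet _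

theorem volume_cell_ne_zero : volume cell ≠ 0 := by
  rw [cell_eq_fundamentalDomain]; exact ZSpan.measure_fundamentalDomain_ne_zero _

theorem volume_real_cell_pos : 0 < volume.real cell :=
  ENNReal.toReal_pos volume_cell_ne_zero volume_cell_lt_top.ne

instance : IsFiniteMeasure μcell := ⟨by simpa [μcell] using volume_cell_lt_top⟩

/-- Functions on the torus `ℂ/3Λ`. -/
def Periodic3 {E : Type*} (F : ℂ → E) : Prop :=
  ∀ (a₁ a₂ : ℤ) (z : ℂ), F (z + pt (3 * a₁) (3 * a₂)) = F z

theorem latBasis_apply (i : Fin 2) : latBasis i = ptEquiv (Pi.single i 1) := by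
  simp [latBasis]

theorem exists_pt_of_mem_span {g : ℂ} (hg : g ∈ Submodule.span ℤ (Set.range latBasis)) :
    ∃ a₁ a₂ : ℤ, g = pt (3 * a₁) (3 * a₂) := by
  obtain ⟨c, rfl⟩ := (Submodule.mem_span_range_iff_exists_fun ℤ).1 hg
  refine ⟨c 0, c 1, ?_⟩
  simp only [Fin.sum_univ_two, latBasis_apply, ← Int.cast_smul_eq_zsmul ℝ, ← map_smul, ← map_add]
  rw [ptEquiv_apply]
  simp

instance : Countable (Submodule.span ℤ (Set.range latBasis)).toAddSubgroup :=
  inferInstanceAs (Countable (Submodule.span ℤ (Set.range latBasis)))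

theorem isAddFundamentalDomain_cell :
    IsAddFundamentalDomain (Submodule.span ℤ (Set.range latBasis)).toAddSubgroup cell volume := by
  rw [cell_eq_fundamentalDomain]; exact ZSpan.isAddFundamentalDomain' _ _

theorem Periodic3.vadd {E : Type*} {F : ℂ → E} (hF : Periodic3 F)
    (g : (Submodule.span ℤ (Set.range latBasis)).toAddSubgroup) (z : ℂ) : F (g +ᵥ z) = F z := by
  obtain ⟨a₁, a₂, hg⟩ := exists_pt_of_mem_span g.2
  rw [AddSubgroup.vadd_def, vadd_eq_add, hg, add_comm, hF]

open scoped Pointwise in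
theorem integral_translate {F : ℂ → ℂ} (hF : Periodic3 F) (h : ℂ) :
    ∫ z, F (z + h) ∂μcell = ∫ z, F z ∂μcell := by
  have h1 : IsAddFundamentalDomain (Submodule.span ℤ (Set.range latBasis)).toAddSubgroup
      (h +ᵥ cell) volume :=
    isAddFundamentalDomain_cell.vadd_of_comm h
  have h2 := isAddFundamentalDomain_cell.setIntegral_eq h1 hF.vadd
  rw [μcell, h2]
  have h3 := (measurePreserving_add_right volume h).setIntegral_image_emb
    (measurableEmbedding_addRight h) F cell
  rw [← h3]
  congr 2
  ext z
  simp [Set.mem_vadd_set_iff_neg_vadd_mem, add_comm]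

theorem integral_reflect {F : ℂ → ℂ} (hF : Periodic3 F) :
    ∫ z, F (-z) ∂μcell = ∫ z, F z ∂μcell := by
  have h1 : IsAddFundamentalDomain (Submodule.span ℤ (Set.range latBasis)).toAddSubgroup
      ((fun z : ℂ => -z) ⁻¹' cell) volume :=
    isAddFundamentalDomain_cell.preimage_of_equiv
      (Measure.measurePreserving_neg volume).quasiMeasurePreserving
      (e := fun g => -g) (Equiv.neg _).bijective (fun g z => by
        simp [AddSubgroup.vadd_def, add_comm])
  have h2 := isAddFundamentalDomain_cell.setIntegral_eq h1 hF.vadd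
  rw [μcell, h2]
  have h3 := (Measure.measurePreserving_neg (volume : Measure ℂ)).setIntegral_image_emb
    (MeasurableEquiv.neg ℂ).measurableEmbedding F cell
  rw [← h3]
  congr 2
  ext z
  simp

/-! ### Fourier modes on the torus -/

/-- The frequency `p` of the Fourier mode `exp (i ⟨z, p⟩)` on `ℂ/3Λ` with index `n`. -/
def freq (n : Fin 2 → ℤ) : ℂ :=
  -(Real.sqrt 3 / 6 * (n 0 - n 1) : ℝ) - ((n 0 + n 1) / 2 : ℝ) * I

/-- The Fourier mode `exp (i ⟨z, p⟩)`, where `p = freq n`. -/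
def mode (n : Fin 2 → ℤ) (z : ℂ) : ℂ := exp (((z * conj (freq n)).re : ℝ) * I)

theorem freq_add (m n : Fin 2 → ℤ) : freq (m + n) = freq m + freq n := by
  simp only [freq, Pi.add_apply]; push_cast; ring

theorem freq_neg (n : Fin 2 → ℤ) : freq (-n) = -freq n := by
  simp only [freq, Pi.neg_apply]; push_cast; ring

theorem freq_re (n : Fin 2 → ℤ) : (freq n).re = -(Real.sqrt 3 / 6 * (n 0 - n 1)) := by
  simp [freq]

theorem freq_im (n : Fin 2 → ℤ) : (freq n).im = -((n 0 + n 1) / 2) := by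
  simp [freq]

theorem mode_add_left (m n : Fin 2 → ℤ) (z : ℂ) : mode (m + n) z = mode m z * mode n z := by
  simp only [mode, freq_add, map_add, mul_add, add_re, ofReal_add, add_mul, exp_add]

theorem mode_add_right (n : Fin 2 → ℤ) (z h : ℂ) : mode n (z + h) = mode n z * mode n h := by
  simp only [mode, add_mul, add_re, ofReal_add, exp_add]

theorem norm_mode (n : Fin 2 → ℤ) (z : ℂ) : ‖mode n z‖ = 1 := norm_exp_ofReal_mul_I _

theorem mode_neg_right (n : Fin 2 → ℤ) (z : ℂ) : mode n (-z) = conj (mode n z) := by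
  simp [mode, ← exp_conj]
  ring_nf

theorem mode_neg_left (n : Fin 2 → ℤ) (z : ℂ) : mode (-n) z = conj (mode n z) := by
  simp [mode, ← exp_conj, freq_neg]
  ring_nf

theorem mode_zero (z : ℂ) : mode 0 z = 1 := by simp [mode, freq]

theorem conj_mul_mode (n : Fin 2 → ℤ) (z : ℂ) : conj (mode n z) * mode n z = 1 := by
  rw [← mode_neg_left, ← mode_add_left, neg_add_cancel, mode_zero]

theorem mode_pt (n : Fin 2 → ℤ) (s r : ℝ) :
    mode n (pt s r) = exp (2 * Real.pi * I * (n 0 * s + n 1 * r) / 3) := by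
  have h3 : Real.sqrt 3 ≠ 0 := by positivity
  have : (pt s r * conj (freq n)).re = 2 * Real.pi * (n 0 * s + n 1 * r) / 3 := by
    rw [mul_re, conj_re, conj_im, freq_re, freq_im, pt_re, pt_im]
    field_simp
    ring
  rw [mode, this]
  push_cast
  ring_nf

theorem mode_ptEquiv (n : Fin 2 → ℤ) (x : Fin 2 → ℝ) :
    mode n (ptEquiv x) = exp (2 * Real.pi * I * n 0 * x 0) * exp (2 * Real.pi * I * n 1 * x 1) := by
  rw [ptEquiv_apply, mode_pt, ← exp_add]
  push_cast
  ring_nf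

theorem mode_periodic (n : Fin 2 → ℤ) : Periodic3 (mode n) := by
  intro a₁ a₂ z
  rw [mode_add_right, mode_pt]
  have : (2 * Real.pi * I * (n 0 * ((3 * a₁ : ℝ) : ℂ) + n 1 * ((3 * a₂ : ℝ) : ℂ)) / 3 : ℂ) =
      ((n 0 * a₁ + n 1 * a₂ : ℤ) : ℂ) * (2 * Real.pi * I) := by push_cast; ring
  rw [this, exp_int_mul_two_pi_mul_I, mul_one]

theorem hasFDerivAt_mode (n : Fin 2 → ℤ) (z : ℂ) :
    ∃ L : ℂ →L[ℝ] ℂ, HasFDerivAt (mode n) L z ∧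
      ∀ e, L e = mode n z * (((e * conj (freq n)).re : ℝ) * I) := by
  let ℓ : ℂ →L[ℝ] ℂ := I • (ofRealCLM ∘L reCLM ∘L
    ((ContinuousLinearMap.mul ℝ ℂ).flip (conj (freq n))))
  have hℓ : ∀ e, ℓ e = ((e * conj (freq n)).re : ℝ) * I := fun e => by
    simp only [smul_apply, ContinuousLinearMap.comp_apply, ofRealCLM_apply,
      reCLM_apply, ContinuousLinearMap.flip_apply, ContinuousLinearMap.mul_apply', smul_eq_mul, ℓ]
    ring
  refine ⟨mode n z • ℓ, ?_, fun e => by simp [hℓ]⟩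
  have h1 := ℓ.hasFDerivAt (x := z)
  have h2 := h1.cexp
  have h3 : (fun z => exp (ℓ z)) = mode n := by ext z; rw [hℓ, mode]
  rw [h3, hℓ] at h2
  exact h2

theorem contDiff_mode (n : Fin 2 → ℤ) : ContDiff ℝ ∞ (mode n) := by
  unfold mode
  have : ContDiff ℝ ∞ fun z : ℂ => (z * conj (freq n)).re :=
    reCLM.contDiff.comp (contDiff_id.mul contDiff_const)
  exact ((ofRealCLM.contDiff.comp this).mul contDiff_const).cexp

theorem continuous_mode (n : Fin 2 → ℤ) : Continuous (mode n) := (contDiff_mode n).continuous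

theorem fderiv_mode (n : Fin 2 → ℤ) (z e : ℂ) :
    fderiv ℝ (mode n) z e = (((e * conj (freq n)).re : ℝ) * I) * mode n z := by
  obtain ⟨L, hL, he⟩ := hasFDerivAt_mode n z
  rw [hL.fderiv, he, mul_comm]

section torus

/-- The circle `ℝ/ℤ` with total mass `1`. -/
local instance : MeasureSpace UnitAddCircle := ⟨AddCircle.haarAddCircle⟩

/-- The points of the fundamental cell as a function on the square torus. -/
def cellPoint (x : UnitAddTorus (Fin 2)) : ℂ :=
  ptEquiv (UnitAddTorus.measurableEquivPiIoc (fun _ => 0) x).1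

theorem mode_cellPoint (n : Fin 2 → ℤ) (x : UnitAddTorus (Fin 2)) :
    mode n (cellPoint x) = UnitAddTorus.mFourier n x := by
  have hx : ∀ i, (((UnitAddTorus.measurableEquivPiIoc (fun _ => 0) x).1 i : ℝ) : UnitAddCircle) =
      x i := fun i =>
    congrFun ((UnitAddTorus.measurableEquivPiIoc (fun _ => (0 : ℝ))).symm_apply_apply x) i
  rw [cellPoint, mode_ptEquiv]
  simp only [UnitAddTorus.mFourier, ContinuousMap.coe_mk, Fin.prod_univ_two]
  rw [← hx 0, ← hx 1, fourier_coe_apply, fourier_coe_apply]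
  simp

/-- The volumes of the square torus and of the cell agree up to a constant factor. This carries
Mathlib's Fourier analysis over from the square torus. -/
theorem exists_measurePreserving_cellPoint :
    ∃ c : ENNReal, c ≠ 0 ∧ c ≠ ⊤ ∧ MeasurePreserving cellPoint volume (c • μcell) := by
  have hL : (Measure.map ptEquiv volume).IsAddHaarMeasure :=
    ptEquiv.isAddHaarMeasure_map volume
  set c := Measure.addHaarScalarFactor (Measure.map ptEquiv volume) (volume : Measure ℂ) with hc
  have hmap : Measure.map ptEquiv volume = c • (volume : Measure ℂ) :=
    Measure.isAddLeftInvariant_eq_smul _ _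
  have hc0 : c ≠ 0 := by
    have := Measure.addHaarScalarFactor_pos_of_isAddHaarMeasure (Measure.map ptEquiv volume)
      (volume : Measure ℂ)
    exact this.ne'
  refine ⟨c, by exact_mod_cast hc0, ENNReal.coe_ne_top, ?_⟩
  have h1 := UnitAddTorus.measurePreserving_equivPiIoc (d := Fin 2) (fun _ => (0 : ℝ))
  have hbox : MeasurableSet {x : Fin 2 → ℝ | ∀ i, x i ∈ Set.Ioc (0 : ℝ) (0 + 1)} :=
    MeasurableSet.univ_pi' fun i => measurableSet_Ioc
  have h2 : MeasurePreserving (Subtype.val : {x : Fin 2 → ℝ // ∀ i, x i ∈ Set.Ioc (0 : ℝ) (0 + 1)} →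
      Fin 2 → ℝ) (Measure.comap Subtype.val volume)
      (volume.restrict {x : Fin 2 → ℝ | ∀ i, x i ∈ Set.Ioc (0 : ℝ) (0 + 1)}) :=
    ⟨measurable_subtype_coe, map_comap_subtype_coe hbox volume⟩
  have hae : (volume : Measure (Fin 2 → ℝ)).restrict {x | ∀ i, x i ∈ Set.Ioc (0 : ℝ) (0 + 1)} =
      volume.restrict (Set.univ.pi fun _ => Set.Ico 0 1) := by
    apply Measure.restrict_congr_set
    have e1 : {x : Fin 2 → ℝ | ∀ i, x i ∈ Set.Ioc (0 : ℝ) (0 + 1)} =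
        Set.univ.pi fun _ => Set.Ioc 0 1 := by ext x; simp
    rw [e1]
    exact Measure.univ_pi_Ioc_ae_eq_Icc.trans Measure.univ_pi_Ico_ae_eq_Icc.symm
  have h3 : MeasurePreserving ptEquiv (volume.restrict (Set.univ.pi fun _ => Set.Ico 0 1))
      (c • μcell) := by
    refine ⟨ptEquiv.continuous.measurable, ?_⟩
    have e1 : (Set.univ.pi fun _ => Set.Ico 0 1) = ptEquiv ⁻¹' cell := by
      rw [cell_eq_image, Set.preimage_image_eq _ ptEquiv.injective]
    rw [e1, ← Measure.restrict_map ptEquiv.continuous.measurable measurableSet_cell, hmap,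
      μcell, Measure.restrict_smul]
  rw [hae] at h2
  exact h3.comp (h2.comp h1)

theorem integral_conj_mode_mul_mode (m n : Fin 2 → ℤ) :
    ∫ z, conj (mode m z) * mode n z ∂μcell = if m = n then (volume.real cell : ℂ) else 0 := by
  obtain ⟨c, hc0, hct, hc⟩ := exists_measurePreserving_cellPoint
  split_ifs with h
  · subst h
    simp [conj_mul_mode, μcell]
  · have h1 := (orthonormal_iff_ite.1 UnitAddTorus.orthonormal_mFourier) m n
    rw [if_neg h, ContinuousMap.inner_toLp] at h1
    have hcont : Continuous fun z => conj (mode m z) * mode n z :=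
      (continuous_conj.comp (continuous_mode m)).mul (continuous_mode n)
    have h2 := integral_map hc.measurable.aemeasurable (μ := volume)
      (f := fun z => conj (mode m z) * mode n z) hcont.aestronglyMeasurable
    rw [hc.map_eq, integral_smul_measure] at h2
    simp only [mode_cellPoint] at h2
    have h3 : c.toReal • ∫ z, conj (mode m z) * mode n z ∂μcell = 0 := by
      rw [h2, ← h1]
      simp [mul_comm]
    exact (smul_eq_zero.1 h3).resolve_left (ENNReal.toReal_ne_zero.2 ⟨hc0, hct⟩)

/-- Completeness of the Fourier modes. -/
theorem ae_eq_zero_of_modes {f : ℂ → ℂ} (hf : MemLp f 2 μcell)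
    (h : ∀ n, ∫ z, conj (mode n z) * f z ∂μcell = 0) : f =ᵐ[μcell] 0 := by
  obtain ⟨c, hc0, hct, hc⟩ := exists_measurePreserving_cellPoint
  have hfc : MemLp f 2 (c • μcell) := hf.smul_measure hct
  have hg : MemLp (f ∘ cellPoint) 2 (volume : Measure (UnitAddTorus (Fin 2))) :=
    hfc.comp_measurePreserving hc
  have hz : hg.toLp (f ∘ cellPoint) = 0 := by
    apply UnitAddTorus.mFourierBasis.repr.injective
    rw [map_zero]
    ext n
    rw [UnitAddTorus.mFourierBasis_repr, UnitAddTorus.mFourierCoeff]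
    have h1 : ∫ t, UnitAddTorus.mFourier (-n) t • hg.toLp (f ∘ cellPoint) t =
        ∫ t, (fun z => conj (mode n z) * f z) (cellPoint t) := by
      apply integral_congr_ae
      filter_upwards [hg.coeFn_toLp] with t ht
      rw [ht, UnitAddTorus.mFourier_neg, ← mode_cellPoint]
      rfl
    have h2 := integral_map hc.measurable.aemeasurable (μ := volume)
      (f := fun z => conj (mode n z) * f z) (by
        rw [hc.map_eq]
        exact ((continuous_conj.comp (continuous_mode n)).aestronglyMeasurable).mul
          hfc.aestronglyMeasurable)
    rw [h1, ← h2, hc.map_eq, integral_smul_measure, h, smul_zero]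
    rfl
  have h3 : f ∘ cellPoint =ᵐ[volume] 0 := by
    have := hg.coeFn_toLp
    rw [hz] at this
    exact this.symm.trans (Lp.coeFn_zero _ _ _)
  have h4 : f =ᵐ[c • μcell] 0 := by
    rw [← hc.map_eq]
    have hm : AEStronglyMeasurable f (Measure.map cellPoint volume) := by
      rw [hc.map_eq]; exact hfc.aestronglyMeasurable
    obtain ⟨f', hf', hff'⟩ := hm
    refine hff'.trans ?_
    have h5 : f' ∘ cellPoint =ᵐ[volume] 0 :=
      (ae_eq_comp hc.measurable.aemeasurable hff'.symm).trans h3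
    exact (ae_map_iff hc.measurable.aemeasurable
      (hf'.measurable (measurableSet_singleton 0))).2 h5
  exact (Measure.ae_ennreal_smul_measure_iff hc0).1 h4

end torus

/-! ### Diagonal operators -/

section Diagonal

variable {H σ : Type*} [NormedAddCommGroup H] [InnerProductSpace ℂ H]

theorem hilbertBasis_ext (b : HilbertBasis σ ℂ H) {x y : H} (h : ∀ i, ⟪b i, x⟫ = ⟪b i, y⟫) :
    x = y := by
  apply b.repr.injective
  ext i
  rw [b.repr_apply_apply, b.repr_apply_apply, h]

theorem hasSum_norm_sq (b : HilbertBasis σ ℂ H) (x : H) :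
    HasSum (fun i => ‖⟪b i, x⟫‖ ^ 2) (‖x‖ ^ 2) := by
  have h := b.hasSum_inner_mul_inner x x
  have h1 : HasSum (fun i => ((‖⟪b i, x⟫‖ ^ 2 : ℝ) : ℂ)) ((‖x‖ ^ 2 : ℝ) : ℂ) := by
    convert! h using 1
    · ext i
      rw [← inner_conj_symm x (b i), mul_comm, mul_conj, normSq_eq_norm_sq]
    · rw [inner_self_eq_norm_sq_to_K]; push_cast; rfl
  exact_mod_cast h1

theorem norm_le_of_coeff (b : HilbertBasis σ ℂ H) {x y : H} {C : ℝ} (hC : 0 ≤ C)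
    (h : ∀ i, ‖⟪b i, y⟫‖ ≤ C * ‖⟪b i, x⟫‖) : ‖y‖ ≤ C * ‖x‖ := by
  have h1 := hasSum_le (fun i => pow_le_pow_left₀ (norm_nonneg _) (h i) 2) (hasSum_norm_sq b y)
    (by simpa only [mul_pow] using (hasSum_norm_sq b x).mul_left (C ^ 2))
  rw [← mul_pow] at h1
  exact (sq_le_sq₀ (norm_nonneg _) (by positivity)).1 h1

theorem exists_diagonal (b : HilbertBasis σ ℂ H) (m : σ → ℂ) {C : ℝ} (hC : 0 ≤ C)
    (hm : ∀ i, ‖m i‖ ≤ C) : ∃ T : H →L[ℂ] H, ∀ i x, ⟪b i, T x⟫ = m i * ⟪b i, x⟫ := by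
  have hmem : ∀ x : H, Memℓp (fun i => m i * b.repr x i) 2 := by
    intro x
    rw [memℓp_gen_iff (by norm_num)]
    have h1 := (hasSum_norm_sq b x).summable.mul_left (C ^ 2)
    refine Summable.of_nonneg_of_le (fun i => by positivity) (fun i => ?_) h1
    rw [b.repr_apply_apply, norm_mul]
    have := mul_le_mul_of_nonneg_right (hm i) (norm_nonneg ⟪b i, x⟫)
    have := pow_le_pow_left₀ (by positivity) this 2
    simpa [mul_pow] using this
  let T : H →ₗ[ℂ] H :=
    { toFun := fun x => b.repr.symm ⟨fun i => m i * b.repr x i, hmem x⟩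
      map_add' := fun x y => by
        rw [← map_add]
        congr 1
        ext i
        simp [mul_add]
        rfl
      map_smul' := fun c x => by
        rw [RingHom.id_apply, ← map_smul]
        congr 1
        ext i
        simp [mul_left_comm] }
  have hT : ∀ i x, ⟪b i, T x⟫ = m i * ⟪b i, x⟫ := fun i x => by
    rw [← b.repr_apply_apply, ← b.repr_apply_apply]
    simp [T]
  refine ⟨T.mkContinuous C fun x => ?_, hT⟩
  refine norm_le_of_coeff b hC fun i => ?_
  rw [hT, norm_mul]
  exact mul_le_mul_of_nonneg_right (hm i) (norm_nonneg _)

theorem isCompactOperator_rankOne (x y : H) : IsCompactOperator (rankOne ℂ x y) := by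
  have h1 : IsCompactOperator (innerSL ℂ y) := isCompactOperator_of_locallyCompactSpace_dom _
  exact h1.clm_comp (toSpanSingleton ℂ x)

/-- A diagonal operator whose entries tend to zero is compact. -/
theorem isCompactOperator_diagonal [CompleteSpace H] (b : HilbertBasis σ ℂ H) {m : σ → ℂ}
    {T : H →L[ℂ] H} (hT : ∀ i x, ⟪b i, T x⟫ = m i * ⟪b i, x⟫)
    (hm : Filter.Tendsto m Filter.cofinite (nhds 0)) : IsCompactOperator T := by
  classical
  let TF : Finset σ → H →L[ℂ] H := fun F => ∑ i ∈ F, m i • rankOne ℂ (b i) (b i)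
  have hTF : ∀ F i x, ⟪b i, TF F x⟫ = if i ∈ F then m i * ⟪b i, x⟫ else 0 := by
    intro F i x
    simp only [TF, sum_apply, smul_apply, rankOne_apply, inner_sum, inner_smul_right,
      orthonormal_iff_ite.1 b.orthonormal, mul_ite, mul_one, mul_zero, Finset.sum_ite_eq]
  have hTFc : ∀ F, IsCompactOperator (TF F) := by
    intro F
    refine Finset.sum_induction _ (fun S : H →L[ℂ] H => IsCompactOperator S) ?_ ?_ ?_
    · intro S S' h h'; exact h.add h'
    · exact isCompactOperator_zero
    · intro i _; exact (isCompactOperator_rankOne _ _).smul (m i)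
  refine isCompactOperator_of_tendsto (l := Filter.atTop) (F := TF) ?_
    (Filter.Eventually.of_forall hTFc)
  rw [Metric.tendsto_atTop]
  intro ε hε
  have h1 : {i | ¬ ‖m i‖ < ε / 2}.Finite := by
    have := hm.eventually (Metric.ball_mem_nhds 0 (half_pos hε))
    simpa [Filter.eventually_cofinite] using this
  refine ⟨h1.toFinset, fun F hF => ?_⟩
  rw [dist_eq_norm]
  refine lt_of_le_of_lt (opNorm_le_bound _ (half_pos hε).le fun x => ?_) (half_lt_self hε)
  refine norm_le_of_coeff b (half_pos hε).le fun i => ?_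
  rw [sub_apply, inner_sub_right, hT, hTF]
  split_ifs with hi
  · rw [sub_self, norm_zero]; positivity
  · have : ‖m i‖ < ε / 2 := by
      by_contra hc
      exact hi (hF (h1.mem_toFinset.2 hc))
    rw [zero_sub, norm_neg, norm_mul]
    exact mul_le_mul_of_nonneg_right this.le (norm_nonneg _)

theorem diagonal_apply_basis (b : HilbertBasis σ ℂ H) {m : σ → ℂ} {T : H →L[ℂ] H}
    (hT : ∀ i x, ⟪b i, T x⟫ = m i * ⟪b i, x⟫) (i : σ) : T (b i) = m i • b i := by
  classical
  refine hilbertBasis_ext b fun j => ?_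
  rw [hT, inner_smul_right, orthonormal_iff_ite.1 b.orthonormal]
  split_ifs with h
  · rw [h]
  · simp

theorem diagonal_adjoint [CompleteSpace H] (b : HilbertBasis σ ℂ H) {m : σ → ℂ} {T : H →L[ℂ] H}
    (hT : ∀ i x, ⟪b i, T x⟫ = m i * ⟪b i, x⟫) (i : σ) (x : H) :
    ⟪b i, adjoint T x⟫ = conj (m i) * ⟪b i, x⟫ := by
  rw [adjoint_inner_right, diagonal_apply_basis b hT, inner_smul_left]

theorem diagonal_injective (b : HilbertBasis σ ℂ H) {m : σ → ℂ} {T : H →L[ℂ] H}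
    (hT : ∀ i x, ⟪b i, T x⟫ = m i * ⟪b i, x⟫) (hm : ∀ i, m i ≠ 0) : Function.Injective T := by
  intro x y hxy
  refine hilbertBasis_ext b fun i => mul_left_cancel₀ (hm i) ?_
  rw [← hT, ← hT, hxy]

end Diagonal

/-! ### The Fourier basis of `L²` -/

section L2basis

variable {ι : Type} [Fintype ι]

theorem memLp_coord (v : L2 ι) (j : ι) : MemLp (fun z => v z j) 2 μcell :=
  (EuclideanSpace.proj j : EuclideanSpace ℂ ι →L[ℂ] ℂ).comp_memLp' (Lp.memLp v)

variable [DecidableEq ι]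

/-- The normalizing factor of the Fourier modes. -/
def modeScale : ℂ := (((volume.real cell) ^ (-(1 / 2) : ℝ) : ℝ) : ℂ)

theorem modeScale_mul : modeScale * modeScale * (volume.real cell : ℂ) = 1 := by
  have h := volume_real_cell_pos
  rw [modeScale]
  norm_cast
  rw [← Real.rpow_add h]
  norm_num
  rw [Real.rpow_neg_one, inv_mul_cancel₀ h.ne']

theorem modeScale_ne_zero : modeScale ≠ 0 := by
  intro h
  have := modeScale_mul
  rw [h] at this
  simp at this

theorem conj_modeScale : conj modeScale = modeScale := conj_ofReal _

theorem modeFun_memLp (n : Fin 2 → ℤ) (j : ι) :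
    MemLp (fun z => EuclideanSpace.single j (modeScale * mode n z)) 2 μcell := by
  have hc : Continuous fun z => EuclideanSpace.single j (modeScale * mode n z) := by
    have h1 : Continuous fun a : ℂ => (EuclideanSpace.single j a : EuclideanSpace ℂ ι) := by
      have : (fun a : ℂ => (EuclideanSpace.single j a : EuclideanSpace ℂ ι)) =
          fun a => a • EuclideanSpace.single j (1 : ℂ) := by
        ext a i
        simp
      rw [this]
      fun_prop
    exact h1.comp (continuous_const.mul (continuous_mode n))
  refine MemLp.of_bound hc.aestronglyMeasurable ‖modeScale‖
    (Filter.Eventually.of_forall fun z => ?_)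
  simp [norm_mode]

/-- The normalized Fourier mode with index `n` in the component `j`. -/
def modeLp (p : (Fin 2 → ℤ) × ι) : L2 ι := (modeFun_memLp p.1 p.2).toLp _

theorem coeFn_modeLp (p : (Fin 2 → ℤ) × ι) :
    modeLp p =ᵐ[μcell] fun z => EuclideanSpace.single p.2 (modeScale * mode p.1 z) :=
  MemLp.coeFn_toLp _

theorem inner_modeLp (n : Fin 2 → ℤ) (j : ι) (v : L2 ι) :
    ⟪modeLp (n, j), v⟫ = modeScale * ∫ z, conj (mode n z) * v z j ∂μcell := by
  rw [L2.inner_def, ← integral_const_mul]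
  apply integral_congr_ae
  filter_upwards [coeFn_modeLp (n, j)] with z hz
  rw [hz, EuclideanSpace.inner_single_left, map_mul, conj_modeScale, mul_assoc]

theorem orthonormal_modeLp : Orthonormal ℂ (modeLp : (Fin 2 → ℤ) × ι → L2 ι) := by
  rw [orthonormal_iff_ite]
  rintro ⟨m, i⟩ ⟨n, j⟩
  rw [inner_modeLp]
  have h1 : ∫ z, conj (mode m z) * (modeLp (n, j) : L2 ι) z i ∂μcell =
      ∫ z, (if i = j then modeScale else 0) * (conj (mode m z) * mode n z) ∂μcell := by
    apply integral_congr_ae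
    filter_upwards [coeFn_modeLp (n, j)] with z hz
    rw [hz]
    by_cases h : i = j
    · simp [h]; ring
    · simp [h]
  rw [h1, integral_const_mul, integral_conj_mode_mul_mode]
  by_cases hij : i = j <;> by_cases hmn : m = n <;> simp [hij, hmn]
  rw [← mul_assoc, modeScale_mul]

theorem modeLp_total : (Submodule.span ℂ (Set.range (modeLp : (Fin 2 → ℤ) × ι → L2 ι)))ᗮ = ⊥ := by
  rw [Submodule.eq_bot_iff]
  intro v hv
  rw [Submodule.mem_orthogonal] at hv
  have h1 : ∀ j, (fun z => v z j) =ᵐ[μcell] 0 := fun j => by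
    refine ae_eq_zero_of_modes (memLp_coord v j) fun n => ?_
    have := hv _ (Submodule.subset_span ⟨(n, j), rfl⟩)
    rw [inner_modeLp] at this
    exact (mul_eq_zero.1 this).resolve_left modeScale_ne_zero
  apply Lp.ext
  filter_upwards [ae_all_iff.2 h1, Lp.coeFn_zero (EuclideanSpace ℂ ι) 2 μcell] with z hz h0
  rw [h0]
  ext j
  exact hz j

/-- The Fourier basis of `L²(ℂ/3Λ; ℂ^ι)`. -/
def modeBasis (ι : Type) [Fintype ι] [DecidableEq ι] :
    HilbertBasis ((Fin 2 → ℤ) × ι) ℂ (L2 ι) :=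
  HilbertBasis.mkOfOrthogonalEqBot orthonormal_modeLp modeLp_total

theorem coe_modeBasis : ⇑(modeBasis ι) = modeLp :=
  HilbertBasis.coe_mkOfOrthogonalEqBot _ _

theorem inner_modeBasis (n : Fin 2 → ℤ) (j : ι) (v : L2 ι) :
    ⟪modeBasis ι (n, j), v⟫ = modeScale * ∫ z, conj (mode n z) * v z j ∂μcell := by
  rw [coe_modeBasis, inner_modeLp]

end L2basis

/-! ### The space `L²_0` in Fourier space -/

section L20

variable {ι : Type} [Fintype ι]

/-- The factor by which the modified translation `𝓛_a` multiplies a component of the given kind. -/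
def kindFactor (c : Fin 2) (a₁ a₂ : ℤ) : ℂ := if c = 0 then om ^ (a₁ + a₂) else 1

theorem om_cube : om ^ 3 = 1 := by
  rw [pow_succ, om_sq, sub_mul, ← sq, om_sq]; ring

theorem om_ne_zero : om ≠ 0 := exp_ne_zero _

theorem kindFactor_ne_zero (c : Fin 2) (a₁ a₂ : ℤ) : kindFactor c a₁ a₂ ≠ 0 := by
  unfold kindFactor
  split_ifs
  · exact zpow_ne_zero _ om_ne_zero
  · exact one_ne_zero

theorem kindFactor_three (c : Fin 2) (a₁ a₂ : ℤ) : kindFactor c (3 * a₁) (3 * a₂) = 1 := by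
  unfold kindFactor
  split_ifs
  · rw [← mul_add, zpow_mul, show om ^ (3 : ℤ) = 1 by exact_mod_cast om_cube, one_zpow]
  · rfl

/-- The Fourier modes that are invariant under all `𝓛_a`. -/
def Adm (c : Fin 2) (n : Fin 2 → ℤ) : Prop :=
  ∀ a₁ a₂ : ℤ, kindFactor c a₁ a₂ * mode n (pt a₁ a₂) = 1

theorem isClosed_L20 (χ : ι → Fin 2) : IsClosed (L20 χ : Set (L2 ι)) := by
  classical
  refine IsSeqClosed.isClosed fun f v hf hv => ?_
  choose u hu hfu using hf
  obtain ⟨ns, -, hns⟩ := (tendstoInMeasure_of_tendsto_Lp hv).exists_seq_tendsto_ae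
  -- The pointwise limit along a subsequence exists on whole orbits of `Λ`.
  let good : ℂ → ι → Prop := fun z j => ∃ l, Filter.Tendsto (fun k => u (ns k) z j) Filter.atTop
    (nhds l)
  let w : ℂ → ι → ℂ := fun z j => if h : good z j then h.choose else 0
  have hw : ∀ z j l, Filter.Tendsto (fun k => u (ns k) z j) Filter.atTop (nhds l) →
      w z j = l := by
    intro z j l hl
    have hg : good z j := ⟨l, hl⟩
    simp only [w, dif_pos hg]
    exact tendsto_nhds_unique hg.choose_spec hl
  refine ⟨fun z => WithLp.toLp 2 (w z), ?_, ?_⟩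
  · intro a₁ a₂ z j
    change kindFactor (χ j) a₁ a₂ * w (z + pt a₁ a₂) j = w z j
    have hrel : ∀ k, u (ns k) (z + pt a₁ a₂) j = (kindFactor (χ j) a₁ a₂)⁻¹ * u (ns k) z j := by
      intro k
      rw [← hu (ns k) a₁ a₂ z j]
      change _ = (kindFactor (χ j) a₁ a₂)⁻¹ * (kindFactor (χ j) a₁ a₂ * _)
      rw [inv_mul_cancel_left₀ (kindFactor_ne_zero _ _ _)]
    by_cases hg : good z j
    · obtain ⟨l, hl⟩ := hg
      have h2 := hl.const_mul (kindFactor (χ j) a₁ a₂)⁻¹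
      simp only [← hrel] at h2
      rw [hw _ _ _ hl, hw _ _ _ h2, mul_inv_cancel_left₀ (kindFactor_ne_zero _ _ _)]
    · have hg' : ¬ good (z + pt a₁ a₂) j := by
        rintro ⟨l, hl⟩
        refine hg ⟨kindFactor (χ j) a₁ a₂ * l, ?_⟩
        have := hl.const_mul (kindFactor (χ j) a₁ a₂)
        simpa only [hrel, mul_inv_cancel_left₀ (kindFactor_ne_zero _ _ _)] using this
      simp only [w, dif_neg hg, dif_neg hg', mul_zero]
  · filter_upwards [hns, ae_all_iff.2 hfu] with z hz hzu
    ext j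
    refine (hw z j _ ?_).symm
    have h1 : Filter.Tendsto (fun k => f (ns k) z j) Filter.atTop (nhds (v z j)) :=
      ((EuclideanSpace.proj j : EuclideanSpace ℂ ι →L[ℂ] ℂ).continuous.tendsto _).comp hz
    simpa only [hzu] using h1

variable [DecidableEq ι]

theorem modeLp_mem_L20 {χ : ι → Fin 2} {n : Fin 2 → ℤ} {j : ι} (h : Adm (χ j) n) :
    modeLp (n, j) ∈ L20 χ := by
  refine ⟨_, fun a₁ a₂ z i => ?_, coeFn_modeLp (n, j)⟩
  change kindFactor (χ i) a₁ a₂ * _ = _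
  by_cases hij : i = j
  · subst hij
    simp only [PiLp.single_apply, if_true, mode_add_right]
    linear_combination (modeScale * mode n z) * h a₁ a₂
  · simp [hij]

/-- The invariance under the modified translations means that only admissible modes occur. -/
theorem mem_L20_iff (χ : ι → Fin 2) (v : L2 ι) :
    v ∈ L20 χ ↔ ∀ n j, ¬ Adm (χ j) n → ⟪modeBasis ι (n, j), v⟫ = 0 := by
  constructor
  · rintro ⟨u, hu, hvu⟩ n j hn
    rw [Adm] at hn
    push Not at hn
    obtain ⟨a₁, a₂, ha⟩ := hn
    have hu' : ∀ (a₁ a₂ : ℤ) z, kindFactor (χ j) a₁ a₂ * u (z + pt a₁ a₂) j = u z j :=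
      fun a₁ a₂ z => hu a₁ a₂ z j
    have hper : Periodic3 fun z => conj (mode n z) * u z j := by
      intro b₁ b₂ z
      have := hu' (3 * b₁) (3 * b₂) z
      rw [kindFactor_three, one_mul] at this
      push_cast at this
      simp only [mode_periodic n b₁ b₂ z, this]
    have h1 := integral_translate hper (pt a₁ a₂)
    have h2 : ∀ z, conj (mode n z) * u z j = kindFactor (χ j) a₁ a₂ * mode n (pt a₁ a₂) *
        (conj (mode n (z + pt a₁ a₂)) * u (z + pt a₁ a₂) j) := by
      intro z
      rw [← hu' a₁ a₂ z, mode_add_right, map_mul]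
      linear_combination (-(conj (mode n z) * kindFactor (χ j) a₁ a₂ * u (z + pt a₁ a₂) j)) *
        conj_mul_mode n (pt a₁ a₂)
    have h3 : ∫ z, conj (mode n z) * u z j ∂μcell = kindFactor (χ j) a₁ a₂ * mode n (pt a₁ a₂) *
        ∫ z, conj (mode n z) * u z j ∂μcell := by
      conv_lhs => rw [funext h2]
      rw [integral_const_mul, h1]
    have h4 : ∫ z, conj (mode n z) * u z j ∂μcell = 0 := by
      by_contra hne
      exact ha (mul_right_cancel₀ hne (by rw [one_mul]; exact h3.symm))
    rw [inner_modeBasis]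
    have h5 : ∫ z, conj (mode n z) * v z j ∂μcell = ∫ z, conj (mode n z) * u z j ∂μcell := by
      apply integral_congr_ae
      filter_upwards [hvu] with z hz
      rw [hz]
    rw [h5, h4, mul_zero]
  · intro h
    have hs := (modeBasis ι).hasSum_repr v
    refine (isClosed_L20 χ).mem_of_tendsto hs (Filter.Eventually.of_forall fun F => ?_)
    refine Submodule.sum_mem _ fun p _ => ?_
    by_cases hp : Adm (χ p.2) p.1
    · rw [coe_modeBasis]
      exact Submodule.smul_mem _ _ (modeLp_mem_L20 hp)
    · rw [HilbertBasis.repr_apply_apply, h p.1 p.2 hp, zero_smul]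
      exact Submodule.zero_mem _

end L20

/-! ### Weak derivatives as Fourier multipliers -/

theorem exists_cell_subset_closedBall : ∃ r, cell ⊆ Metric.closedBall 0 r := by
  have hb : Bornology.IsBounded cell := by
    rw [cell_eq_fundamentalDomain]; exact ZSpan.fundamentalDomain_isBounded _
  exact hb.subset_closedBall 0

theorem exists_bound_on_cell {E : Type*} [NormedAddCommGroup E] {F : ℂ → E} (hF : Continuous F) :
    ∃ C, 0 ≤ C ∧ ∀ z ∈ cell, ‖F z‖ ≤ C := by
  obtain ⟨r, hr⟩ := exists_cell_subset_closedBall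
  obtain ⟨C, hC⟩ := (isCompact_closedBall (0 : ℂ) r).exists_bound_of_continuousOn hF.continuousOn
  exact ⟨max C 0, le_max_right _ _, fun z hz => (hC z (hr hz)).trans (le_max_left _ _)⟩

theorem ae_mem_cell : ∀ᵐ z ∂μcell, z ∈ cell := ae_restrict_mem measurableSet_cell

theorem memLp_of_continuous {E : Type*} [NormedAddCommGroup E] [SecondCountableTopology E]
    {F : ℂ → E} (hF : Continuous F) (p : ENNReal) : MemLp F p μcell := by
  obtain ⟨C, -, hC⟩ := exists_bound_on_cell hF
  refine MemLp.of_bound hF.aestronglyMeasurable C ?_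
  filter_upwards [ae_mem_cell] with z hz using hC z hz

/-- The integral over the torus of a directional derivative vanishes, by translation invariance. -/
theorem integral_fderiv_eq_zero {F : ℂ → ℂ} (hF : ContDiff ℝ ∞ F) (hper : Periodic3 F) (e : ℂ) :
    ∫ z, fderiv ℝ F z e ∂μcell = 0 := by
  obtain ⟨r, hr⟩ := exists_cell_subset_closedBall
  have hF' : Continuous fun z => fderiv ℝ F z e :=
    (hF.continuous_fderiv (by simp)).clm_apply continuous_const
  obtain ⟨C, hC⟩ := (isCompact_closedBall (0 : ℂ) (r + ‖e‖)).exists_bound_of_continuousOn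
    hF'.continuousOn
  have hmain := hasDerivAt_integral_of_dominated_loc_of_deriv_le (μ := μcell) (𝕜 := ℝ)
    (F := fun t z => F (z + t * e)) (F' := fun t z => fderiv ℝ F (z + t * e) e) (x₀ := 0)
    (s := Metric.ball 0 1) (bound := fun _ => C) (Metric.ball_mem_nhds 0 one_pos)
    (Filter.Eventually.of_forall fun t =>
      (hF.continuous.comp (continuous_id.add continuous_const)).aestronglyMeasurable)
    (by simpa using (memLp_of_continuous hF.continuous 1).integrable le_rfl)
    (by simpa using hF'.aestronglyMeasurable)
    (by
      filter_upwards [ae_mem_cell] with z hz t ht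
      apply hC
      have h1 := hr hz
      simp only [Metric.mem_closedBall, dist_zero_right, Metric.mem_ball] at h1 ht ⊢
      refine (norm_add_le _ _).trans (add_le_add h1 ?_)
      rw [norm_mul, norm_real]
      exact mul_le_of_le_one_left (norm_nonneg _) ht.le)
    (integrable_const C)
    (Filter.Eventually.of_forall fun z t _ => by
      have h1 : HasDerivAt (fun t : ℝ => z + (t : ℂ) * e) e t := by
        simpa using (((hasDerivAt_id t).ofReal_comp).mul_const e).const_add z
      have h2 := (hF.differentiable (by simp) (z + t * e)).hasFDerivAt
      exact h2.comp_hasDerivAt t h1)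
  have hconst : (fun t : ℝ => ∫ z, F (z + t * e) ∂μcell) = fun _ => ∫ z, F z ∂μcell := by
    ext t
    exact integral_translate hper _
  have h2 := hmain.2
  rw [hconst] at h2
  have h3 := h2.unique (hasDerivAt_const 0 _)
  simpa using h3

theorem integral_mode_mul_fderiv (n : Fin 2 → ℤ) {φ : ℂ → ℂ} (hφ : ContDiff ℝ ∞ φ)
    (hper : Periodic3 φ) (e : ℂ) :
    ∫ z, mode n z * fderiv ℝ φ z e ∂μcell =
      -(((e * conj (freq n)).re : ℝ) * I * ∫ z, mode n z * φ z ∂μcell) := by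
  have h1 := integral_fderiv_eq_zero ((contDiff_mode n).mul hφ)
    (fun a b z => by simp only [mode_periodic n a b z, hper a b z]) e
  have h2 : ∀ z, fderiv ℝ (fun z => mode n z * φ z) z e =
      mode n z * fderiv ℝ φ z e + ((e * conj (freq n)).re : ℝ) * I * (mode n z * φ z) := by
    intro z
    rw [fderiv_fun_mul ((contDiff_mode n).differentiable (by simp) z)
      (hφ.differentiable (by simp) z)]
    simp only [add_apply, smul_apply, smul_eq_mul, fderiv_mode]
    ring
  have i1 : Integrable (fun z => mode n z * fderiv ℝ φ z e) μcell :=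
    (memLp_of_continuous ((continuous_mode n).mul
      ((hφ.continuous_fderiv (by simp)).clm_apply continuous_const)) 1).integrable le_rfl
  have i2 : Integrable (fun z => ((e * conj (freq n)).re : ℝ) * I * (mode n z * φ z)) μcell :=
    (memLp_of_continuous (continuous_const.mul ((continuous_mode n).mul hφ.continuous))
      1).integrable le_rfl
  simp only [h2] at h1
  rw [integral_add i1 i2, integral_const_mul] at h1
  exact eq_neg_of_add_eq_zero_left h1

section weak

variable {ι : Type} [Fintype ι] [DecidableEq ι]

/-- Weak differentiation is multiplication of the Fourier coefficients. -/
theorem coeff_of_hasWeakDeriv {e : ℂ} {v g : L2 ι} {j : ι}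
    (h : HasWeakDeriv e (fun z => v z j) (fun z => g z j)) (n : Fin 2 → ℤ) :
    ⟪modeBasis ι (n, j), g⟫ = ((e * conj (freq n)).re : ℝ) * I * ⟪modeBasis ι (n, j), v⟫ := by
  have h1 := h (mode (-n)) (contDiff_mode _) (mode_periodic _)
  simp only [fderiv_mode, mode_neg_left, freq_neg] at h1
  rw [inner_modeBasis, inner_modeBasis]
  have h2 : ∫ z, v z j * (((e * conj (-freq n)).re : ℝ) * I * conj (mode n z)) ∂μcell =
      -(((e * conj (freq n)).re : ℝ) * I * ∫ z, conj (mode n z) * v z j ∂μcell) := by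
    rw [← integral_const_mul, ← integral_neg]
    congr 1
    ext z
    simp only [map_neg, mul_neg, neg_re, ofReal_neg]
    ring
  have h3 : ∫ z, g z j * conj (mode n z) ∂μcell = ∫ z, conj (mode n z) * g z j ∂μcell := by
    simp only [mul_comm]
  rw [h2, h3] at h1
  linear_combination modeScale * h1

/-- Integration against a continuous function is the inner product with an element of `L²`. -/
theorem exists_pairing {ψ : ℂ → ℂ} (hψ : Continuous ψ) (j : ι) :
    ∃ Ψ : L2 ι, ∀ v : L2 ι, ⟪Ψ, v⟫ = ∫ z, v z j * ψ z ∂μcell := by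
  have hc : Continuous fun z => (EuclideanSpace.single j (conj (ψ z)) : EuclideanSpace ℂ ι) := by
    have h1 : (fun z => (EuclideanSpace.single j (conj (ψ z)) : EuclideanSpace ℂ ι)) =
        fun z => conj (ψ z) • EuclideanSpace.single j (1 : ℂ) := by
      ext z i
      simp
    rw [h1]
    exact (continuous_conj.comp hψ).smul continuous_const
  refine ⟨(memLp_of_continuous hc 2).toLp _, fun v => ?_⟩
  rw [L2.inner_def]
  apply integral_congr_ae
  filter_upwards [(memLp_of_continuous hc 2).coeFn_toLp] with z hz
  rw [hz, EuclideanSpace.inner_single_left, conj_conj, mul_comm]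

theorem integral_modeBasis (n : Fin 2 → ℤ) (i j : ι) (ψ : ℂ → ℂ) :
    ∫ z, modeBasis ι (n, i) z j * ψ z ∂μcell =
      if i = j then modeScale * ∫ z, mode n z * ψ z ∂μcell else 0 := by
  rw [coe_modeBasis]
  have h1 : ∫ z, (modeLp (n, i) : L2 ι) z j * ψ z ∂μcell =
      ∫ z, (if i = j then modeScale else 0) * (mode n z * ψ z) ∂μcell := by
    apply integral_congr_ae
    filter_upwards [coeFn_modeLp (n, i)] with z hz
    rw [hz]
    by_cases h : i = j
    · simp [h]; ring
    · have h' : j ≠ i := fun hh => h hh.symm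
      simp [h, h']
  rw [h1, integral_const_mul]
  split_ifs <;> simp

/-- A Fourier multiplier `m`, followed by multiplication with the symbol of a derivative, is the
weak derivative of the multiplier. -/
theorem hasWeakDeriv_multiplier {m : (Fin 2 → ℤ) × ι → ℂ} {e : ℂ} {T S : L2 ι →L[ℂ] L2 ι}
    (hT : ∀ i x, ⟪modeBasis ι i, T x⟫ = m i * ⟪modeBasis ι i, x⟫)
    (hS : ∀ i x, ⟪modeBasis ι i, S x⟫ = ((e * conj (freq i.1)).re : ℝ) * I * m i *
      ⟪modeBasis ι i, x⟫) (f : L2 ι) (j : ι) :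
    HasWeakDeriv e (fun z => T f z j) (fun z => S f z j) := by
  intro φ hφ hper
  obtain ⟨Ψ₁, hΨ₁⟩ := exists_pairing (ι := ι)
    (((hφ.continuous_fderiv (by simp)).clm_apply continuous_const :
      Continuous fun z => fderiv ℝ φ z e)) j
  obtain ⟨Ψ₂, hΨ₂⟩ := exists_pairing (ι := ι) hφ.continuous j
  rw [← hΨ₁, ← hΨ₂]
  have key : adjoint T Ψ₁ + adjoint S Ψ₂ = 0 := by
    refine hilbertBasis_ext (modeBasis ι) fun p => ?_
    obtain ⟨n, i⟩ := p
    rw [inner_zero_right, ← inner_conj_symm, inner_add_left, adjoint_inner_left,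
      adjoint_inner_left, diagonal_apply_basis _ hT, diagonal_apply_basis _ hS, inner_smul_right,
      inner_smul_right, hΨ₁, hΨ₂, integral_modeBasis, integral_modeBasis]
    split_ifs
    · rw [integral_mode_mul_fderiv n hφ hper]
      have : m (n, i) * (modeScale * -(((e * conj (freq n)).re : ℝ) * I *
          ∫ z, mode n z * φ z ∂μcell)) + ((e * conj (freq n)).re : ℝ) * I * m (n, i) *
          (modeScale * ∫ z, mode n z * φ z ∂μcell) = 0 := by ring
      rw [this, map_zero]
    · simp
  have h := congrArg (fun y => ⟪y, f⟫) key
  simp only [inner_add_left, adjoint_inner_left, inner_zero_left] at h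
  exact eq_neg_of_add_eq_zero_left h

end weak

/-! ### Equivariant potentials -/

section Equivariance

variable {ι : Type}

/-- Continuous potentials that commute with the modified translations `𝓛_a`. -/
structure GoodPot (χ : ι → Fin 2) (V : ℂ → Matrix ι ι ℂ) : Prop where
  continuous : Continuous V
  equivariant : ∀ (a₁ a₂ : ℤ) (z : ℂ) (j l : ι),
    kindFactor (χ j) a₁ a₂ * V (z + pt a₁ a₂) j l = V z j l * kindFactor (χ l) a₁ a₂

theorem conj_om_mul_om : conj om * om = 1 := by
  rw [mul_comm, mul_conj, normSq_apply, om_re, om_im]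
  rw [show (-1 / 2 : ℝ) * (-1 / 2) + Real.sqrt 3 / 2 * (Real.sqrt 3 / 2) = 1 by
    nlinarith [sqrt_three_sq], ofReal_one]

theorem conj_kindFactor (c : Fin 2) (a₁ a₂ : ℤ) :
    conj (kindFactor c a₁ a₂) * kindFactor c a₁ a₂ = 1 := by
  unfold kindFactor
  split_ifs
  · rw [map_zpow₀, ← mul_zpow, conj_om_mul_om, one_zpow]
  · simp

theorem GoodPot.conjTranspose {χ : ι → Fin 2} {V : ℂ → Matrix ι ι ℂ} (h : GoodPot χ V) :
    GoodPot χ fun z => (V z).conjTranspose where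
  continuous := h.continuous.matrix_conjTranspose
  equivariant a₁ a₂ z j l := by
    have h1 := congrArg conj (h.equivariant a₁ a₂ z l j)
    simp only [map_mul] at h1
    simp only [Matrix.conjTranspose_apply, RCLike.star_def]
    have hj := conj_kindFactor (χ j) a₁ a₂
    have hl := conj_kindFactor (χ l) a₁ a₂
    linear_combination (kindFactor (χ j) a₁ a₂ * kindFactor (χ l) a₁ a₂) * h1 -
      (kindFactor (χ j) a₁ a₂ * conj (V (z + pt a₁ a₂) l j)) * hl +
      (kindFactor (χ l) a₁ a₂ * conj (V z l j)) * hj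

theorem GoodPot.periodic {χ : ι → Fin 2} {V : ℂ → Matrix ι ι ℂ} (h : GoodPot χ V) (i j : ι) :
    Periodic3 fun z => V z i j := by
  intro a₁ a₂ z
  have := h.equivariant (3 * a₁) (3 * a₂) z i j
  rw [kindFactor_three, kindFactor_three, one_mul, mul_one] at this
  exact_mod_cast this

end Equivariance

/-! ### Multiplication operators -/

section MatrixMultiplication

variable {ι : Type} [Fintype ι] [DecidableEq ι]

theorem continuous_toEuclideanCLM :
    Continuous (Matrix.toEuclideanCLM (𝕜 := ℂ) : Matrix ι ι ℂ → _) :=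
  (Matrix.toEuclideanCLM (𝕜 := ℂ) (n := ι)).toAlgEquiv.toLinearMap.continuous_of_finiteDimensional

theorem toEuclideanCLM_coord (A : Matrix ι ι ℂ) (x : EuclideanSpace ℂ ι) (j : ι) :
    Matrix.toEuclideanCLM (𝕜 := ℂ) A x j = ∑ l, A j l * x l := by
  rw [Matrix.ofLp_toEuclideanCLM]; rfl

theorem exists_mulOp {V : ℂ → Matrix ι ι ℂ} (hV : Continuous V) :
    ∃ T : L2 ι →L[ℂ] L2 ι, ∀ v,
      T v =ᵐ[μcell] fun z => Matrix.toEuclideanCLM (𝕜 := ℂ) (V z) (v z) := by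
  have hc := continuous_toEuclideanCLM.comp hV
  obtain ⟨C, hC0, hC⟩ := exists_bound_on_cell hc
  have hbd : ∀ v : L2 ι, ∀ᵐ z ∂μcell, ‖Matrix.toEuclideanCLM (𝕜 := ℂ) (V z) (v z)‖ ≤ C * ‖v z‖ := by
    intro v
    filter_upwards [ae_mem_cell] with z hz
    exact (le_opNorm _ _).trans (mul_le_mul_of_nonneg_right (hC z hz) (norm_nonneg _))
  have hmem : ∀ v : L2 ι, MemLp (fun z => Matrix.toEuclideanCLM (𝕜 := ℂ) (V z) (v z)) 2 μcell := by
    intro v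
    refine (Lp.memLp v).of_le_mul ?_ (hbd v)
    exact isBoundedBilinearMap_apply.continuous.comp_aestronglyMeasurable
      (hc.aestronglyMeasurable.prodMk (Lp.aestronglyMeasurable v))
  let T : L2 ι →ₗ[ℂ] L2 ι :=
    { toFun := fun v => (hmem v).toLp _
      map_add' := fun v w => by
        apply Lp.ext
        filter_upwards [(hmem (v + w)).coeFn_toLp, (hmem v).coeFn_toLp, (hmem w).coeFn_toLp,
          Lp.coeFn_add v w, Lp.coeFn_add ((hmem v).toLp _) ((hmem w).toLp _)] with z h1 h2 h3 h4 h5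
        rw [h1, h5, Pi.add_apply, h2, h3, h4, Pi.add_apply, map_add]
      map_smul' := fun c v => by
        apply Lp.ext
        filter_upwards [(hmem (c • v)).coeFn_toLp, (hmem v).coeFn_toLp,
          Lp.coeFn_smul c v, Lp.coeFn_smul c ((hmem v).toLp _)] with z h1 h2 h4 h5
        rw [h1, RingHom.id_apply, h5, Pi.smul_apply, h2, h4, Pi.smul_apply, map_smul] }
  refine ⟨T.mkContinuous C fun v => ?_, fun v => (hmem v).coeFn_toLp⟩
  apply Lp.norm_le_mul_norm_of_ae_le_mul
  filter_upwards [hbd v, (hmem v).coeFn_toLp] with z h1 h2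
  change ‖((hmem v).toLp _ : L2 ι) z‖ ≤ _
  rw [h2]
  exact h1

/-- Multiplication by a continuous matrix-valued function on `L²(ℂ/3Λ; ℂ^ι)`. -/
def mulOp (V : ℂ → Matrix ι ι ℂ) (hV : Continuous V) : L2 ι →L[ℂ] L2 ι := (exists_mulOp hV).choose

theorem coeFn_mulOp {V : ℂ → Matrix ι ι ℂ} (hV : Continuous V) (v : L2 ι) :
    mulOp V hV v =ᵐ[μcell] fun z => Matrix.toEuclideanCLM (𝕜 := ℂ) (V z) (v z) :=
  (exists_mulOp hV).choose_spec v

theorem mulOp_coord {V : ℂ → Matrix ι ι ℂ} (hV : Continuous V) (v : L2 ι) :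
    ∀ᵐ z ∂μcell, ∀ j, mulOp V hV v z j = ∑ l, V z j l * v z l := by
  filter_upwards [coeFn_mulOp hV v] with z hz j
  rw [hz, toEuclideanCLM_coord]

theorem adjoint_mulOp {V : ℂ → Matrix ι ι ℂ} (hV : Continuous V)
    (hV' : Continuous fun z => (V z).conjTranspose) :
    adjoint (mulOp V hV) = mulOp (fun z => (V z).conjTranspose) hV' := by
  symm
  rw [eq_adjoint_iff]
  intro x y
  rw [L2.inner_def, L2.inner_def]
  apply integral_congr_ae
  filter_upwards [coeFn_mulOp hV y, coeFn_mulOp hV' x] with z h1 h2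
  rw [h1, h2, ← Matrix.star_eq_conjTranspose, map_star, ContinuousLinearMap.star_eq_adjoint,
    adjoint_inner_left]

theorem GoodPot.mulOp_mem {χ : ι → Fin 2} {V : ℂ → Matrix ι ι ℂ} (h : GoodPot χ V) {v : L2 ι}
    (hv : v ∈ L20 χ) : mulOp V h.continuous v ∈ L20 χ := by
  obtain ⟨u, hu, hvu⟩ := hv
  refine ⟨fun z => Matrix.toEuclideanCLM (𝕜 := ℂ) (V z) (u z), fun a₁ a₂ z j => ?_, ?_⟩
  · rw [toEuclideanCLM_coord, toEuclideanCLM_coord, Finset.mul_sum]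
    refine Finset.sum_congr rfl fun l _ => ?_
    rw [← mul_assoc, ← hu a₁ a₂ z l, ← mul_assoc]
    exact congrArg (· * u (z + pt a₁ a₂) l) (h.equivariant a₁ a₂ z j l)
  · filter_upwards [coeFn_mulOp h.continuous v, hvu] with z h1 h2
    rw [h1, h2]

end MatrixMultiplication

/-! ### The symbol of the free operator -/

section Symbol

/-- A spectral shift that makes the free operator `2 D_{z̄}` invertible on all Fourier modes: the
imaginary parts of the frequencies are multiples of `1/2`. -/
def shift : ℂ := I / 4

theorem freq_add_shift_im (n : Fin 2 → ℤ) : (freq n + shift).im = (1 - 2 * (n 0 + n 1)) / 4 := by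
  rw [add_im, freq_im, shift]
  simp
  ring

theorem le_abs_im_freq_add_shift (n : Fin 2 → ℤ) : 1 / 4 ≤ |(freq n + shift).im| := by
  rw [freq_add_shift_im, abs_div]
  have h1 : (1 : ℤ) ≤ |1 - 2 * (n 0 + n 1)| := Int.one_le_abs (by omega)
  have h2 : (1 : ℝ) ≤ |1 - 2 * ((n 0 : ℝ) + n 1)| := by exact_mod_cast h1
  rw [abs_of_pos (by norm_num : (0 : ℝ) < 4)]
  linarith

theorem le_norm_freq_add_shift (n : Fin 2 → ℤ) : 1 / 4 ≤ ‖freq n + shift‖ :=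
  (le_abs_im_freq_add_shift n).trans (abs_im_le_norm _)

theorem freq_add_shift_ne_zero (n : Fin 2 → ℤ) : freq n + shift ≠ 0 := by
  intro h
  have := le_norm_freq_add_shift n
  rw [h, norm_zero] at this
  norm_num at this

theorem norm_freq_le (n : Fin 2 → ℤ) : ‖freq n‖ ≤ 2 * ‖freq n + shift‖ := by
  have h1 : ‖shift‖ = 1 / 4 := by simp [shift]
  have h2 := norm_sub_le (freq n + shift) shift
  rw [add_sub_cancel_right, h1] at h2
  linarith [le_norm_freq_add_shift n]

theorem tendsto_inv_freq_add_shift :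
    Filter.Tendsto (fun n => (freq n + shift)⁻¹) Filter.cofinite (nhds 0) := by
  rw [tendsto_zero_iff_norm_tendsto_zero]
  simp only [norm_inv]
  refine Filter.Tendsto.inv_tendsto_atTop ?_
  have h0 : Filter.Tendsto (fun n : Fin 2 → ℤ => ‖n‖) Filter.cofinite Filter.atTop := by
    rw [← Filter.cocompact_eq_cofinite]
    exact tendsto_norm_cocompact_atTop
  refine Filter.tendsto_atTop_mono (f := fun n => ‖n‖ / 8 - 1 / 4) (fun n => ?_) ?_
  · have h1 : ‖shift‖ = 1 / 4 := by simp [shift]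
    have h2 := norm_sub_le (freq n + shift) shift
    rw [add_sub_cancel_right, h1] at h2
    have h3 : ‖n‖ ≤ 8 * ‖freq n‖ := by
      refine (pi_norm_le_iff_of_nonneg (by positivity)).2 ?_
      have hr := (abs_le.1 (abs_re_le_norm (freq n)))
      have hi := (abs_le.1 (abs_im_le_norm (freq n)))
      rw [freq_re] at hr
      rw [freq_im] at hi
      have hs : (1 : ℝ) ≤ Real.sqrt 3 := by rw [Real.one_le_sqrt]; norm_num
      have hd : |(n 0 : ℝ) - n 1| ≤ 6 * ‖freq n‖ := by
        have : |Real.sqrt 3 / 6 * ((n 0 : ℝ) - n 1)| ≤ ‖freq n‖ :=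
          abs_le.2 ⟨by linarith, by linarith⟩
        rw [abs_mul, abs_of_pos (by positivity)] at this
        nlinarith [abs_nonneg ((n 0 : ℝ) - n 1)]
      rw [abs_le] at hd
      intro i
      rw [Int.norm_eq_abs, abs_le]
      fin_cases i <;> constructor <;> simp <;> linarith
    linarith
  · exact Filter.tendsto_atTop_add_const_right _ _ (h0.atTop_div_const (by norm_num))

theorem tendsto_symbol (ι : Type) [Finite ι] :
    Filter.Tendsto (fun i : (Fin 2 → ℤ) × ι => (freq i.1 + shift)⁻¹) Filter.cofinite (nhds 0) := by
  refine tendsto_inv_freq_add_shift.comp ?_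
  intro s hs
  rw [Filter.mem_cofinite] at hs
  rw [Filter.mem_map, Filter.mem_cofinite]
  exact (hs.prod (Set.finite_univ (α := ι))).subset fun i hi => ⟨hi, trivial⟩

end Symbol

/-! ### The operators of the model as `R⁻¹ + B` -/

section Resolvent

variable {ι : Type} [Fintype ι] [DecidableEq ι]

theorem exists_freeInv (ι : Type) [Fintype ι] [DecidableEq ι] : ∃ T : L2 ι →L[ℂ] L2 ι,
    ∀ i x, ⟪modeBasis ι i, T x⟫ = (freq i.1 + shift)⁻¹ * ⟪modeBasis ι i, x⟫ := by
  refine exists_diagonal (modeBasis ι) _ (C := 4) (by norm_num) fun i => ?_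
  rw [norm_inv]
  refine inv_le_of_inv_le₀ (by norm_num) ?_
  have := le_norm_freq_add_shift i.1
  norm_num at this ⊢
  exact this

/-- The inverse of the free operator `2 D_{z̄} + shift` on the torus `ℂ/3Λ`. -/
def freeInv (ι : Type) [Fintype ι] [DecidableEq ι] : L2 ι →L[ℂ] L2 ι := (exists_freeInv ι).choose

theorem inner_freeInv (i : (Fin 2 → ℤ) × ι) (x : L2 ι) :
    ⟪modeBasis ι i, freeInv ι x⟫ = (freq i.1 + shift)⁻¹ * ⟪modeBasis ι i, x⟫ :=
  (exists_freeInv ι).choose_spec i x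

theorem inner_adjoint_freeInv (i : (Fin 2 → ℤ) × ι) (x : L2 ι) :
    ⟪modeBasis ι i, adjoint (freeInv ι) x⟫ =
      (conj (freq i.1 + shift))⁻¹ * ⟪modeBasis ι i, x⟫ := by
  rw [diagonal_adjoint _ inner_freeInv, map_inv₀]

theorem isCompactOperator_freeInv : IsCompactOperator (freeInv ι) :=
  isCompactOperator_diagonal (modeBasis ι) inner_freeInv (tendsto_symbol ι)

theorem isCompactOperator_adjoint_freeInv : IsCompactOperator (adjoint (freeInv ι)) := by
  refine isCompactOperator_diagonal (modeBasis ι) inner_adjoint_freeInv ?_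
  have h := (continuous_conj.tendsto 0).comp (tendsto_symbol ι)
  simpa only [map_zero, Function.comp_def, map_inv₀] using h

theorem freeInv_injective : Function.Injective (freeInv ι) :=
  diagonal_injective (modeBasis ι) inner_freeInv fun _ => inv_ne_zero (freq_add_shift_ne_zero _)

theorem adjoint_freeInv_injective : Function.Injective (adjoint (freeInv ι)) :=
  diagonal_injective (modeBasis ι) inner_adjoint_freeInv fun _ => inv_ne_zero
    ((map_ne_zero _).2 (freq_add_shift_ne_zero _))

theorem L20_of_diagonal {χ : ι → Fin 2} {m : (Fin 2 → ℤ) × ι → ℂ} {T : L2 ι →L[ℂ] L2 ι}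
    (hT : ∀ i x, ⟪modeBasis ι i, T x⟫ = m i * ⟪modeBasis ι i, x⟫) {v : L2 ι} (hv : v ∈ L20 χ) :
    T v ∈ L20 χ := by
  rw [mem_L20_iff] at hv ⊢
  intro n j hn
  rw [hT, hv n j hn, mul_zero]

theorem L20_of_diagonal_apply {χ : ι → Fin 2} {m : (Fin 2 → ℤ) × ι → ℂ} {T : L2 ι →L[ℂ] L2 ι}
    (hT : ∀ i x, ⟪modeBasis ι i, T x⟫ = m i * ⟪modeBasis ι i, x⟫) (hm : ∀ i, m i ≠ 0) {v : L2 ι}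
    (hv : T v ∈ L20 χ) : v ∈ L20 χ := by
  rw [mem_L20_iff] at hv ⊢
  intro n j hn
  have := hv n j hn
  rw [hT] at this
  exact (mul_eq_zero.1 this).resolve_left (hm _)

/-- A first order constant coefficient operator `i⁻¹ (∂_{x₁} + s i ∂_{x₂})` with a zeroth order
term, in terms of its inverse `T` as a Fourier multiplier. -/
theorem weak_iff_multiplier {s c k : ℂ} {T : L2 ι →L[ℂ] L2 ι}
    (hne : ∀ n, ((freq n).re : ℂ) + s * I * (freq n).im + c ≠ 0)
    (hbd : ∀ n, ‖freq n‖ ≤ 2 * ‖((freq n).re : ℂ) + s * I * (freq n).im + c‖)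
    (hT : ∀ i x, ⟪modeBasis ι i, T x⟫ =
      (((freq i.1).re : ℂ) + s * I * (freq i.1).im + c)⁻¹ * ⟪modeBasis ι i, x⟫)
    {V : ℂ → Matrix ι ι ℂ} (hV : Continuous V) (v w : L2 ι) :
    (∃ g₁ g₂ : L2 ι, HasWeakGrad v g₁ g₂ ∧ ∀ᵐ z ∂μcell, ∀ j,
      w z j = I⁻¹ * (g₁ z j + s * I * g₂ z j) + ∑ l, V z j l * v z l + k * v z j) ↔
    IsOp T (mulOp V hV + (k - c) • ContinuousLinearMap.id ℂ (L2 ι)) v w := by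
  set σ : (Fin 2 → ℤ) → ℂ := fun n => ((freq n).re : ℂ) + s * I * (freq n).im + c with hσ
  have hre : ∀ n, ((1 : ℂ) * conj (freq n)).re = (freq n).re := fun n => by simp
  have him : ∀ n, (I * conj (freq n)).re = (freq n).im := fun n => by simp
  constructor
  · rintro ⟨g₁, g₂, hg, hw⟩
    refine ⟨I⁻¹ • (g₁ + (s * I) • g₂) + c • v, ?_, ?_⟩
    · refine hilbertBasis_ext (modeBasis ι) fun p => ?_
      obtain ⟨n, j⟩ := p
      rw [hT, inner_add_right, inner_smul_right, inner_add_right, inner_smul_right,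
        inner_smul_right, coeff_of_hasWeakDeriv (hg j).1, coeff_of_hasWeakDeriv (hg j).2, hre, him]
      rw [eq_inv_mul_iff_mul_eq₀ (hne n)]
      have hI : I⁻¹ * I = 1 := inv_mul_cancel₀ I_ne_zero
      linear_combination (-(((freq n).re : ℂ) + s * I * (freq n).im) *
        ⟪modeBasis ι (n, j), v⟫) * hI
    · rw [add_apply, smul_apply, id_apply]
      apply Lp.ext
      filter_upwards [hw, mulOp_coord hV v,
        Lp.coeFn_add (I⁻¹ • (g₁ + (s * I) • g₂) + c • v) (mulOp V hV v + (k - c) • v),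
        Lp.coeFn_add (I⁻¹ • (g₁ + (s * I) • g₂)) (c • v), Lp.coeFn_smul c v,
        Lp.coeFn_smul I⁻¹ (g₁ + (s * I) • g₂), Lp.coeFn_add g₁ ((s * I) • g₂),
        Lp.coeFn_smul (s * I) g₂, Lp.coeFn_add (mulOp V hV v) ((k - c) • v),
        Lp.coeFn_smul (k - c) v] with z h0 h1 h2 h3 h4 h5 h6 h7 h8 h9
      ext j
      rw [h0, h2, Pi.add_apply, h3, Pi.add_apply, h4, h5, h8]
      simp only [Pi.smul_apply, Pi.add_apply, PiLp.add_apply, PiLp.smul_apply, smul_eq_mul, h6, h7,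
        h9, h1]
      ring
  · rintro ⟨f, rfl, rfl⟩
    have hpart : ∀ x : ℝ, ∀ n, |x| ≤ ‖freq n‖ → ‖(x : ℂ) * I * (σ n)⁻¹‖ ≤ 2 := by
      intro x n hx
      rw [norm_mul, norm_mul, norm_I, mul_one, norm_real, Real.norm_eq_abs, norm_inv,
        ← div_eq_mul_inv, div_le_iff₀ (norm_pos_iff.2 (hne n))]
      exact hx.trans (hbd n)
    obtain ⟨S₁, hS₁⟩ := exists_diagonal (modeBasis ι)
      (fun i => (((1 : ℂ) * conj (freq i.1)).re : ℝ) * I * (σ i.1)⁻¹) (C := 2) (by norm_num)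
      fun i => hpart _ _ (by rw [hre]; exact abs_re_le_norm _)
    obtain ⟨S₂, hS₂⟩ := exists_diagonal (modeBasis ι)
      (fun i => ((I * conj (freq i.1)).re : ℝ) * I * (σ i.1)⁻¹) (C := 2) (by norm_num)
      fun i => hpart _ _ (by rw [him]; exact abs_im_le_norm _)
    have hf : f = I⁻¹ • (S₁ f + (s * I) • S₂ f) + c • T f := by
      refine hilbertBasis_ext (modeBasis ι) fun p => ?_
      rw [inner_add_right, inner_smul_right, inner_add_right, inner_smul_right,
        inner_smul_right, hS₁, hS₂, hT, hre, him]
      have hI : I⁻¹ * I = 1 := inv_mul_cancel₀ I_ne_zero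
      have hσ' : σ p.1 * (σ p.1)⁻¹ = 1 := mul_inv_cancel₀ (hne _)
      have hσ'' : σ p.1 = ((freq p.1).re : ℂ) + s * I * (freq p.1).im + c := rfl
      linear_combination (-⟪modeBasis ι p, f⟫) * hσ' + (⟪modeBasis ι p, f⟫ * (σ p.1)⁻¹) * hσ'' -
        (((freq p.1).re : ℂ) + s * I * (freq p.1).im) * (σ p.1)⁻¹ * ⟪modeBasis ι p, f⟫ * hI
    refine ⟨S₁ f, S₂ f, fun j => ⟨hasWeakDeriv_multiplier hT hS₁ f j,
      hasWeakDeriv_multiplier hT hS₂ f j⟩, ?_⟩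
    rw [add_apply, smul_apply, id_apply]
    filter_upwards [mulOp_coord hV (T f),
      Lp.coeFn_add f (mulOp V hV (T f) + (k - c) • T f),
      Lp.coeFn_add (I⁻¹ • (S₁ f + (s * I) • S₂ f)) (c • T f), Lp.coeFn_smul c (T f),
      Lp.coeFn_smul I⁻¹ (S₁ f + (s * I) • S₂ f), Lp.coeFn_add (S₁ f) ((s * I) • S₂ f),
      Lp.coeFn_smul (s * I) (S₂ f), Lp.coeFn_add (mulOp V hV (T f)) ((k - c) • T f),
      Lp.coeFn_smul (k - c) (T f)] with z h1 h2 h3 h4 h5 h6 h7 h8 h9 j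
    rw [← hf] at h3
    rw [h2, Pi.add_apply, h3, Pi.add_apply, h4, h5, h8]
    simp only [Pi.smul_apply, Pi.add_apply, PiLp.add_apply, PiLp.smul_apply, smul_eq_mul, h6, h7,
      h9, h1]
    ring

theorem re_add_I_mul_im (w : ℂ) : (w.re : ℂ) + 1 * I * w.im = w := by
  rw [one_mul, mul_comm, re_add_im]

theorem re_sub_I_mul_im (w : ℂ) : (w.re : ℂ) + (-1) * I * w.im = conj w := by
  apply Complex.ext <;> simp

/-- The bounded part of `D + k`, complementary to the inverse of the free operator. -/
def lowerOrder (V : ℂ → Matrix ι ι ℂ) (hV : Continuous V) (k : ℂ) : L2 ι →L[ℂ] L2 ι :=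
  mulOp V hV + (k - shift) • ContinuousLinearMap.id ℂ (L2 ι)

theorem adjoint_lowerOrder {V : ℂ → Matrix ι ι ℂ} (hV : Continuous V)
    (hV' : Continuous fun z => (V z).conjTranspose) (k : ℂ) :
    adjoint (lowerOrder V hV k) = mulOp (fun z => (V z).conjTranspose) hV' +
      (conj k - conj shift) • ContinuousLinearMap.id ℂ (L2 ι) := by
  rw [lowerOrder, map_add, adjoint_mulOp hV hV']
  congr 1
  rw [LinearIsometryEquiv.map_smulₛₗ, map_sub]
  congr 1
  exact adjoint_id

theorem isD_iff_isOp {χ : ι → Fin 2} {V : ℂ → Matrix ι ι ℂ} (hV : Continuous V) (k : ℂ)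
    (v w : L2 ι) :
    IsD χ V k v w ↔ v ∈ L20 χ ∧ IsOp (freeInv ι) (lowerOrder V hV k) v w := by
  unfold IsD
  refine and_congr_right fun _ => ?_
  rw [lowerOrder, ← weak_iff_multiplier (s := 1) (c := shift) (T := freeInv ι)]
  · simp only [one_mul]
  · intro n; rw [re_add_I_mul_im]; exact freq_add_shift_ne_zero n
  · intro n; rw [re_add_I_mul_im]; exact norm_freq_le n
  · intro i x; rw [re_add_I_mul_im]; exact inner_freeInv i x

theorem isDadj_iff_isOp {χ : ι → Fin 2} {V : ℂ → Matrix ι ι ℂ} (hV : Continuous V) (k : ℂ)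
    (v w : L2 ι) :
    IsDadj χ V k v w ↔
      v ∈ L20 χ ∧ IsOp (adjoint (freeInv ι)) (adjoint (lowerOrder V hV k)) v w := by
  unfold IsDadj
  refine and_congr_right fun _ => ?_
  have hV' : Continuous fun z => (V z).conjTranspose := hV.matrix_conjTranspose
  rw [adjoint_lowerOrder hV hV', ← weak_iff_multiplier (s := -1) (c := conj shift)
    (T := adjoint (freeInv ι))]
  · simp only [neg_mul, one_mul, ← sub_eq_add_neg]
  · intro n; rw [re_sub_I_mul_im, ← map_add]; exact (map_ne_zero _).2 (freq_add_shift_ne_zero n)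
  · intro n; rw [re_sub_I_mul_im, ← map_add, norm_conj]; exact norm_freq_le n
  · intro i x; rw [re_sub_I_mul_im, ← map_add]; exact inner_adjoint_freeInv i x

end Resolvent

/-! ### Restriction to `L²_0` -/

section Restriction

variable {H : Type*} [NormedAddCommGroup H] [InnerProductSpace ℂ H]

theorem adjoint_restrict [CompleteSpace H] {S : Submodule ℂ H} [CompleteSpace S] {T : H →L[ℂ] H}
    (h : ∀ x ∈ S, T x ∈ S) (h' : ∀ x ∈ S, adjoint T x ∈ S) :
    adjoint (T.restrict h) = (adjoint T).restrict h' := by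
  symm
  rw [eq_adjoint_iff]
  intro x y
  exact adjoint_inner_left T y x

theorem isOp_restrict {S : Submodule ℂ H} {R B : H →L[ℂ] H} (hR : ∀ x ∈ S, R x ∈ S)
    (hR' : ∀ x, R x ∈ S → x ∈ S) (hB : ∀ x ∈ S, B x ∈ S) {v w : S} :
    IsOp (R.restrict hR) (B.restrict hB) v w ↔ IsOp R B v w := by
  constructor
  · rintro ⟨f, rfl, rfl⟩
    exact ⟨f, rfl, rfl⟩
  · rintro ⟨f, hv, hw⟩
    refine ⟨⟨f, hR' f (hv ▸ v.2)⟩, Subtype.ext hv, Subtype.ext hw⟩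

end Restriction

section OnL20

variable {ι : Type} [Fintype ι] [DecidableEq ι]

instance (χ : ι → Fin 2) : CompleteSpace (L20 χ) := (isClosed_L20 χ).completeSpace_coe

/-- The inverse of the free operator on `L²_0`. -/
def freeInv₀ (χ : ι → Fin 2) : L20 χ →L[ℂ] L20 χ :=
  (freeInv ι).restrict fun _ => L20_of_diagonal inner_freeInv

theorem adjoint_freeInv₀ (χ : ι → Fin 2) : adjoint (freeInv₀ χ) =
    (adjoint (freeInv ι)).restrict fun _ => L20_of_diagonal inner_adjoint_freeInv :=
  adjoint_restrict _ _

theorem isCompactOperator_freeInv₀ (χ : ι → Fin 2) : IsCompactOperator (freeInv₀ χ) :=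
  IsCompactOperator.restrict' (f := (freeInv ι : L2 ι →ₗ[ℂ] L2 ι)) isCompactOperator_freeInv
    fun _ => L20_of_diagonal inner_freeInv

theorem isCompactOperator_adjoint_freeInv₀ (χ : ι → Fin 2) :
    IsCompactOperator (adjoint (freeInv₀ χ)) := by
  rw [adjoint_freeInv₀]
  exact IsCompactOperator.restrict' (f := (adjoint (freeInv ι) : L2 ι →ₗ[ℂ] L2 ι))
    isCompactOperator_adjoint_freeInv
    fun _ => L20_of_diagonal inner_adjoint_freeInv

theorem freeInv₀_injective (χ : ι → Fin 2) : Function.Injective (freeInv₀ χ) := fun _ _ h =>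
  Subtype.ext (freeInv_injective (congrArg Subtype.val h))

theorem adjoint_freeInv₀_injective (χ : ι → Fin 2) :
    Function.Injective (adjoint (freeInv₀ χ)) := by
  rw [adjoint_freeInv₀]
  exact fun _ _ h => Subtype.ext (adjoint_freeInv_injective (congrArg Subtype.val h))

theorem GoodPot.lowerOrder_mem {χ : ι → Fin 2} {V : ℂ → Matrix ι ι ℂ} (h : GoodPot χ V) (k : ℂ)
    {v : L2 ι} (hv : v ∈ L20 χ) : lowerOrder V h.continuous k v ∈ L20 χ :=
  (L20 χ).add_mem (h.mulOp_mem hv) ((L20 χ).smul_mem _ hv)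

theorem GoodPot.adjoint_lowerOrder_mem {χ : ι → Fin 2} {V : ℂ → Matrix ι ι ℂ} (h : GoodPot χ V)
    (k : ℂ) {v : L2 ι} (hv : v ∈ L20 χ) : adjoint (lowerOrder V h.continuous k) v ∈ L20 χ := by
  rw [adjoint_lowerOrder h.continuous h.conjTranspose.continuous]
  exact (L20 χ).add_mem (h.conjTranspose.mulOp_mem hv) ((L20 χ).smul_mem _ hv)

/-- The bounded part of `D + k` on `L²_0`. -/
def lowerOrder₀ {χ : ι → Fin 2} {V : ℂ → Matrix ι ι ℂ} (h : GoodPot χ V) (k : ℂ) :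
    L20 χ →L[ℂ] L20 χ :=
  (lowerOrder V h.continuous k).restrict fun _ => h.lowerOrder_mem k

theorem adjoint_lowerOrder₀ {χ : ι → Fin 2} {V : ℂ → Matrix ι ι ℂ} (h : GoodPot χ V) (k : ℂ) :
    adjoint (lowerOrder₀ h k) = (adjoint (lowerOrder V h.continuous k)).restrict
      fun _ => h.adjoint_lowerOrder_mem k :=
  adjoint_restrict _ _

theorem isD_coe_iff {χ : ι → Fin 2} {V : ℂ → Matrix ι ι ℂ} (h : GoodPot χ V) (k : ℂ)
    (v w : L20 χ) : IsD χ V k v w ↔ IsOp (freeInv₀ χ) (lowerOrder₀ h k) v w := by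
  rw [isD_iff_isOp h.continuous, freeInv₀, lowerOrder₀, isOp_restrict]
  · exact and_iff_right v.2
  · exact fun x => L20_of_diagonal_apply inner_freeInv
      fun _ => inv_ne_zero (freq_add_shift_ne_zero _)

theorem isDadj_coe_iff {χ : ι → Fin 2} {V : ℂ → Matrix ι ι ℂ} (h : GoodPot χ V) (k : ℂ)
    (v w : L20 χ) :
    IsDadj χ V k v w ↔ IsOp (adjoint (freeInv₀ χ)) (adjoint (lowerOrder₀ h k)) v w := by
  rw [isDadj_iff_isOp h.continuous, adjoint_freeInv₀, adjoint_lowerOrder₀, isOp_restrict]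
  · exact and_iff_right v.2
  · exact fun x => L20_of_diagonal_apply inner_adjoint_freeInv
      fun _ => inv_ne_zero ((map_ne_zero _).2 (freq_add_shift_ne_zero _))

end OnL20

/-! ### Kernel and cokernel under an antiunitary symmetry -/

section Abstract

variable {H : Type*} [NormedAddCommGroup H] [InnerProductSpace ℂ H]

/-- If an antiunitary involution exchanges the kernel and the cokernel of `D = R⁻¹ + B`, and `0` is
the first but not the second band energy, then kernel and cokernel are lines. -/
theorem exists_ker_coker_lines [CompleteSpace H] {R B : H →L[ℂ] H} (C : H →ₛₗ[starRingEnd ℂ] H)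
    (hCC : ∀ v, C (C v) = v) (hCn : ∀ v, ‖C v‖ = ‖v‖)
    (hker : ∀ v, IsOp R B v 0 → IsOp (adjoint R) (adjoint B) (C v) 0)
    (hcoker : ∀ v, IsOp (adjoint R) (adjoint B) v 0 → IsOp R B (C v) 0)
    (h1 : IsOpBand R B 1 0) (h2 : ¬ IsOpBand R B 2 0) :
    ∃ u u' : H, ‖u‖ = 1 ∧ ‖u'‖ = 1 ∧ (∀ v, IsOp R B v 0 ↔ ∃ c : ℂ, v = c • u) ∧
      ∀ v, IsOp (adjoint R) (adjoint B) v 0 ↔ ∃ c : ℂ, v = c • u' := by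
  obtain ⟨a, ha, ha0⟩ : ∃ a, IsOp R B a 0 ∧ a ≠ 0 := by
    by_contra hno
    push Not at hno
    have : opSpan R B {x | |x| ≤ 0} = ⊥ := by
      rw [opSpan, Submodule.span_eq_bot]
      rintro ⟨v₁, v₂⟩ ⟨E, hE, hv₂, hv₁⟩
      have hE0 : E = 0 := abs_nonpos_iff.1 hE
      simp only [hE0, ofReal_zero, zero_smul] at hv₁ hv₂
      have e1 := hno _ hv₁
      have e2 := hno _ (hcoker _ hv₂)
      rw [← norm_eq_zero, hCn, norm_eq_zero] at e2
      rw [e1, e2]; rfl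
    have h3 := h1.2.2
    rw [this, rank_bot] at h3
    exact absurd h3 (by norm_num)
  have hline : ∀ b, IsOp R B b 0 → ∃ c : ℂ, b = c • a := by
    intro b hb
    by_contra hc
    have hli : LinearIndependent ℂ ![a, b] := by
      rw [LinearIndependent.pair_iff]
      intro s r hsr
      have hr : r = 0 := by
        by_contra hr
        refine hc ⟨-(r⁻¹ * s), ?_⟩
        have := congrArg (fun x => r⁻¹ • x) hsr
        simp only [smul_add, smul_smul, inv_mul_cancel₀ hr, one_smul, smul_zero] at this
        rw [neg_smul]
        exact eq_neg_of_add_eq_zero_right this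
      subst hr
      simpa [ha0] using hsr
    refine h2 (isOpBand_two_zero hli (c := C a) (d := C b) ?_ ha hb (hker a ha) (hker b hb))
    rw [LinearIndependent.pair_iff] at hli ⊢
    intro s r hsr
    have := congrArg C hsr
    rw [map_add, map_smulₛₗ, map_smulₛₗ, hCC, hCC, map_zero] at this
    simpa using hli _ _ this
  have han : (‖a‖ : ℂ) ≠ 0 := by exact_mod_cast norm_ne_zero_iff.2 ha0
  set u : H := (‖a‖⁻¹ : ℂ) • a with hu
  have hun : ‖u‖ = 1 := by
    rw [hu, norm_smul, norm_inv, norm_real, norm_norm, inv_mul_cancel₀ (norm_ne_zero_iff.2 ha0)]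
  have hukey : ∀ v, IsOp R B v 0 ↔ ∃ c : ℂ, v = c • u := by
    intro v
    constructor
    · intro hv
      obtain ⟨c, hc⟩ := hline v hv
      refine ⟨c * ‖a‖, ?_⟩
      rw [hc, hu, smul_smul, mul_assoc, mul_inv_cancel₀ han, mul_one]
    · rintro ⟨c, rfl⟩
      simpa using (ha.smul (‖a‖⁻¹ : ℂ)).smul c
  have hu0 : IsOp R B u 0 := (hukey u).2 ⟨1, by simp⟩
  refine ⟨u, C u, hun, by rw [hCn, hun], hukey, fun v => ⟨fun hv => ?_, ?_⟩⟩
  · obtain ⟨c, hc⟩ := (hukey _).1 (hcoker v hv)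
    refine ⟨conj c, ?_⟩
    rw [← hCC v, hc, map_smulₛₗ]
  · rintro ⟨c, rfl⟩
    simpa using (hker u hu0).smul c

variable {K : Type*} [NormedAddCommGroup K] [InnerProductSpace ℂ K]

/-- An operator on two sheets whose inverse free part is diagonal and whose bounded part couples the
sheets by `t Tp` and `t Tm`. -/
theorem isOp_iff_pairOp {R B B₀ Tp Tm : H →L[ℂ] H} {R₂ B₂ : K →L[ℂ] K} {p q : K →L[ℂ] H} {t : ℝ}
    (h : IsSheetSplit p q) (hRp : ∀ x, p (R₂ x) = R (p x)) (hRq : ∀ x, q (R₂ x) = R (q x))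
    (hBp : ∀ x, p (B₂ x) = B (p x) + (t : ℂ) • Tp (q x))
    (hBq : ∀ x, q (B₂ x) = B₀ (q x) + (t : ℂ) • Tm (p x)) (x y : K) :
    IsOp R₂ B₂ x y ↔ PairOp R B B₀ Tp Tm t (p x) (q x) (p y) (q y) := by
  constructor
  · rintro ⟨f, rfl, rfl⟩
    refine ⟨⟨p f, hRp f, ?_⟩, ⟨q f, hRq f, ?_⟩⟩
    · rw [map_add, hBp]; abel
    · rw [map_add, hBq]; abel
  · rintro ⟨⟨f₁, hx₁, hy₁⟩, ⟨f₂, hx₂, hy₂⟩⟩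
    obtain ⟨f, rfl, rfl⟩ := h.surj f₁ f₂
    refine ⟨f, h.ext (by rw [hx₁, hRp]) (by rw [hx₂, hRq]), h.ext ?_ ?_⟩
    · rw [map_add, hBp, ← add_assoc, ← hy₁, sub_add_cancel]
    · rw [map_add, hBq, ← add_assoc, ← hy₂, sub_add_cancel]

end Abstract

/-! ### The antiunitary symmetry of the model -/

section Reflection

variable {ι : Type} [Fintype ι] [DecidableEq ι]

/-- The antiunitary involution `v ↦ conj (v (-z))` of `L²(ℂ/3Λ; ℂ^ι)`; it conjugates the Fourier
coefficients. -/
def conjReflect (ι : Type) [Fintype ι] [DecidableEq ι] : L2 ι ≃ₗᵢ⋆[ℂ] L2 ι :=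
  ((modeBasis ι).repr.trans (starₗᵢ ℂ)).trans (modeBasis ι).repr.symm

theorem inner_conjReflect (i : (Fin 2 → ℤ) × ι) (v : L2 ι) :
    ⟪modeBasis ι i, conjReflect ι v⟫ = conj ⟪modeBasis ι i, v⟫ := by
  rw [← HilbertBasis.repr_apply_apply, ← HilbertBasis.repr_apply_apply]
  simp [conjReflect]

theorem conjReflect_conjReflect (v : L2 ι) : conjReflect ι (conjReflect ι v) = v :=
  hilbertBasis_ext (modeBasis ι) fun i => by
    rw [inner_conjReflect, inner_conjReflect, conj_conj]

theorem conjReflect_inner (v w : L2 ι) : ⟪conjReflect ι v, conjReflect ι w⟫ = ⟪w, v⟫ := by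
  have h1 := (modeBasis ι).hasSum_inner_mul_inner (conjReflect ι v) (conjReflect ι w)
  have h2 := (modeBasis ι).hasSum_inner_mul_inner w v
  refine h1.unique ?_
  convert! h2 using 1
  ext i
  rw [inner_conjReflect, ← inner_conj_symm, inner_conjReflect, conj_conj, inner_conj_symm, mul_comm]

theorem conjReflect_freeInv (v : L2 ι) :
    conjReflect ι (freeInv ι v) = adjoint (freeInv ι) (conjReflect ι v) :=
  hilbertBasis_ext (modeBasis ι) fun i => by
    rw [inner_conjReflect, inner_freeInv, inner_adjoint_freeInv, inner_conjReflect, map_mul,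
      map_inv₀]

theorem conjReflect_mem {χ : ι → Fin 2} {v : L2 ι} (hv : v ∈ L20 χ) : conjReflect ι v ∈ L20 χ := by
  rw [mem_L20_iff] at hv ⊢
  intro n j hn
  rw [inner_conjReflect, hv n j hn, map_zero]

theorem inner_modeBasis_mulOp {V : ℂ → Matrix ι ι ℂ} (hV : Continuous V) (m n : Fin 2 → ℤ)
    (i j : ι) : ⟪modeBasis ι (m, i), mulOp V hV (modeBasis ι (n, j))⟫ =
      modeScale * modeScale * ∫ z, conj (mode m z) * V z i j * mode n z ∂μcell := by
  rw [inner_modeBasis, mul_assoc]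
  congr 1
  rw [← integral_const_mul]
  apply integral_congr_ae
  rw [coe_modeBasis]
  filter_upwards [mulOp_coord hV (modeLp (n, j)), coeFn_modeLp (n, j)] with z h1 h2
  rw [h1, h2]
  simp only [PiLp.single_apply, mul_ite, mul_zero, Finset.sum_ite_eq', Finset.mem_univ, if_true]
  ring

/-- A potential with `V (-z) = V (z)ᵀ` has a symmetric matrix in the Fourier basis, which is real
for `conjReflect`. -/
theorem conjReflect_mulOp {χ : ι → Fin 2} {V : ℂ → Matrix ι ι ℂ} (h : GoodPot χ V)
    (hsymm : ∀ z i j, V (-z) i j = V z j i) (v : L2 ι) :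
    conjReflect ι (mulOp V h.continuous v) =
      adjoint (mulOp V h.continuous) (conjReflect ι v) := by
  set B := mulOp V h.continuous
  have hmat : ∀ p q, ⟪modeBasis ι p, B (modeBasis ι q)⟫ = ⟪modeBasis ι q, B (modeBasis ι p)⟫ := by
    rintro ⟨m, i⟩ ⟨n, j⟩
    rw [inner_modeBasis_mulOp, inner_modeBasis_mulOp]
    congr 1
    have hper : Periodic3 fun z => conj (mode m z) * V z i j * mode n z := by
      intro a b z
      simp only [mode_periodic m a b z, mode_periodic n a b z, h.periodic i j a b z]
    rw [← integral_reflect hper]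
    congr 1
    ext z
    rw [mode_neg_right, mode_neg_right, conj_conj, hsymm]
    ring
  have hb : ∀ p, B (modeBasis ι p) = conjReflect ι (adjoint B (modeBasis ι p)) := by
    intro p
    refine hilbertBasis_ext (modeBasis ι) fun q => ?_
    rw [inner_conjReflect, adjoint_inner_right, inner_conj_symm, hmat]
  refine hilbertBasis_ext (modeBasis ι) fun p => ?_
  rw [inner_conjReflect, adjoint_inner_right, hb, conjReflect_inner, ← adjoint_inner_left,
    inner_conj_symm]

theorem conjReflect_lowerOrder {χ : ι → Fin 2} {V : ℂ → Matrix ι ι ℂ} (h : GoodPot χ V)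
    (hsymm : ∀ z i j, V (-z) i j = V z j i) (k : ℂ) (v : L2 ι) :
    conjReflect ι (lowerOrder V h.continuous k v) =
      adjoint (lowerOrder V h.continuous k) (conjReflect ι v) := by
  rw [adjoint_lowerOrder h.continuous h.conjTranspose.continuous, ← adjoint_mulOp h.continuous,
    lowerOrder]
  simp only [add_apply, smul_apply, id_apply, map_add, conjReflect_mulOp h hsymm]
  congr 1
  rw [LinearIsometryEquiv.map_smulₛₗ, map_sub]

/-- The restriction of `conjReflect` to `L²_0`. -/
def conjReflect₀ (χ : ι → Fin 2) : L20 χ →ₛₗ[starRingEnd ℂ] L20 χ where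
  toFun v := ⟨conjReflect ι v, conjReflect_mem v.2⟩
  map_add' v w := Subtype.ext (map_add (conjReflect ι) (v : L2 ι) w)
  map_smul' c v := Subtype.ext ((conjReflect ι).map_smulₛₗ c (v : L2 ι))

theorem isOp_conjReflect₀ {χ : ι → Fin 2} {V : ℂ → Matrix ι ι ℂ} (h : GoodPot χ V)
    (hsymm : ∀ z i j, V (-z) i j = V z j i) (k : ℂ) (v : L20 χ)
    (hv : IsOp (freeInv₀ χ) (lowerOrder₀ h k) v 0) :
    IsOp (adjoint (freeInv₀ χ)) (adjoint (lowerOrder₀ h k)) (conjReflect₀ χ v) 0 := by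
  obtain ⟨f, hvf, hf⟩ := hv
  rw [adjoint_freeInv₀, adjoint_lowerOrder₀]
  refine ⟨conjReflect₀ χ f, Subtype.ext ?_, Subtype.ext ?_⟩
  · rw [hvf]; exact conjReflect_freeInv (f : L2 ι)
  · have := congrArg (conjReflect₀ χ) hf
    rw [map_zero, map_add] at this
    rw [this]
    exact congrArg (conjReflect ι f + ·) (conjReflect_lowerOrder h hsymm k v)

theorem isOp_conjReflect₀_adjoint {χ : ι → Fin 2} {V : ℂ → Matrix ι ι ℂ} (h : GoodPot χ V)
    (hsymm : ∀ z i j, V (-z) i j = V z j i) (k : ℂ) (v : L20 χ)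
    (hv : IsOp (adjoint (freeInv₀ χ)) (adjoint (lowerOrder₀ h k)) v 0) :
    IsOp (freeInv₀ χ) (lowerOrder₀ h k) (conjReflect₀ χ v) 0 := by
  obtain ⟨f, hvf, hf⟩ := hv
  have hcc : ∀ x : L20 χ, conjReflect₀ χ (conjReflect₀ χ x) = x := fun x =>
    Subtype.ext (conjReflect_conjReflect (x : L2 ι))
  rw [adjoint_freeInv₀] at hvf
  rw [adjoint_lowerOrder₀] at hf
  refine ⟨conjReflect₀ χ f, ?_, ?_⟩
  · rw [← hcc (freeInv₀ χ _), hvf]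
    refine congrArg (conjReflect₀ χ) (Subtype.ext ?_)
    have := conjReflect_freeInv (conjReflect ι (f : L2 ι))
    rw [conjReflect_conjReflect] at this
    exact this.symm
  · rw [← hcc (lowerOrder₀ h k _), ← map_add, ← map_zero (conjReflect₀ χ), hf]
    refine congrArg (conjReflect₀ χ) (Subtype.ext ?_)
    have := conjReflect_lowerOrder h hsymm k (conjReflect ι (v : L2 ι))
    rw [conjReflect_conjReflect] at this
    exact congrArg ((f : L2 ι) + ·) this.symm

end Reflection

/-! ### Band energies of the model -/

section Bands

variable {ι : Type} [Fintype ι] [DecidableEq ι]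

/-- The eigenfunctions of the Bloch Hamiltonian are those of the abstract block operator. -/
theorem eigenSpan_eq_map {χ : ι → Fin 2} {V : ℂ → Matrix ι ι ℂ} (h : GoodPot χ V) (k : ℂ)
    (S : Set ℝ) : eigenSpan χ V k S =
      (opSpan (freeInv₀ χ) (lowerOrder₀ h k) S).map ((L20 χ).subtype.prodMap (L20 χ).subtype) := by
  rw [eigenSpan, opSpan, Submodule.map_span]
  congr 1
  ext ⟨v₁, v₂⟩
  constructor
  · rintro ⟨E, hE, h2, h1⟩
    refine ⟨(⟨v₁, h1.1⟩, ⟨v₂, h2.1⟩), ⟨E, hE, ?_, ?_⟩, rfl⟩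
    · exact (isDadj_coe_iff h k ⟨v₂, h2.1⟩ ((E : ℂ) • ⟨v₁, h1.1⟩)).1 h2
    · exact (isD_coe_iff h k ⟨v₁, h1.1⟩ ((E : ℂ) • ⟨v₂, h2.1⟩)).1 h1
  · rintro ⟨⟨x₁, x₂⟩, ⟨E, hE, h2, h1⟩, heq⟩
    obtain ⟨rfl, rfl⟩ := Prod.mk.inj heq
    exact ⟨E, hE, (isDadj_coe_iff h k x₂ ((E : ℂ) • x₁)).2 h2,
      (isD_coe_iff h k x₁ ((E : ℂ) • x₂)).2 h1⟩

theorem isBandEnergy_iff {χ : ι → Fin 2} {V : ℂ → Matrix ι ι ℂ} (h : GoodPot χ V) (k : ℂ)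
    (j : ℕ) (E : ℝ) :
    IsBandEnergy χ V k j E ↔ IsOpBand (freeInv₀ χ) (lowerOrder₀ h k) j E := by
  have hinj : Function.Injective ((L20 χ).subtype.prodMap (L20 χ).subtype) :=
    Prod.map_injective.2 ⟨Subtype.val_injective, Subtype.val_injective⟩
  have hrank : ∀ S, Module.rank ℂ (eigenSpan χ V k S) =
      Module.rank ℂ (opSpan (freeInv₀ χ) (lowerOrder₀ h k) S) := fun S => by
    rw [eigenSpan_eq_map h]
    exact (Submodule.equivMapOfInjective _ hinj _).rank_eq.symm
  rw [IsBandEnergy, IsOpBand, hrank, hrank]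

end Bands

/-! ### The potentials of the model -/

section Potential

theorem mode_lattice (n : Fin 2 → ℤ) (a₁ a₂ : ℤ) :
    mode n (pt a₁ a₂) = om ^ (n 0 * a₁ + n 1 * a₂) := by
  rw [mode_pt, om, ← exp_int_mul]
  push_cast
  ring_nf

/-- The indices of the three Fourier modes of `U` agree modulo `3`, so that translation by `Λ`
multiplies all of them by the same factor. -/
theorem U_eq (z : ℂ) :
    U z = mode ![-1, -1] z + om * mode ![2, -1] z + om ^ 2 * mode ![-1, 2] z := by
  have hc2 : conj om ^ 2 = om := by
    have h1 := conj_om_mul_om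
    have h2 := om_cube
    calc conj om ^ 2 = conj om ^ 2 * om ^ 3 := by rw [h2, mul_one]
      _ = (conj om * om) ^ 2 * om := by ring
      _ = om := by rw [h1]; ring
  have ho2 : om ^ 2 = conj om := by
    have := congrArg conj hc2
    rwa [map_pow, conj_conj] at this
  rw [U, Finset.sum_range_succ, Finset.sum_range_succ, Finset.sum_range_one]
  simp only [pow_zero, pow_one, one_mul, mul_one, hc2, ho2, mode]
  have key : ∀ n : Fin 2 → ℤ, ∀ w : ℂ, freq n = I * w →
      (z * conj w - conj z * w) / 2 = ((z * conj (freq n)).re : ℝ) * I := by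
    intro n w h
    rw [h]
    apply Complex.ext
    · simp
    · simp; ring
  have hf : ∀ a b : ℤ, freq ![a, b] =
      -((Real.sqrt 3 / 6 * (a - b) : ℝ) : ℂ) - ((a + b : ℝ) / 2 : ℝ) * I := fun a b => rfl
  congr 1
  · congr 1
    · congr 1
      rw [← key _ 1 (by rw [hf]; push_cast; ring)]
      simp
    · congr 2
      refine key _ om ?_
      rw [hf, om_eq]
      push_cast
      linear_combination (-(Real.sqrt 3 : ℂ) / 2) * I_sq
  · congr 2
    rw [show z * om - conj z * conj om = z * conj (conj om) - conj z * conj om by rw [conj_conj]]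
    refine key _ (conj om) ?_
    rw [hf, om_eq]
    simp only [map_add, map_mul, conj_ofReal, conj_I, map_div₀, map_neg, map_one, map_ofNat]
    push_cast
    linear_combination ((Real.sqrt 3 : ℂ) / 2) * I_sq

theorem continuous_U : Continuous U := by
  have h : U = fun z => mode ![-1, -1] z + om * mode ![2, -1] z + om ^ 2 * mode ![-1, 2] z :=
    funext U_eq
  rw [h]
  exact ((continuous_mode _).add (continuous_const.mul (continuous_mode _))).add
    (continuous_const.mul (continuous_mode _))

theorem om_zpow_three_mul (m : ℤ) : om ^ (3 * m) = 1 := by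
  rw [zpow_mul, show om ^ (3 : ℤ) = 1 by exact_mod_cast om_cube, one_zpow]

theorem U_add_pt (a₁ a₂ : ℤ) (z : ℂ) : om ^ (a₁ + a₂) * U (z + pt a₁ a₂) = U z := by
  have h : ∀ n : Fin 2 → ℤ, ∀ m, n 0 * a₁ + n 1 * a₂ = -(a₁ + a₂) + 3 * m →
      om ^ (a₁ + a₂) * mode n (z + pt a₁ a₂) = mode n z := by
    intro n m hm
    rw [mode_add_right, mode_lattice, hm, zpow_add₀ om_ne_zero (-(a₁ + a₂)) (3 * m),
      om_zpow_three_mul, mul_one,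
      mul_left_comm, ← zpow_add₀ om_ne_zero, add_neg_cancel, zpow_zero, mul_one]
  have h1 := h ![-1, -1] 0 (by simp; ring)
  have h2 := h ![2, -1] a₁ (by simp; ring)
  have h3 := h ![-1, 2] a₂ (by simp; ring)
  rw [U_eq, U_eq]
  linear_combination h1 + om * h2 + om ^ 2 * h3

theorem U_neg_add_pt (a₁ a₂ : ℤ) (z : ℂ) : U (-(z + pt a₁ a₂)) = U (-z) * om ^ (a₁ + a₂) := by
  have h := U_add_pt (-a₁) (-a₂) (-z)
  have hp : pt ((-a₁ : ℤ) : ℝ) ((-a₂ : ℤ) : ℝ) = -pt a₁ a₂ := by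
    simp only [pt]; push_cast; ring
  rw [hp, ← neg_add, ← neg_add, zpow_neg] at h
  rw [← h, mul_comm, mul_inv_cancel_left₀ (zpow_ne_zero _ om_ne_zero)]

theorem goodPot_pot₁ (α : ℂ) : GoodPot kind₁ (pot₁ α) where
  continuous := by
    refine continuous_matrix fun i j => ?_
    have h1 := continuous_U
    have h2 : Continuous fun z => U (-z) := continuous_U.comp continuous_neg
    fin_cases i <;> fin_cases j <;> simp [pot₁] <;> fun_prop
  equivariant a₁ a₂ z j l := by
    have h1 := U_add_pt a₁ a₂ z
    have h2 := U_neg_add_pt a₁ a₂ z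
    fin_cases j <;> fin_cases l
    · simp [pot₁]
    · simp only [kindFactor, kind₁, pot₁, id]
      simp
      rw [← h1]; ring
    · simp only [kindFactor, kind₁, pot₁, id]
      simp only [Fin.mk_one, Fin.zero_eta, one_ne_zero, if_true, if_false, Matrix.of_apply,
        Matrix.cons_val]
      rw [h2]; ring
    · simp [pot₁]

theorem pot₁_neg (α z : ℂ) (i j : Fin 2) : pot₁ α (-z) i j = pot₁ α z j i := by
  fin_cases i <;> fin_cases j <;> simp [pot₁]

theorem pot₁_zero (z : ℂ) : pot₁ 0 z = 0 := by
  ext i j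
  fin_cases i <;> fin_cases j <;> simp [pot₁]

theorem goodPot_Tplus : GoodPot kind₁ fun _ => Tplus where
  continuous := continuous_const
  equivariant a₁ a₂ z j l := by
    fin_cases j <;> fin_cases l <;> simp [Tplus]

theorem goodPot_Tminus : GoodPot kind₁ fun _ => Tminus where
  continuous := continuous_const
  equivariant a₁ a₂ z j l := by
    fin_cases j <;> fin_cases l <;> simp [Tminus]

theorem goodPot_pot₂ (α : ℂ) (t : ℝ) : GoodPot kind₂ (pot₂ α t) where
  continuous := (goodPot_pot₁ α).continuous.matrix_fromBlocks continuous_const continuous_const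
    (goodPot_pot₁ 0).continuous
  equivariant a₁ a₂ z j l := by
    rcases j with j | j <;> rcases l with l | l
    · exact (goodPot_pot₁ α).equivariant a₁ a₂ z j l
    · have : kindFactor (kind₂ (Sum.inl j)) a₁ a₂ * Tplus j l =
          Tplus j l * kindFactor (kind₂ (Sum.inr l)) a₁ a₂ :=
        goodPot_Tplus.equivariant a₁ a₂ z j l
      simp only [pot₂, Matrix.fromBlocks_apply₁₂, Matrix.smul_apply, smul_eq_mul]
      linear_combination (t : ℂ) * this
    · have : kindFactor (kind₂ (Sum.inr j)) a₁ a₂ * Tminus j l =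
          Tminus j l * kindFactor (kind₂ (Sum.inl l)) a₁ a₂ :=
        goodPot_Tminus.equivariant a₁ a₂ z j l
      simp only [pot₂, Matrix.fromBlocks_apply₂₁, Matrix.smul_apply, smul_eq_mul]
      linear_combination (t : ℂ) * this
    · exact (goodPot_pot₁ 0).equivariant a₁ a₂ z j l

end Potential

/-! ### The uncoupled sheet at the Dirac point -/

section FreeOperator

variable {ι : Type} [Fintype ι] [DecidableEq ι]

theorem inner_mulOp_const (A : Matrix ι ι ℂ) (n : Fin 2 → ℤ) (j : ι) (v : L2 ι) :
    ⟪modeBasis ι (n, j), mulOp (fun _ => A) continuous_const v⟫ =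
      ∑ l, A j l * ⟪modeBasis ι (n, l), v⟫ := by
  simp only [inner_modeBasis]
  have h1 : ∫ z, conj (mode n z) * mulOp (fun _ => A) continuous_const v z j ∂μcell =
      ∫ z, ∑ l, A j l * (conj (mode n z) * v z l) ∂μcell := by
    apply integral_congr_ae
    filter_upwards [mulOp_coord continuous_const v] with z hz
    rw [hz, Finset.mul_sum]
    exact Finset.sum_congr rfl fun l _ => by ring
  rw [h1, integral_finsetSum]
  · rw [Finset.mul_sum]
    refine Finset.sum_congr rfl fun l _ => ?_
    rw [integral_const_mul]; ring
  · intro l _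
    refine Integrable.const_mul ?_ _
    have h2 : MemLp (fun z => conj (mode n z)) 2 μcell :=
      memLp_of_continuous (continuous_conj.comp (continuous_mode n)) 2
    exact h2.integrable_mul (memLp_coord v l)

theorem mulOp_eq_zero {V : ℂ → Matrix ι ι ℂ} (hV : Continuous V) (h : ∀ z, V z = 0) :
    mulOp V hV = 0 := by
  ext1 v
  apply Lp.ext
  filter_upwards [coeFn_mulOp hV v, Lp.coeFn_zero (EuclideanSpace ℂ ι) 2 μcell] with z h1 h2
  rw [h1, h, map_zero]
  exact h2.symm

/-- Without potential, `D + k` is the Fourier multiplier with symbol `freq n + k`. -/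
theorem isOp_free_iff {χ : ι → Fin 2} {V : ℂ → Matrix ι ι ℂ} (h : GoodPot χ V)
    (h0 : ∀ z, V z = 0) (k : ℂ) (v w : L20 χ) :
    IsOp (freeInv₀ χ) (lowerOrder₀ h k) v w ↔
      ∀ i, ⟪modeBasis ι i, (w : L2 ι)⟫ = (freq i.1 + k) * ⟪modeBasis ι i, (v : L2 ι)⟫ := by
  have hB : ∀ x : L20 χ, lowerOrder₀ h k x = (k - shift) • x := by
    intro x
    refine Subtype.ext ?_
    change lowerOrder V h.continuous k x = _
    rw [lowerOrder, mulOp_eq_zero _ h0, zero_add]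
    rfl
  constructor
  · rintro ⟨f, rfl, rfl⟩ i
    have h1 : ⟪modeBasis ι i, ((freeInv₀ χ f : L20 χ) : L2 ι)⟫ =
        (freq i.1 + shift)⁻¹ * ⟪modeBasis ι i, (f : L2 ι)⟫ := inner_freeInv i _
    rw [hB, Submodule.coe_add, Submodule.coe_smul, inner_add_right, inner_smul_right, h1]
    have := mul_inv_cancel₀ (freq_add_shift_ne_zero i.1)
    linear_combination (-⟪modeBasis ι i, (f : L2 ι)⟫) * this
  · intro hc
    refine ⟨w - (k - shift) • v, Subtype.ext (hilbertBasis_ext (modeBasis ι) fun i => ?_), ?_⟩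
    · have h1 : ⟪modeBasis ι i, ((freeInv₀ χ (w - (k - shift) • v) : L20 χ) : L2 ι)⟫ =
          (freq i.1 + shift)⁻¹ * ⟪modeBasis ι i, ((w - (k - shift) • v : L20 χ) : L2 ι)⟫ :=
        inner_freeInv i _
      rw [h1, Submodule.coe_sub, Submodule.coe_smul, inner_sub_right, inner_smul_right, hc,
        eq_inv_mul_iff_mul_eq₀ (freq_add_shift_ne_zero i.1)]
      ring
    · rw [hB, sub_add_cancel]

theorem isOp_free_adjoint_iff {χ : ι → Fin 2} {V : ℂ → Matrix ι ι ℂ} (h : GoodPot χ V)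
    (h0 : ∀ z, V z = 0) (k : ℂ) (v w : L20 χ) :
    IsOp (adjoint (freeInv₀ χ)) (adjoint (lowerOrder₀ h k)) v w ↔
      ∀ i, ⟪modeBasis ι i, (w : L2 ι)⟫ = conj (freq i.1 + k) * ⟪modeBasis ι i, (v : L2 ι)⟫ := by
  have hne : ∀ n, conj (freq n + shift) ≠ 0 := fun n =>
    (map_ne_zero _).2 (freq_add_shift_ne_zero n)
  have hB : ∀ x : L20 χ, adjoint (lowerOrder₀ h k) x = (conj k - conj shift) • x := by
    intro x
    rw [adjoint_lowerOrder₀]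
    refine Subtype.ext ?_
    change adjoint (lowerOrder V h.continuous k) x = _
    rw [adjoint_lowerOrder _ h.conjTranspose.continuous, mulOp_eq_zero _
      (fun z => by rw [h0, Matrix.conjTranspose_zero]), zero_add]
    rfl
  have hR : ∀ i (f : L20 χ), ⟪modeBasis ι i, ((adjoint (freeInv₀ χ) f : L20 χ) : L2 ι)⟫ =
      (conj (freq i.1 + shift))⁻¹ * ⟪modeBasis ι i, (f : L2 ι)⟫ := by
    intro i f
    rw [adjoint_freeInv₀]
    exact inner_adjoint_freeInv i _
  constructor
  · rintro ⟨f, rfl, rfl⟩ i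
    rw [hB, Submodule.coe_add, Submodule.coe_smul, inner_add_right, inner_smul_right, hR]
    have h1 := mul_inv_cancel₀ (hne i.1)
    rw [map_add] at h1 ⊢
    rw [map_add]
    linear_combination (-⟪modeBasis ι i, (f : L2 ι)⟫) * h1
  · intro hc
    refine ⟨w - (conj k - conj shift) • v,
      Subtype.ext (hilbertBasis_ext (modeBasis ι) fun i => ?_), ?_⟩
    · rw [hR, Submodule.coe_sub, Submodule.coe_smul, inner_sub_right, inner_smul_right, hc,
        eq_inv_mul_iff_mul_eq₀ (hne i.1), map_add, map_add]
      ring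
    · rw [hB, sub_add_cancel]

theorem freq_add_Kprime_eq_zero {n : Fin 2 → ℤ} (h : freq n + Kprime = 0) : n = ![-1, -1] := by
  have h1 := congrArg Complex.re h
  have h2 := congrArg Complex.im h
  have hs : Real.sqrt 3 ≠ 0 := by positivity
  rw [add_re, freq_re, Kprime, neg_re, I_re, zero_re, neg_zero, add_zero, neg_eq_zero,
    mul_eq_zero] at h1
  rw [add_im, freq_im, Kprime, neg_im, I_im, zero_im] at h2
  have h3 : (n 0 : ℝ) = n 1 := by
    rcases h1 with h1 | h1
    · exact absurd h1 (by positivity)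
    · linarith
  have h4 : (n 0 : ℝ) + n 1 = -2 := by linarith
  have h5 : n 0 = n 1 := by exact_mod_cast h3
  have h6 : n 0 + n 1 = -2 := by exact_mod_cast h4
  ext i
  fin_cases i
  · change n 0 = -1; omega
  · change n 1 = -1; omega

theorem freq_Dirac : freq ![-1, -1] + Kprime = 0 := by
  apply Complex.ext
  · simp [freq_re, Kprime]
  · simp [freq_im, Kprime]

theorem e₁_eq : e₁ = modeLp (![-1, -1], (0 : Fin 2)) := by
  unfold e₁ modeLp
  refine MemLp.toLp_congr _ _ (Filter.Eventually.of_forall fun z => ?_)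
  have hf : freq ![-1, -1] = I := by
    have := eq_neg_of_add_eq_zero_left freq_Dirac
    rwa [Kprime, neg_neg] at this
  ext j
  fin_cases j
  · simp [e₁fun, modeScale, mode, hf]
    left
    ring_nf
  · simp [e₁fun]

theorem adm_Dirac : Adm 0 ![-1, -1] := by
  intro a₁ a₂
  rw [mode_lattice, kindFactor, if_pos rfl, ← zpow_add₀ om_ne_zero]
  simp
  rw [show a₁ + a₂ + (-a₁ + -a₂) = 0 by ring, zpow_zero]

theorem om_ne_one : om ≠ 1 := by
  intro h
  have := om_re
  rw [h] at this
  norm_num at this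

theorem not_adm_Dirac : ¬ Adm 1 ![-1, -1] := by
  intro h
  have := h (-1) 0
  rw [mode_lattice, kindFactor] at this
  simp at this
  exact om_ne_one this

theorem adm_three_mul (m : ℤ) : Adm 1 ![3 * m, 0] := by
  intro a₁ a₂
  rw [mode_lattice, kindFactor]
  simp
  rw [mul_assoc, om_zpow_three_mul]

theorem e₁_mem : e₁ ∈ L20 kind₁ := by
  rw [e₁_eq]; exact modeLp_mem_L20 adm_Dirac

/-- The zero eigenfunction `e₁`, as an element of `L²_0`. -/
def e₁' : L20 kind₁ := ⟨e₁, e₁_mem⟩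

theorem norm_e₁' : ‖e₁'‖ = 1 := by
  change ‖e₁‖ = 1
  rw [e₁_eq]
  exact orthonormal_modeLp.1 _

theorem exists_smul_e₁' {v : L20 kind₁}
    (h : ∀ i : (Fin 2 → ℤ) × Fin 2, freq i.1 + Kprime ≠ 0 →
      ⟪modeBasis (Fin 2) i, (v : L2 (Fin 2))⟫ = 0) :
    ∃ c : ℂ, v = c • e₁' := by
  refine ⟨⟪e₁, (v : L2 (Fin 2))⟫, Subtype.ext (hilbertBasis_ext (modeBasis (Fin 2)) fun i => ?_)⟩
  rw [Submodule.coe_smul, inner_smul_right]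
  change _ = _ * ⟪modeBasis (Fin 2) i, e₁⟫
  obtain ⟨n, j⟩ := i
  have hon := orthonormal_iff_ite.1 (modeBasis (Fin 2)).orthonormal
  rw [e₁_eq, ← coe_modeBasis, hon]
  by_cases hn : n = ![-1, -1]
  · subst hn
    fin_cases j
    · simp
    · simpa using (mem_L20_iff kind₁ v).1 v.2 ![-1, -1] 1 not_adm_Dirac
  · have hne : ((n, j) : (Fin 2 → ℤ) × Fin 2) ≠ (![-1, -1], 0) := fun h0 =>
      hn (congrArg Prod.fst h0)
    rw [h (n, j) fun h0 => hn (freq_add_Kprime_eq_zero h0), if_neg hne, mul_zero]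

theorem inner_e₁' (i : (Fin 2 → ℤ) × Fin 2) (h : freq i.1 + Kprime ≠ 0) :
    ⟪modeBasis (Fin 2) i, (e₁' : L2 (Fin 2))⟫ = 0 := by
  change ⟪modeBasis (Fin 2) i, e₁⟫ = 0
  have hon := orthonormal_iff_ite.1 (modeBasis (Fin 2)).orthonormal
  rw [e₁_eq, ← coe_modeBasis, hon, if_neg]
  rintro rfl
  exact h freq_Dirac

/-- The mode of `e₁` is the only one with frequency `-K'`, and it is admissible only in the first
component. -/
theorem free_ker_iff (v : L20 kind₁) :
    IsOp (freeInv₀ kind₁) (lowerOrder₀ (goodPot_pot₁ 0) Kprime) v 0 ↔ ∃ c : ℂ, v = c • e₁' := by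
  rw [isOp_free_iff _ pot₁_zero]
  constructor
  · intro h
    refine exists_smul_e₁' fun i hi => ?_
    have := h i
    rw [Submodule.coe_zero, inner_zero_right, eq_comm, mul_eq_zero] at this
    exact this.resolve_left hi
  · rintro ⟨c, rfl⟩ i
    rw [Submodule.coe_zero, inner_zero_right, Submodule.coe_smul, inner_smul_right]
    by_cases hi : freq i.1 + Kprime = 0
    · rw [hi, zero_mul]
    · rw [inner_e₁' i hi, mul_zero, mul_zero]

theorem free_coker_iff (v : L20 kind₁) :
    IsOp (adjoint (freeInv₀ kind₁)) (adjoint (lowerOrder₀ (goodPot_pot₁ 0) Kprime)) v 0 ↔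
      ∃ c : ℂ, v = c • e₁' := by
  rw [isOp_free_adjoint_iff _ pot₁_zero]
  constructor
  · intro h
    refine exists_smul_e₁' fun i hi => ?_
    have := h i
    rw [Submodule.coe_zero, inner_zero_right, eq_comm, mul_eq_zero] at this
    exact this.resolve_left ((map_ne_zero _).2 hi)
  · rintro ⟨c, rfl⟩ i
    rw [Submodule.coe_zero, inner_zero_right, Submodule.coe_smul, inner_smul_right]
    by_cases hi : freq i.1 + Kprime = 0
    · rw [hi, map_zero, zero_mul]
    · rw [inner_e₁' i hi, mul_zero, mul_zero]

/-- Multiplication by `T₊` on `L²_0`. -/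
def TplusOp : L20 kind₁ →L[ℂ] L20 kind₁ :=
  (mulOp (fun _ => Tplus) continuous_const).restrict fun _ => goodPot_Tplus.mulOp_mem

/-- Multiplication by `T₋` on `L²_0`. -/
def TminusOp : L20 kind₁ →L[ℂ] L20 kind₁ :=
  (mulOp (fun _ => Tminus) continuous_const).restrict fun _ => goodPot_Tminus.mulOp_mem

theorem inner_TplusOp (i : (Fin 2 → ℤ) × Fin 2) (v : L20 kind₁) :
    ⟪modeBasis (Fin 2) i, (TplusOp v : L2 (Fin 2))⟫ =
      (if i.2 = 0 then 1 else 0) * ⟪modeBasis (Fin 2) i, (v : L2 (Fin 2))⟫ := by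
  obtain ⟨n, j⟩ := i
  refine (inner_mulOp_const Tplus n j v).trans ?_
  rw [Fin.sum_univ_two]
  fin_cases j <;> simp [Tplus]

theorem inner_TminusOp (i : (Fin 2 → ℤ) × Fin 2) (v : L20 kind₁) :
    ⟪modeBasis (Fin 2) i, (TminusOp v : L2 (Fin 2))⟫ =
      (if i.2 = 0 then 0 else 1) * ⟪modeBasis (Fin 2) i, (v : L2 (Fin 2))⟫ := by
  obtain ⟨n, j⟩ := i
  refine (inner_mulOp_const Tminus n j v).trans ?_
  rw [Fin.sum_univ_two]
  fin_cases j <;> simp [Tminus]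

theorem L20_ext {χ : ι → Fin 2} {v w : L20 χ}
    (h : ∀ i, ⟪modeBasis ι i, (v : L2 ι)⟫ = ⟪modeBasis ι i, (w : L2 ι)⟫) : v = w :=
  Subtype.ext (hilbertBasis_ext (modeBasis ι) h)

theorem conjTranspose_Tplus : Tplus.conjTranspose = Tplus := by
  ext i j; fin_cases i <;> fin_cases j <;> simp [Tplus]

theorem conjTranspose_Tminus : Tminus.conjTranspose = Tminus := by
  ext i j; fin_cases i <;> fin_cases j <;> simp [Tminus]

theorem mulOp_const_symm {A : Matrix ι ι ℂ} (hA : A.conjTranspose = A) (v w : L2 ι) :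
    ⟪mulOp (fun _ => A) continuous_const v, w⟫ = ⟪v, mulOp (fun _ => A) continuous_const w⟫ := by
  rw [← adjoint_inner_right, adjoint_mulOp continuous_const continuous_const]
  simp only [hA]

theorem TplusOp_e₁' : TplusOp e₁' = e₁' := by
  refine L20_ext fun i => ?_
  rw [inner_TplusOp]
  split_ifs with h
  · rw [one_mul]
  · have hon := orthonormal_iff_ite.1 (modeBasis (Fin 2)).orthonormal
    change _ = ⟪modeBasis (Fin 2) i, e₁⟫
    rw [e₁_eq, ← coe_modeBasis, hon, if_neg, zero_mul]
    rintro rfl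
    exact h rfl

theorem TplusE₁_eq : TplusE₁ = e₁ := by
  have h : (TplusOp e₁' : L2 (Fin 2)) = e₁ := congrArg Subtype.val TplusOp_e₁'
  rw [← h]
  apply Lp.ext
  filter_upwards [ContinuousLinearMap.coeFn_compLp (Matrix.toEuclideanCLM (𝕜 := ℂ) Tplus) e₁,
    coeFn_mulOp (V := fun _ => Tplus) continuous_const e₁] with z h1 h2
  exact h1.trans h2.symm

/-- All conditions on the coupling are checked on Fourier coefficients: `D(0) + K'` and the
projections `T₊`, `T₋` are diagonal in the Fourier basis. -/
theorem exists_twoSheet {B : L20 kind₁ →L[ℂ] L20 kind₁} {u u' : L20 kind₁}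
    {G : L20 kind₁ →L[ℂ] L20 kind₁} (hG : IsPinv (freeInv₀ kind₁) B u u' G) :
    ∃ G₀, TwoSheet (freeInv₀ kind₁) B (lowerOrder₀ (goodPot_pot₁ 0) Kprime) TplusOp TminusOp
      G G₀ u u' e₁' := by
  obtain ⟨G₀, hG₀⟩ := exists_isPinv (isCompactOperator_freeInv₀ kind₁) (freeInv₀_injective kind₁)
    norm_e₁' norm_e₁' free_ker_iff free_coker_iff
  refine ⟨G₀, hG, hG₀, hG₀.adjoint_isPinv (isCompactOperator_adjoint_freeInv₀ _)
    (adjoint_freeInv₀_injective _), ?_, ?_, ?_, TplusOp_e₁', ?_, ?_, ?_, ?_, ?_, ?_⟩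
  · intro v
    refine L20_ext fun i => ?_
    rw [Submodule.coe_add, inner_add_right, inner_TplusOp, inner_TminusOp]
    split_ifs <;> simp
  · intro v
    refine L20_ext fun i => ?_
    rw [inner_TplusOp, inner_TminusOp]
    split_ifs <;> simp
  · intro v
    refine L20_ext fun i => ?_
    rw [inner_TminusOp, inner_TplusOp]
    split_ifs <;> simp
  · intro v w
    exact mulOp_const_symm conjTranspose_Tplus (v : L2 (Fin 2)) w
  · intro v w
    exact mulOp_const_symm conjTranspose_Tminus (v : L2 (Fin 2)) w
  · intro v
    have := norm_le_of_coeff (modeBasis (Fin 2)) (C := 1) zero_le_one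
      (x := (v : L2 (Fin 2))) (y := (TplusOp v : L2 (Fin 2))) fun i => by
        rw [inner_TplusOp]; split_ifs <;> simp
    rwa [one_mul] at this
  · intro v
    have := norm_le_of_coeff (modeBasis (Fin 2)) (C := 1) zero_le_one
      (x := (v : L2 (Fin 2))) (y := (TminusOp v : L2 (Fin 2))) fun i => by
        rw [inner_TminusOp]; split_ifs <;> simp
    rwa [one_mul] at this
  · intro v y h
    rw [isOp_free_iff _ pot₁_zero] at h ⊢
    intro i
    rw [inner_TplusOp, inner_TplusOp, h, mul_left_comm]
  · intro v y h
    rw [isOp_free_adjoint_iff _ pot₁_zero] at h ⊢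
    intro i
    rw [inner_TminusOp, inner_TminusOp, h, mul_left_comm]

end FreeOperator

/-! ### Functions on two sheets -/

section Sheets

variable {ι κ : Type} [Fintype ι] [Fintype κ]

/-- The components of a vector with indices in the range of `g`. -/
def coordPull (g : κ → ι) : EuclideanSpace ℂ ι →L[ℂ] EuclideanSpace ℂ κ :=
  LinearMap.toContinuousLinearMap
    { toFun := fun x => WithLp.toLp 2 fun j => x (g j)
      map_add' := fun _ _ => rfl
      map_smul' := fun _ _ => rfl }

/-- The components of a function in `L²(ℂ/3Λ; ℂ^ι)` with indices in the range of `g`. -/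
def pull (g : κ → ι) : L2 ι →L[ℂ] L2 κ := (coordPull g).compLpL 2 μcell

theorem pull_coord (g : κ → ι) (v : L2 ι) : ∀ᵐ z ∂μcell, ∀ j, pull g v z j = v z (g j) := by
  filter_upwards [(coordPull g).coeFn_compLpL v] with z hz j
  rw [pull, hz]; rfl

theorem inner_pull [DecidableEq ι] [DecidableEq κ] (g : κ → ι) (n : Fin 2 → ℤ) (j : κ) (v : L2 ι) :
    ⟪modeBasis κ (n, j), pull g v⟫ = ⟪modeBasis ι (n, g j), v⟫ := by
  rw [inner_modeBasis, inner_modeBasis]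
  congr 1
  apply integral_congr_ae
  filter_upwards [pull_coord g v] with z hz
  rw [hz]

/-- Two functions on one sheet form a function on two sheets. -/
theorem exists_join (v w : L2 (Fin 2)) :
    ∃ x : L2 (Fin 2 ⊕ Fin 2), pull Sum.inl x = v ∧ pull Sum.inr x = w := by
  let L₁ : EuclideanSpace ℂ (Fin 2) →L[ℂ] EuclideanSpace ℂ (Fin 2 ⊕ Fin 2) :=
    LinearMap.toContinuousLinearMap
      { toFun := fun x => WithLp.toLp 2 (Sum.elim x 0)
        map_add' := fun x y => by ext (j | j) <;> simp
        map_smul' := fun c x => by ext (j | j) <;> simp }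
  let L₂ : EuclideanSpace ℂ (Fin 2) →L[ℂ] EuclideanSpace ℂ (Fin 2 ⊕ Fin 2) :=
    LinearMap.toContinuousLinearMap
      { toFun := fun x => WithLp.toLp 2 (Sum.elim 0 x)
        map_add' := fun x y => by ext (j | j) <;> simp
        map_smul' := fun c x => by ext (j | j) <;> simp }
  have h : ∀ᵐ z ∂μcell, ∀ j, (L₁.compLp v + L₂.compLp w) z j = Sum.elim (v z) (w z) j := by
    filter_upwards [L₁.coeFn_compLp v, L₂.coeFn_compLp w,
      Lp.coeFn_add (L₁.compLp v) (L₂.compLp w)] with z h1 h2 h3 j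
    rw [h3, Pi.add_apply, h1, h2]
    rcases j with j | j <;> simp [L₁, L₂]
  refine ⟨L₁.compLp v + L₂.compLp w, ?_, ?_⟩
  · apply Lp.ext
    filter_upwards [h, pull_coord Sum.inl (L₁.compLp v + L₂.compLp w)] with z h1 h2
    ext j
    rw [h2, h1]; rfl
  · apply Lp.ext
    filter_upwards [h, pull_coord Sum.inr (L₁.compLp v + L₂.compLp w)] with z h1 h2
    ext j
    rw [h2, h1]; rfl

theorem inner_eq_pull (x y : L2 (Fin 2 ⊕ Fin 2)) :
    ⟪x, y⟫ = ⟪pull Sum.inl x, pull Sum.inl y⟫ + ⟪pull Sum.inr x, pull Sum.inr y⟫ := by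
  rw [L2.inner_def, L2.inner_def, L2.inner_def,
    ← integral_add (L2.integrable_inner _ _) (L2.integrable_inner _ _)]
  apply integral_congr_ae
  filter_upwards [pull_coord Sum.inl x, pull_coord Sum.inl y, pull_coord Sum.inr x,
    pull_coord Sum.inr y] with z h1 h2 h3 h4
  simp only [PiLp.inner_apply, Fintype.sum_sum_type, h1, h2, h3, h4]

theorem pull_mem {χ : ι → Fin 2} {χ' : κ → Fin 2} {g : κ → ι} (hg : ∀ j, χ (g j) = χ' j)
    {v : L2 ι} (hv : v ∈ L20 χ) : pull g v ∈ L20 χ' := by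
  classical
  rw [mem_L20_iff] at hv ⊢
  intro n j hn
  rw [inner_pull]
  exact hv n (g j) (by rwa [hg])

theorem mem_L20_of_pull {v : L2 (Fin 2 ⊕ Fin 2)} (h1 : pull Sum.inl v ∈ L20 kind₁)
    (h2 : pull Sum.inr v ∈ L20 kind₁) : v ∈ L20 kind₂ := by
  rw [mem_L20_iff] at h1 h2 ⊢
  rintro n (j | j) hn
  · rw [← inner_pull]; exact h1 n j hn
  · rw [← inner_pull]; exact h2 n j hn

theorem pull_freeInv [DecidableEq ι] [DecidableEq κ] (g : κ → ι) (v : L2 ι) :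
    pull g (freeInv ι v) = freeInv κ (pull g v) :=
  hilbertBasis_ext (modeBasis κ) fun ⟨n, j⟩ => by
    rw [inner_pull, inner_freeInv, inner_freeInv, inner_pull]

theorem pull_adjoint_freeInv [DecidableEq ι] [DecidableEq κ] (g : κ → ι) (v : L2 ι) :
    pull g (adjoint (freeInv ι) v) = adjoint (freeInv κ) (pull g v) :=
  hilbertBasis_ext (modeBasis κ) fun ⟨n, j⟩ => by
    rw [inner_pull, inner_adjoint_freeInv, inner_adjoint_freeInv, inner_pull]

theorem pull_mulOp {V : ℂ → Matrix (Fin 2 ⊕ Fin 2) (Fin 2 ⊕ Fin 2) ℂ} (hV : Continuous V)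
    {A D : ℂ → Matrix (Fin 2) (Fin 2) ℂ} (hA : Continuous A) (hD : Continuous D)
    {P Q : Matrix (Fin 2) (Fin 2) ℂ} {t : ℂ}
    (h : ∀ z, V z = Matrix.fromBlocks (A z) (t • P) (t • Q) (D z)) (v : L2 (Fin 2 ⊕ Fin 2)) :
    pull Sum.inl (mulOp V hV v) = mulOp A hA (pull Sum.inl v) +
        t • mulOp (fun _ => P) continuous_const (pull Sum.inr v) ∧
      pull Sum.inr (mulOp V hV v) = mulOp D hD (pull Sum.inr v) +
        t • mulOp (fun _ => Q) continuous_const (pull Sum.inl v) := by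
  constructor
  · apply Lp.ext
    filter_upwards [pull_coord Sum.inl (mulOp V hV v), mulOp_coord hV v,
      mulOp_coord hA (pull Sum.inl v),
      mulOp_coord (V := fun _ => P) continuous_const (pull Sum.inr v),
      Lp.coeFn_add (mulOp A hA (pull Sum.inl v))
        (t • mulOp (fun _ => P) continuous_const (pull Sum.inr v)),
      Lp.coeFn_smul t (mulOp (fun _ => P) continuous_const (pull Sum.inr v)),
      pull_coord Sum.inl v, pull_coord Sum.inr v] with z h1 h2 h3 h4 h5 h6 h7 h8
    ext j
    rw [h1, h2, h5, Pi.add_apply, PiLp.add_apply, h3, h6, Pi.smul_apply, PiLp.smul_apply, h4,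
      Fintype.sum_sum_type, h, smul_eq_mul, Finset.mul_sum]
    simp only [Matrix.fromBlocks_apply₁₁, Matrix.fromBlocks_apply₁₂, Matrix.smul_apply,
      smul_eq_mul, h7, h8, mul_assoc]
  · apply Lp.ext
    filter_upwards [pull_coord Sum.inr (mulOp V hV v), mulOp_coord hV v,
      mulOp_coord hD (pull Sum.inr v),
      mulOp_coord (V := fun _ => Q) continuous_const (pull Sum.inl v),
      Lp.coeFn_add (mulOp D hD (pull Sum.inr v))
        (t • mulOp (fun _ => Q) continuous_const (pull Sum.inl v)),
      Lp.coeFn_smul t (mulOp (fun _ => Q) continuous_const (pull Sum.inl v)),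
      pull_coord Sum.inr v, pull_coord Sum.inl v] with z h1 h2 h3 h4 h5 h6 h7 h8
    ext j
    rw [h1, h2, h5, Pi.add_apply, PiLp.add_apply, h3, h6, Pi.smul_apply, PiLp.smul_apply, h4,
      Fintype.sum_sum_type, h, smul_eq_mul, Finset.mul_sum, add_comm]
    simp only [Matrix.fromBlocks_apply₂₁, Matrix.fromBlocks_apply₂₂, Matrix.smul_apply,
      smul_eq_mul, h7, h8, mul_assoc]

theorem pull_inl_mem {v : L2 (Fin 2 ⊕ Fin 2)} (hv : v ∈ L20 kind₂) :
    pull Sum.inl v ∈ L20 kind₁ :=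
  pull_mem (χ := kind₂) (χ' := kind₁) (g := Sum.inl) (fun _ => rfl) hv

theorem pull_inr_mem {v : L2 (Fin 2 ⊕ Fin 2)} (hv : v ∈ L20 kind₂) :
    pull Sum.inr v ∈ L20 kind₁ :=
  pull_mem (χ := kind₂) (χ' := kind₁) (g := Sum.inr) (fun _ => rfl) hv

/-- The first sheet of a function on two sheets. -/
def sheet₁ : L20 kind₂ →L[ℂ] L20 kind₁ := (pull Sum.inl).restrict fun _ => pull_inl_mem

/-- The second sheet of a function on two sheets. -/
def sheet₂ : L20 kind₂ →L[ℂ] L20 kind₁ := (pull Sum.inr).restrict fun _ => pull_inr_mem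

theorem isSheetSplit_sheets : IsSheetSplit sheet₁ sheet₂ where
  inner_eq x y := inner_eq_pull (x : L2 (Fin 2 ⊕ Fin 2)) y
  surj v w := by
    obtain ⟨x, h1, h2⟩ := exists_join v w
    have hx : x ∈ L20 kind₂ := mem_L20_of_pull (h1 ▸ v.2) (h2 ▸ w.2)
    exact ⟨⟨x, hx⟩, Subtype.ext h1, Subtype.ext h2⟩

theorem coe_sheet₁ (x : L20 kind₂) :
    (sheet₁ x : L2 (Fin 2)) = pull Sum.inl (x : L2 (Fin 2 ⊕ Fin 2)) := rfl

theorem coe_sheet₂ (x : L20 kind₂) :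
    (sheet₂ x : L2 (Fin 2)) = pull Sum.inr (x : L2 (Fin 2 ⊕ Fin 2)) := rfl

theorem coe_TplusOp (x : L20 kind₁) :
    (TplusOp x : L2 (Fin 2)) = mulOp (fun _ => Tplus) continuous_const (x : L2 (Fin 2)) := rfl

theorem coe_TminusOp (x : L20 kind₁) :
    (TminusOp x : L2 (Fin 2)) = mulOp (fun _ => Tminus) continuous_const (x : L2 (Fin 2)) := rfl

section

variable [DecidableEq ι] {χ : ι → Fin 2} {V : ℂ → Matrix ι ι ℂ}

theorem coe_freeInv₀ (x : L20 χ) : (freeInv₀ χ x : L2 ι) = freeInv ι (x : L2 ι) := rfl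

theorem coe_adjoint_freeInv₀ (x : L20 χ) :
    ((adjoint (freeInv₀ χ) x : L20 χ) : L2 ι) = adjoint (freeInv ι) (x : L2 ι) := by
  rw [adjoint_freeInv₀]; rfl

theorem coe_lowerOrder₀ (h : GoodPot χ V) (k : ℂ) (x : L20 χ) :
    (lowerOrder₀ h k x : L2 ι) =
      mulOp V h.continuous (x : L2 ι) + (k - shift) • (x : L2 ι) := rfl

theorem coe_adjoint_lowerOrder₀ (h : GoodPot χ V) (k : ℂ) (x : L20 χ) :
    ((adjoint (lowerOrder₀ h k) x : L20 χ) : L2 ι) =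
      mulOp (fun z => (V z).conjTranspose) h.conjTranspose.continuous (x : L2 ι) +
        (conj k - conj shift) • (x : L2 ι) := by
  rw [adjoint_lowerOrder₀]
  change adjoint (lowerOrder V h.continuous k) (x : L2 ι) = _
  rw [adjoint_lowerOrder _ h.conjTranspose.continuous]
  rfl

end

/-- `D₂(α; t) + k` as a coupled pair of operators on two sheets. -/
theorem isOp_pot₂_iff (α : ℂ) (t : ℝ) (k : ℂ) (x y : L20 kind₂) :
    IsOp (freeInv₀ kind₂) (lowerOrder₀ (goodPot_pot₂ α t) k) x y ↔
      PairOp (freeInv₀ kind₁) (lowerOrder₀ (goodPot_pot₁ α) k) (lowerOrder₀ (goodPot_pot₁ 0) k)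
        TplusOp TminusOp t (sheet₁ x) (sheet₂ x) (sheet₁ y) (sheet₂ y) := by
  have hmul := pull_mulOp (goodPot_pot₂ α t).continuous (goodPot_pot₁ α).continuous
    (goodPot_pot₁ 0).continuous (P := Tplus) (Q := Tminus) (t := t) (fun z => rfl)
  have h1 : ∀ x : L20 kind₂, sheet₁ (freeInv₀ kind₂ x) = freeInv₀ kind₁ (sheet₁ x) := fun x =>
    Subtype.ext (by simp only [coe_sheet₁, coe_freeInv₀, pull_freeInv])
  have h2 : ∀ x : L20 kind₂, sheet₂ (freeInv₀ kind₂ x) = freeInv₀ kind₁ (sheet₂ x) := fun x =>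
    Subtype.ext (by simp only [coe_sheet₂, coe_freeInv₀, pull_freeInv])
  refine isOp_iff_pairOp isSheetSplit_sheets h1 h2 (fun x => Subtype.ext ?_)
    (fun x => Subtype.ext ?_) x y
  · rw [coe_sheet₁, coe_lowerOrder₀, Submodule.coe_add, Submodule.coe_smul, coe_lowerOrder₀,
      coe_TplusOp, coe_sheet₁, coe_sheet₂, map_add, map_smul, (hmul x).1, add_right_comm]
  · rw [coe_sheet₂, coe_lowerOrder₀, Submodule.coe_add, Submodule.coe_smul, coe_lowerOrder₀,
      coe_TminusOp, coe_sheet₁, coe_sheet₂, map_add, map_smul, (hmul x).2, add_right_comm]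

theorem isOp_adjoint_pot₂_iff (α : ℂ) (t : ℝ) (k : ℂ) (x y : L20 kind₂) :
    IsOp (adjoint (freeInv₀ kind₂)) (adjoint (lowerOrder₀ (goodPot_pot₂ α t) k)) x y ↔
      PairOp (adjoint (freeInv₀ kind₁)) (adjoint (lowerOrder₀ (goodPot_pot₁ α) k))
        (adjoint (lowerOrder₀ (goodPot_pot₁ 0) k)) TminusOp TplusOp t
        (sheet₁ x) (sheet₂ x) (sheet₁ y) (sheet₂ y) := by
  have hmul := pull_mulOp (goodPot_pot₂ α t).conjTranspose.continuous
    (goodPot_pot₁ α).conjTranspose.continuous (goodPot_pot₁ 0).conjTranspose.continuous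
    (P := Tminus) (Q := Tplus) (t := t) (fun z => by
      rw [pot₂, Matrix.fromBlocks_conjTranspose, Matrix.conjTranspose_smul,
        Matrix.conjTranspose_smul, conjTranspose_Tplus, conjTranspose_Tminus]
      simp)
  have h1 : ∀ x : L20 kind₂, sheet₁ (adjoint (freeInv₀ kind₂) x) =
      adjoint (freeInv₀ kind₁) (sheet₁ x) := fun x => Subtype.ext (by
    simp only [coe_sheet₁, coe_adjoint_freeInv₀, pull_adjoint_freeInv])
  have h2 : ∀ x : L20 kind₂, sheet₂ (adjoint (freeInv₀ kind₂) x) =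
      adjoint (freeInv₀ kind₁) (sheet₂ x) := fun x => Subtype.ext (by
    simp only [coe_sheet₂, coe_adjoint_freeInv₀, pull_adjoint_freeInv])
  refine isOp_iff_pairOp isSheetSplit_sheets h1 h2 (fun x => Subtype.ext ?_)
    (fun x => Subtype.ext ?_) x y
  · rw [coe_sheet₁, coe_adjoint_lowerOrder₀, Submodule.coe_add, Submodule.coe_smul,
      coe_adjoint_lowerOrder₀, coe_TminusOp, coe_sheet₁, coe_sheet₂, map_add, map_smul,
      (hmul x).1, add_right_comm]
  · rw [coe_sheet₂, coe_adjoint_lowerOrder₀, Submodule.coe_add, Submodule.coe_smul,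
      coe_adjoint_lowerOrder₀, coe_TplusOp, coe_sheet₁, coe_sheet₂, map_add, map_smul,
      (hmul x).2, add_right_comm]

end Sheets

/-! ### The theorem -/

section Final

/-- Infinitely many modes are admissible in the second component. -/
theorem L20_infinite : ¬ FiniteDimensional ℂ (L20 kind₁) := by
  intro hfin
  let f : ℤ → L20 kind₁ := fun m =>
    ⟨modeLp (![3 * m, 0], (1 : Fin 2)), modeLp_mem_L20 (adm_three_mul m)⟩
  have hf : Orthonormal ℂ f := by
    have h : Function.Injective fun m : ℤ => ((![3 * m, 0], 1) : (Fin 2 → ℤ) × Fin 2) := by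
      intro a b hab
      have h1 := congrFun (congrArg Prod.fst hab) 0
      simpa using h1
    have := (orthonormal_modeLp (ι := Fin 2)).comp _ h
    exact ⟨fun m => this.1 m, fun a b hab => this.2 hab⟩
  have := hf.linearIndependent.finite
  exact not_finite ℤ

/-- At the Dirac point, kernel and cokernel of `D(α) + K'` are lines for a simple magic `α`. -/
theorem exists_lines_of_simple {α : ℂ} (hα : IsSimpleMagic α) : ∃ u u' G,
    IsPinv (freeInv₀ kind₁) (lowerOrder₀ (goodPot_pot₁ α) Kprime) u u' G := by
  have h1 := (isBandEnergy_iff (goodPot_pot₁ α) Kprime 1 0).1 (hα.1 Kprime)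
  have h2 : ¬ IsOpBand (freeInv₀ kind₁) (lowerOrder₀ (goodPot_pot₁ α) Kprime) 2 0 := fun h =>
    lt_irrefl _ (hα.2 Kprime 0 ((isBandEnergy_iff (goodPot_pot₁ α) Kprime 2 0).2 h))
  obtain ⟨u, u', hu, hu', hker, hcoker⟩ := exists_ker_coker_lines (conjReflect₀ kind₁)
    (fun v => Subtype.ext (conjReflect_conjReflect (v : L2 (Fin 2))))
    (fun v => (conjReflect (Fin 2)).norm_map (v : L2 (Fin 2)))
    (isOp_conjReflect₀ (goodPot_pot₁ α) (pot₁_neg α) Kprime)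
    (isOp_conjReflect₀_adjoint (goodPot_pot₁ α) (pot₁_neg α) Kprime) h1 h2
  obtain ⟨G, hG⟩ := exists_isPinv (isCompactOperator_freeInv₀ kind₁) (freeInv₀_injective kind₁)
    hu hu' hker hcoker
  exact ⟨u, u', G, hG⟩

instance : TopologicalSpace.SeparableSpace (L20 kind₁) := by
  have : Fact ((2 : ENNReal) ≠ ⊤) := ⟨by norm_num⟩
  have : IsSeparable μcell := by unfold μcell; infer_instance
  have : SecondCountableTopology (L2 (Fin 2)) := inferInstance
  infer_instance

theorem exists_isEigensystem {α : ℂ} {u u' : L20 kind₁} {G : L20 kind₁ →L[ℂ] L20 kind₁}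
    (h : IsPinv (freeInv₀ kind₁) (lowerOrder₀ (goodPot_pot₁ α) Kprime) u u' G) :
    ∃ (v w : ℕ → L2 (Fin 2)) (z : ℕ → ℝ), IsEigensystem α Kprime v w z := by
  obtain ⟨v, w, z, hv, hz, hD, hD', hc⟩ := exists_singular_system L20_infinite h
    (h.adjoint_isPinv (isCompactOperator_adjoint_freeInv₀ _) (adjoint_freeInv₀_injective _))
  refine ⟨fun i => v i, fun i => w i, z, ⟨hv.1, hv.2⟩, hz, fun i => ?_, fun i => ?_, ?_⟩
  · exact (isD_coe_iff _ _ _ _).2 (hD i)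
  · exact (isDadj_coe_iff _ _ _ _).2 (hD' i)
  · intro x hx ho
    exact (isD_coe_iff (goodPot_pot₁ α) Kprime ⟨x, hx⟩ 0).2 (hc ⟨x, hx⟩ ho)

theorem hasSum_isEigensystem {α : ℂ} {u u' : L20 kind₁} {G : L20 kind₁ →L[ℂ] L20 kind₁}
    (h : IsPinv (freeInv₀ kind₁) (lowerOrder₀ (goodPot_pot₁ α) Kprime) u u' G)
    {v w : ℕ → L2 (Fin 2)} {z : ℕ → ℝ} (hE : IsEigensystem α Kprime v w z) :
    HasSum (fun i => ‖⟪TplusE₁, w i⟫‖ ^ 2 / z i) (1 - ‖⟪u', e₁'⟫‖ ^ 2) := by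
  have hv : ∀ i, v i ∈ L20 kind₁ := fun i => (hE.apply_D i).1
  have hw : ∀ i, w i ∈ L20 kind₁ := fun i => (hE.apply_Dadj i).1
  have key := hasSum_singular_system h (v := fun i => ⟨v i, hv i⟩)
    (w := fun i => ⟨w i, hw i⟩) (z := z)
    ⟨hE.orthonormal.1, fun i j hij => hE.orthonormal.2 hij⟩ hE.ne_zero
    (fun i => (isD_coe_iff (goodPot_pot₁ α) Kprime ⟨v i, hv i⟩ ⟨w i, hw i⟩).1 (hE.apply_D i))
    (fun i => (isDadj_coe_iff (goodPot_pot₁ α) Kprime ⟨w i, hw i⟩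
      ((z i : ℂ) • ⟨v i, hv i⟩)).1 (hE.apply_Dadj i))
    (fun x hx => (isD_coe_iff (goodPot_pot₁ α) Kprime x 0).1 (hE.complete x x.2 hx)) norm_e₁'
  have h2 : ∀ i, ⟪TplusE₁, w i⟫ = ⟪e₁', (⟨w i, hw i⟩ : L20 kind₁)⟫ := fun i => by
    rw [TplusE₁_eq]; rfl
  simp only [h2]
  exact key

end Final

end Graphene

end

theorem theorem2 (α : ℂ) (hα : Graphene.IsSimpleMagic α) :
    ∃ S : ℝ, S ≤ 1 ∧
      (∃ (u w : ℕ → Graphene.L2 (Fin 2)) (z : ℕ → ℝ),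
        Graphene.IsEigensystem α Graphene.Kprime u w z) ∧
      (∀ (u w : ℕ → Graphene.L2 (Fin 2)) (z : ℕ → ℝ),
        Graphene.IsEigensystem α Graphene.Kprime u w z →
          HasSum (fun i => ‖inner ℂ Graphene.TplusE₁ (w i)‖ ^ 2 / z i) S) ∧
      ∃ δ > (0 : ℝ), ∃ M : ℝ, ∀ t : ℝ, 0 < t → t < δ →
        Graphene.IsBandEnergy Graphene.kind₂ (Graphene.pot₂ α t) Graphene.Kprime 1 0 ∧
        ∃ E₂ : ℝ,
          Graphene.IsBandEnergy Graphene.kind₂ (Graphene.pot₂ α t) Graphene.Kprime 2 E₂ ∧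
          |E₂ - Real.sqrt (1 - S) * t| ≤ M * t ^ (3 / 2 : ℝ) := by
  obtain ⟨u, u', G, hG⟩ := Graphene.exists_lines_of_simple hα
  obtain ⟨G₀, hT⟩ := Graphene.exists_twoSheet hG
  obtain ⟨M, hM⟩ := hT.exists_band_energies Graphene.isSheetSplit_sheets
  refine ⟨1 - ‖inner ℂ u' Graphene.e₁'‖ ^ 2, sub_le_self _ (sq_nonneg _),
    Graphene.exists_isEigensystem hG, fun _ _ _ => Graphene.hasSum_isEigensystem hG,
    1, one_pos, |M|, fun t ht ht1 => ?_⟩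
  obtain ⟨h1, E₂, h2, h3⟩ := hM t _ _ ht ht1 (Graphene.isCompactOperator_freeInv₀ Graphene.kind₂)
    (Graphene.isCompactOperator_adjoint_freeInv₀ _) (Graphene.freeInv₀_injective _)
    (Graphene.adjoint_freeInv₀_injective _) (Graphene.isOp_pot₂_iff α t Graphene.Kprime)
    (Graphene.isOp_adjoint_pot₂_iff α t Graphene.Kprime)
  refine ⟨(Graphene.isBandEnergy_iff _ _ _ _).2 h1, E₂,
    (Graphene.isBandEnergy_iff _ _ _ _).2 h2, ?_⟩
  rw [sub_sub_cancel, Real.sqrt_sq (norm_nonneg _)]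
  -- The error is of order `t²`, which is better than `t^(3/2)` since `t < 1`.
  have hpow : t ^ 2 ≤ t ^ (3 / 2 : ℝ) := by
    rw [← Real.rpow_natCast]
    exact Real.rpow_le_rpow_of_exponent_ge ht ht1.le (by norm_num)
  exact h3.trans ((mul_le_mul_of_nonneg_right (le_abs_self M) (sq_nonneg t)).trans
    (mul_le_mul_of_nonneg_left hpow (abs_nonneg M)))
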